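/- **Conventions.** Conjugation is $C^x=x^{-1}Cx$. A graph of groups $\mathbb A$ has a graph with fixed-point-free inversion of edges, vertex groups $A_v$, edge groups $A_e=A_{e^{-1}}$ and monomorphisms $\alpha_e:A_e\to A_{o(e)}$, $\omega_e=\alpha_{e^{-1}}:A_e\to A_{t(e)}$. An $\mathbb A$-path $\langle p_0,e_1,p_1,\dots,e_n,p_n\rangle$ is an edge path with vertex group elements; $\equiv$ is the equivalence generated by the elementary reductions $\langle a,e,\omega_e(c),e^{-1},b\rangle\to\langle a\,\alpha_e(c)\,b\rangle$ of subpaths; a path is reduced if no elementary reduction applies, and a loop $p$ is cyclically reduced if $p$ and $p^2$ are reduced. An $\mathbb A$-graph $\mathbb B$ is a graph with a graph morphism $[\cdot]$ to the graph of $\mathbb A$, subgroups $B_u\le A_{[u]}$ for its vertices $u$, and elements $f_\alpha\in A_{[o(f)]}$, $f_\omega\in A_{[t(f)]}$ for its edges $f$, with $(f^{-1})_\alpha=(f_\omega)^{-1}$. It is a graph of groups with vertex groups $B_u$, edge groups $$B_f=\alpha_{[f]}^{-1}(B_{o(f)}^{f_\alpha})\cap\omega_{[f]}^{-1}(B_{t(f)}^{f_\omega^{-1}})$$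 and monomorphisms $c\mapsto f_\alpha\alpha_{[f]}(c)f_\alpha^{-1}$, $c\mapsto f_\omega^{-1}\omega_{[f]}(c)f_\omega$. For a $\mathbb B$-path $q=\langle q_0,f_1,q_1,\dots,f_k,q_k\rangle$ put $\mu(q)=\langle q_0(f_1)_\alpha,[f_1],(f_1)_\omega q_1(f_2)_\alpha,[f_2],\dots,[f_k],(f_k)_\omega q_k\rangle$. $\mathbb B$ is *folded* if (I) there are no edges $f_1,f_2$ with $t(f_1)=o(f_2)=u$, $f_2\ne f_1^{-1}$, $[f_2]=[f_1]^{-1}$, $b\in B_u$ and $c\in A_{[f_1]}$ with $(f_1)_\omega b(f_2)_\alpha=\omega_{[f_1]}(c)$, and (II) $\alpha_{[f]}^{-1}(B_{o(f)}^{f_\alpha})=\omega_{[f]}^{-1}(B_{t(f)}^{f_\omega^{-1}})$ for every edge $f$. **Property 1.** A group $G$ satisfies Property 1 with respect to a subgroup $C$ if, for every finitely generated $H\le G$ and all $x,g\in G$ with $gx^{-1}\notin C$ such that $H\cap C$ and $H\cap C^x$ are finite, only finitely many pairs $(c,c')\in C\times C^x$ satisfy $cgc'\in H$. It satisfies Property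 1 with respect to a pair $(C,C')$ of subgroups if, for every finitely generated $H\le G$ and every $g\in G$ such that $H\cap C$ and $H\cap C'$ are finite, only finitely many pairs $(c,c')\in C\times C'$ satisfy $cgc'\in H$. **Property 2.** For a folded $\mathbb A$-graph $\mathbb B$, the pair $(\mathbb A,\mathbb B)$ satisfies Property 2 if: 1. every vertex group of $\mathbb A$ has decidable (uniform) membership problem and decidable power membership problem (given $g$ and a finitely generated subgroup $H$, is there a non-zero integer $k$ with $g^k\in H$?); 2. there is an algorithm that, given an edge $f$ of $\mathbb B$ and $x\in A_{[o(f)]}$, decides whether $xB_{o(f)}\cap\alpha_{[f]}(A_{[f]})^{f_\alpha^{-1}}$ is empty; 3. every infinite $B_f$ has finite index in $A_{[f]}$, and it is known which $B_f$ are infinite; 4. for every edge cycle $f_1,\dots,f_m$ ($m\ge1$, $f_{m+1}=f_1$) of $\mathbb B$ with all $B_{f_i}$ finite there is an $i$ such that, with $e_j=[f_j]$: if $e_{i+1}\ne e_i^{-1}$, then $A_{[t(f_i)]}$ satisfies Property 1 with respect to the pair $\bigl(\omega_{e_i}(A_{e_i})^{(f_i)_\omega},\ \alpha_{e_{i+1}}(A_{e_{i+1}})^{(f_{i+1})_\alpha^{-1}}\bigr)$;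 if $e_{i+1}=e_i^{-1}$, then $A_{[t(f_i)]}$ satisfies Property 1 with respect to $\omega_{e_i}(A_{e_i})^{(f_i)_\omega}$. **Theorem.** There is an algorithm ReadPower with the following property. Let $\mathbb A$ be a finite graph of groups with finitely generated vertex and edge groups, and let $\mathbb B$ be a finite folded $\mathbb A$-graph with finitely generated vertex groups such that $(\mathbb A,\mathbb B)$ satisfies Property 2. Suppose they are given by the following finite data: the two graphs, numbers of generators of the vertex groups $A_v$, words in these for the images of generators of each $A_e$ under $\alpha_e$ and $\omega_e$, the types of the vertices and edges of $\mathbb B$, words for generators of each $B_u$ and for the labels $f_\alpha,f_\omega$, programs for the decision problems in (1) and (2), and the list of the edges $f$ with $B_f$ infinite. Let $p$ be a cyclically reduced $\mathbb A$-loop, given by words, and let $u',u''$ be vertices of $\mathbb B$. On input of these data, ReadPower halts and decides whether there are a $\mathbb B$-path $q$ from $u'$ to $u''$ and an integer $m>0$ such that $\mu(q)\equiv p^m$ (in particular $\mu(q)$ and $p^m$ have the same end points). If so, it outputs such a $q$ (by words) and $m$, where $m$ is the minimum of all $m>0$ for which such a $q$ exists. -/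

import Mathlib

open Nat.Partrec (Code)
open Quiver

universe u₁ u₂ u₃ u₄ v₁ v₂

/-! ### Graphs of groups

A graph is a quiver with an involutive, fixed-point-free reversal of edges: an edge `e : v ⟶ w` has
origin `v` and terminus `w`, and `reverse e : w ⟶ v` is its inverse edge. -/

/-- A graph of groups on the graph `V`. The identification of the group of the inverse edge with the
group of the edge is the isomorphism `bar`; under it, `α` of the inverse edge is `ω` of the edge. -/
structure GraphOfGroups (V : Type u₁) [Quiver.{v₁} V] [HasInvolutiveReverse V] where
  reverse_ne : ∀ {v : V} (e : v ⟶ v), reverse e ≠ e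
  vert : V → Type u₃
  edge : ∀ {v w : V}, (v ⟶ w) → Type u₄
  [vertGroup : ∀ v, Group (vert v)]
  [edgeGroup : ∀ {v w : V} (e : v ⟶ w), Group (edge e)]
  α : ∀ {v w : V} (e : v ⟶ w), edge e →* vert v
  ω : ∀ {v w : V} (e : v ⟶ w), edge e →* vert w
  α_injective : ∀ {v w : V} (e : v ⟶ w), Function.Injective (α e)
  ω_injective : ∀ {v w : V} (e : v ⟶ w), Function.Injective (ω e)
  bar : ∀ {v w : V} (e : v ⟶ w), edge e ≃* edge (reverse e)
  α_bar : ∀ {v w : V} (e : v ⟶ w) (c : edge e), α (reverse e) (bar e c) = ω e c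
  ω_bar : ∀ {v w : V} (e : v ⟶ w) (c : edge e), ω (reverse e) (bar e c) = α e c

namespace GraphOfGroups

variable {V : Type u₁} [Quiver.{v₁} V] [HasInvolutiveReverse V]

instance (𝔸 : GraphOfGroups.{u₁, u₃, u₄, v₁} V) (v : V) : Group (𝔸.vert v) := 𝔸.vertGroup v

instance (𝔸 : GraphOfGroups.{u₁, u₃, u₄, v₁} V) {v w : V} (e : v ⟶ w) : Group (𝔸.edge e) := 𝔸.edgeGroup e

/-- `𝔸`-paths: `nil a` is the path `⟨a⟩` of length `0`, and `cons a e p` is `⟨a, e, p₀, e₁, p₁, …⟩`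
where `p = ⟨p₀, e₁, p₁, …⟩`. -/
inductive Path (𝔸 : GraphOfGroups.{u₁, u₃, u₄, v₁} V) : V → V → Type (max u₁ u₃ v₁)
  | nil {v : V} (a : 𝔸.vert v) : Path 𝔸 v v
  | cons {v x w : V} (a : 𝔸.vert v) (e : v ⟶ x) (p : Path 𝔸 x w) : Path 𝔸 v w

namespace Path

variable {𝔸 : GraphOfGroups.{u₁, u₃, u₄, v₁} V}

/-- Multiply the first group element of a path on the left by `a`. -/
def mulLeft {v w : V} (a : 𝔸.vert v) : 𝔸.Path v w → 𝔸.Path v w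
  | nil b => nil (a * b)
  | cons b e p => cons (a * b) e p

/-- Concatenation of paths: the last element of the first and the first element of the second path
are multiplied. -/
def comp {v x w : V} : 𝔸.Path v x → 𝔸.Path x w → 𝔸.Path v w
  | nil a, q => q.mulLeft a
  | cons a e p, q => cons a e (p.comp q)

/-- Powers of a loop. -/
def pow {v : V} (p : 𝔸.Path v v) : ℕ → 𝔸.Path v v
  | 0 => nil 1
  | 1 => p
  | n + 2 => (p.pow (n + 1)).comp p

/-- Elementary reductions: a subpath `⟨a, e, ω_e(c), e⁻¹, b⟩` is replaced by `⟨a α_e(c) b⟩`. -/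
inductive ElemRed : ∀ {v w : V}, 𝔸.Path v w → 𝔸.Path v w → Prop
  | head {v x w : V} (a : 𝔸.vert v) (e : v ⟶ x) (c : 𝔸.edge e) (p : 𝔸.Path v w) :
      ElemRed (cons a e (cons (𝔸.ω e c) (reverse e) p)) (p.mulLeft (a * 𝔸.α e c))
  | tail {v x w : V} (a : 𝔸.vert v) (e : v ⟶ x) {p q : 𝔸.Path x w} (h : ElemRed p q) :
      ElemRed (cons a e p) (cons a e q)

/-- The equivalence of paths generated by elementary reductions. -/
def Equivalent {v w : V} : 𝔸.Path v w → 𝔸.Path v w → Prop :=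
  Relation.EqvGen ElemRed

/-- A path is reduced if no elementary reduction is applicable. -/
def Reduced {v w : V} (p : 𝔸.Path v w) : Prop := ∀ q, ¬ ElemRed p q

/-- A loop is cyclically reduced if it and its square are reduced. -/
def CyclicallyReduced {v : V} (p : 𝔸.Path v v) : Prop := p.Reduced ∧ (p.pow 2).Reduced

/-- Transport of a path along equalities of its end points. -/
def cast {v w v' w' : V} (hv : v = v') (hw : w = w') (p : 𝔸.Path v w) : 𝔸.Path v' w' :=
  hv ▸ hw ▸ p

end Path

/-- `bar`, with the inverse edge given up to equality. -/
def barCast (𝔸 : GraphOfGroups.{u₁, u₃, u₄, v₁} V) {v w : V} (e : v ⟶ w) (e' : w ⟶ v) (h : e' = reverse e) :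
    𝔸.edge e ≃* 𝔸.edge e' :=
  h ▸ 𝔸.bar e

theorem α_barCast (𝔸 : GraphOfGroups.{u₁, u₃, u₄, v₁} V) {v w : V} (e : v ⟶ w) (e' : w ⟶ v) (h : e' = reverse e)
    (c : 𝔸.edge e) : 𝔸.α e' (𝔸.barCast e e' h c) = 𝔸.ω e c := by
  subst h; exact 𝔸.α_bar e c

theorem ω_barCast (𝔸 : GraphOfGroups.{u₁, u₃, u₄, v₁} V) {v w : V} (e : v ⟶ w) (e' : w ⟶ v) (h : e' = reverse e)
    (c : 𝔸.edge e) : 𝔸.ω e' (𝔸.barCast e e' h c) = 𝔸.α e c := by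
  subst h; exact 𝔸.ω_bar e c

end GraphOfGroups

/-- The conjugate `C ^ x = x⁻¹ C x`. -/
def Subgroup.conjBy {G : Type*} [Group G] (C : Subgroup G) (x : G) : Subgroup G :=
  C.map (MulAut.conj x⁻¹).toMonoidHom

theorem Subgroup.mem_conjBy {G : Type*} [Group G] (C : Subgroup G) (x g : G) :
    g ∈ C.conjBy x ↔ x * g * x⁻¹ ∈ C := by
  constructor
  · rintro ⟨c, hc, rfl⟩
    have h : x * (x⁻¹ * c * x) * x⁻¹ = c := by group
    simpa [h] using hc
  · intro h
    refine ⟨x * g * x⁻¹, h, ?_⟩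
    simp [mul_assoc]

/-! ### `𝔸`-graphs -/

/-- An `𝔸`-graph with underlying graph `U`. -/
structure AGraph {V : Type u₁} [Quiver.{v₁} V] [HasInvolutiveReverse V] (𝔸 : GraphOfGroups.{u₁, u₃, u₄, v₁} V)
    (U : Type u₂) [Quiver.{v₂} U] [HasInvolutiveReverse U] where
  reverse_ne : ∀ {u : U} (f : u ⟶ u), reverse f ≠ f
  /-- The graph morphism `[·]`. -/
  type : U ⥤q V
  type_reverse : ∀ {u w : U} (f : u ⟶ w), type.map (reverse f) = reverse (type.map f)
  /-- The subgroup `B_u` of `A_[u]`. -/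
  vert : ∀ u : U, Subgroup (𝔸.vert (type.obj u))
  /-- The label `f_α`. -/
  lα : ∀ {u w : U}, (u ⟶ w) → 𝔸.vert (type.obj u)
  /-- The label `f_ω`. -/
  lω : ∀ {u w : U}, (u ⟶ w) → 𝔸.vert (type.obj w)
  lα_reverse : ∀ {u w : U} (f : u ⟶ w), lα (reverse f) = (lω f)⁻¹

namespace AGraph

variable {V : Type u₁} [Quiver.{v₁} V] [HasInvolutiveReverse V] {𝔸 : GraphOfGroups.{u₁, u₃, u₄, v₁} V}
  {U : Type u₂} [Quiver.{v₂} U] [HasInvolutiveReverse U]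

theorem lω_reverse (𝔹 : AGraph 𝔸 U) {u w : U} (f : u ⟶ w) : 𝔹.lω (reverse f) = (𝔹.lα f)⁻¹ := by
  have h := 𝔹.lα_reverse (reverse f)
  rw [reverse_reverse] at h
  rw [h, inv_inv]

/-- `α_e⁻¹(f_α⁻¹ B_{o(f)} f_α)`, where `e = [f]`. -/
def edgeα (𝔹 : AGraph 𝔸 U) {u w : U} (f : u ⟶ w) : Subgroup (𝔸.edge (𝔹.type.map f)) :=
  ((𝔹.vert u).conjBy (𝔹.lα f)).comap (𝔸.α (𝔹.type.map f))

/-- `ω_e⁻¹(f_ω B_{t(f)} f_ω⁻¹)`, where `e = [f]`. -/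
def edgeω (𝔹 : AGraph 𝔸 U) {u w : U} (f : u ⟶ w) : Subgroup (𝔸.edge (𝔹.type.map f)) :=
  ((𝔹.vert w).conjBy (𝔹.lω f)⁻¹).comap (𝔸.ω (𝔹.type.map f))

/-- The edge group `B_f`, a subgroup of `A_[f]`. -/
def edge (𝔹 : AGraph 𝔸 U) {u w : U} (f : u ⟶ w) : Subgroup (𝔸.edge (𝔹.type.map f)) :=
  𝔹.edgeα f ⊓ 𝔹.edgeω f

theorem mem_edge_iff (𝔹 : AGraph 𝔸 U) {u w : U} (f : u ⟶ w) (c : 𝔸.edge (𝔹.type.map f)) :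
    c ∈ 𝔹.edge f ↔ 𝔹.lα f * 𝔸.α (𝔹.type.map f) c * (𝔹.lα f)⁻¹ ∈ 𝔹.vert u ∧
      (𝔹.lω f)⁻¹ * 𝔸.ω (𝔹.type.map f) c * 𝔹.lω f ∈ 𝔹.vert w := by
  simp [edge, edgeα, edgeω, Subgroup.mem_conjBy]

theorem barCast_mem_edge_iff (𝔹 : AGraph 𝔸 U) {u w : U} (f : u ⟶ w)
    (c : 𝔸.edge (𝔹.type.map f)) :
    𝔸.barCast _ _ (𝔹.type_reverse f) c ∈ 𝔹.edge (reverse f) ↔ c ∈ 𝔹.edge f := by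
  simp only [mem_edge_iff, 𝔸.α_barCast, 𝔸.ω_barCast, lα_reverse, lω_reverse, inv_inv]
  exact and_comm

/-- The graph of groups that an `𝔸`-graph defines: vertex groups `B_u`, edge groups `B_f`,
`α_f(c) = f_α α_[f](c) f_α⁻¹` and `ω_f(c) = f_ω⁻¹ ω_[f](c) f_ω`. -/
def toGraphOfGroups (𝔹 : AGraph 𝔸 U) : GraphOfGroups U where
  reverse_ne := 𝔹.reverse_ne
  vert u := 𝔹.vert u
  edge f := 𝔹.edge f
  vertGroup _ := inferInstance
  edgeGroup _ := inferInstance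
  α f := MonoidHom.codRestrict
    (((MulAut.conj (𝔹.lα f)).toMonoidHom.comp (𝔸.α (𝔹.type.map f))).comp (𝔹.edge f).subtype) _
    (fun c => ((𝔹.mem_edge_iff f c).1 c.2).1)
  ω f := MonoidHom.codRestrict
    (((MulAut.conj (𝔹.lω f)⁻¹).toMonoidHom.comp (𝔸.ω (𝔹.type.map f))).comp (𝔹.edge f).subtype) _
    (fun c => by simpa using ((𝔹.mem_edge_iff f c).1 c.2).2)
  α_injective f c d h := by
    have h' := congrArg Subtype.val h
    simp only [MonoidHom.codRestrict_apply, MonoidHom.comp_apply, MulEquiv.toMonoidHom_eq_coe,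
      MonoidHom.coe_coe] at h'
    exact Subtype.ext (𝔸.α_injective _ ((MulAut.conj _).injective h'))
  ω_injective f c d h := by
    have h' := congrArg Subtype.val h
    simp only [MonoidHom.codRestrict_apply, MonoidHom.comp_apply, MulEquiv.toMonoidHom_eq_coe,
      MonoidHom.coe_coe] at h'
    exact Subtype.ext (𝔸.ω_injective _ ((MulAut.conj _).injective h'))
  bar f :=
    { toEquiv := (𝔸.barCast _ _ (𝔹.type_reverse f)).toEquiv.subtypeEquiv
        (fun c => (𝔹.barCast_mem_edge_iff f c).symm)
      map_mul' := fun c d => Subtype.ext (map_mul (𝔸.barCast _ _ (𝔹.type_reverse f)) c.1 d.1) }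
  α_bar f c := by
    apply Subtype.ext
    change 𝔹.lα (reverse f) * 𝔸.α _ (𝔸.barCast _ _ (𝔹.type_reverse f) c.1) * (𝔹.lα (reverse f))⁻¹
      = (𝔹.lω f)⁻¹ * 𝔸.ω _ c.1 * (𝔹.lω f)⁻¹⁻¹
    rw [𝔸.α_barCast, lα_reverse]
  ω_bar f c := by
    apply Subtype.ext
    change (𝔹.lω (reverse f))⁻¹ * 𝔸.ω _ (𝔸.barCast _ _ (𝔹.type_reverse f) c.1) *
      (𝔹.lω (reverse f))⁻¹⁻¹ = 𝔹.lα f * 𝔸.α _ c.1 * (𝔹.lα f)⁻¹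
    rw [𝔸.ω_barCast, lω_reverse, inv_inv]

/-- `𝔹`-paths, that is, paths in the graph of groups that `𝔹` defines. -/
abbrev Path (𝔹 : AGraph 𝔸 U) (u w : U) := 𝔹.toGraphOfGroups.Path u w

/-- The `𝔸`-path `μ(q)` of a `𝔹`-path `q`. -/
def μ (𝔹 : AGraph 𝔸 U) : ∀ {u w : U}, 𝔹.Path u w → 𝔸.Path (𝔹.type.obj u) (𝔹.type.obj w)
  | _, _, .nil b => .nil (Subtype.val b)
  | _, _, .cons b f q => .cons (Subtype.val b * 𝔹.lα f) (𝔹.type.map f) ((𝔹.μ q).mulLeft (𝔹.lω f))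

/-- `q` reads the `𝔸`-path `p`: the paths `μ(q)` and `p` have the same end points and are
equivalent. -/
def Reads (𝔹 : AGraph 𝔸 U) {u w : U} (q : 𝔹.Path u w) {v x : V} (p : 𝔸.Path v x) : Prop :=
  ∃ (hu : 𝔹.type.obj u = v) (hw : 𝔹.type.obj w = x), ((𝔹.μ q).cast hu hw).Equivalent p

/-- `𝔹` is folded: no fold is possible between an edge `f₁` into `u` and an edge `f₂ ≠ f₁⁻¹` out of
`u` with `[f₂] = [f₁]⁻¹`, and for every edge the two subgroups that define its group coincide. Edges
with a common origin are compared in the type `Quiver.Star` of edges with this origin. -/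
structure Folded (𝔹 : AGraph 𝔸 U) : Prop where
  no_fold : ∀ {x u y : U} (f₁ : x ⟶ u) (f₂ : u ⟶ y), Quiver.Star.mk f₂ ≠ Quiver.Star.mk (reverse f₁) →
    Quiver.Star.mk (𝔹.type.map f₂) = Quiver.Star.mk (reverse (𝔹.type.map f₁)) →
    ∀ b ∈ 𝔹.vert u, ∀ c : 𝔸.edge (𝔹.type.map f₁),
      𝔹.lω f₁ * b * 𝔹.lα f₂ ≠ 𝔸.ω (𝔹.type.map f₁) c
  edge_eq : ∀ {u w : U} (f : u ⟶ w), 𝔹.edgeα f = 𝔹.edgeω f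

end AGraph

/-! ### The double coset property -/

/-- The double coset property with respect to one subgroup `C`. -/
def DoubleCosetProperty {G : Type*} [Group G] (C : Subgroup G) : Prop :=
  ∀ H : Subgroup G, H.FG → ∀ x g : G, g * x⁻¹ ∉ C →
    Finite ↥(H ⊓ C) → Finite ↥(H ⊓ C.conjBy x) →
    {c : G × G | c.1 ∈ C ∧ c.2 ∈ C.conjBy x ∧ c.1 * g * c.2 ∈ H}.Finite

/-- The double coset property with respect to a pair of subgroups `(C, C')`. -/
def DoubleCosetPairProperty {G : Type*} [Group G] (C C' : Subgroup G) : Prop :=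
  ∀ H : Subgroup G, H.FG → ∀ g : G, Finite ↥(H ⊓ C) → Finite ↥(H ⊓ C') →
    {c : G × G | c.1 ∈ C ∧ c.2 ∈ C' ∧ c.1 * g * c.2 ∈ H}.Finite

/-! ### Finite descriptions -/

/-- Group words: the letter `(i, true)` stands for the `i`-th generator and `(i, false)` for its
inverse. -/
abbrev GWord := List (ℕ × Bool)

/-- The value of a word with respect to a list of generators; a letter whose index exceeds the
length of the list has the value `1`. -/
def GWord.eval {G : Type*} [Group G] (gens : List G) (w : GWord) : G :=
  (w.map fun l => if l.2 then gens.getD l.1 1 else (gens.getD l.1 1)⁻¹).prod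

/-- The subgroup generated by the values of a finite list of words. -/
def GWord.span {G : Type*} [Group G] (gens : List G) (X : List GWord) : Subgroup G :=
  Subgroup.closure {g | ∃ w ∈ X, GWord.eval gens w = g}

/-- Description of a path: its first group element as a word, followed by the list of its edges
(as numbers), each with the group element (as a word) that follows it. -/
abbrev PathCode := GWord × List (ℕ × GWord)

/-- The program `c`, run on the input `a`, halts and answers correctly whether `P` holds. -/
def Nat.Partrec.Code.Answers {α : Type*} [Primcodable α] (c : Code) (a : α) (P : Prop) : Prop :=
  ∃ b : Bool, Encodable.encode b ∈ c.eval (Encodable.encode a) ∧ (b = true ↔ P)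

/-- Data of a vertex of a graph of groups: the number of generators of the vertex group, and programs
for its membership problem and its power membership problem. -/
structure VertexData where
  numGens : ℕ
  memCode : Code
  powCode : Code

/-- Data of an edge of a graph of groups: numbers of its end points and of its inverse, and words for
the images of the generators of the edge group under `α` and `ω`. -/
structure EdgeData where
  origin : ℕ
  terminus : ℕ
  inverse : ℕ
  alpha : List GWord
  omega : List GWord

/-- Finite description of a graph of groups, with programs for the vertex groups. -/
structure GraphData where
  verts : List VertexData
  edges : List EdgeData

/-- Data of a vertex of an `𝔸`-graph: the number of its type and generators of its group. -/
structure AVertexData where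
  type : ℕ
  gens : List GWord

/-- Data of an edge of an `𝔸`-graph: numbers of its end points, of its inverse and of its type, words
for the two labels, and whether its edge group is infinite. -/
structure AEdgeData where
  origin : ℕ
  terminus : ℕ
  inverse : ℕ
  type : ℕ
  alpha : GWord
  omega : GWord
  infinite : Bool

/-- Finite description of an `𝔸`-graph, with a program for the intersection problem. -/
structure AGraphData where
  verts : List AVertexData
  edges : List AEdgeData
  interCode : Code

/-- The input of the algorithm: `𝔸`, `𝔹`, a loop (its base vertex and its description), and two
vertices of `𝔹`. -/
structure ReadPowerInput where
  graph : GraphData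
  agraph : AGraphData
  base : ℕ
  loop : PathCode
  start : ℕ
  finish : ℕ

instance : Primcodable VertexData := Primcodable.ofEquiv (ℕ × Code × Code)
  ⟨fun d => (d.numGens, d.memCode, d.powCode), fun t => ⟨t.1, t.2.1, t.2.2⟩,
    fun _ => rfl, fun _ => rfl⟩

instance : Primcodable EdgeData := Primcodable.ofEquiv (ℕ × ℕ × ℕ × List GWord × List GWord)
  ⟨fun d => (d.origin, d.terminus, d.inverse, d.alpha, d.omega),
    fun t => ⟨t.1, t.2.1, t.2.2.1, t.2.2.2.1, t.2.2.2.2⟩, fun _ => rfl, fun _ => rfl⟩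

instance : Primcodable GraphData := Primcodable.ofEquiv (List VertexData × List EdgeData)
  ⟨fun d => (d.verts, d.edges), fun t => ⟨t.1, t.2⟩, fun _ => rfl, fun _ => rfl⟩

instance : Primcodable AVertexData := Primcodable.ofEquiv (ℕ × List GWord)
  ⟨fun d => (d.type, d.gens), fun t => ⟨t.1, t.2⟩, fun _ => rfl, fun _ => rfl⟩

instance : Primcodable AEdgeData := Primcodable.ofEquiv (ℕ × ℕ × ℕ × ℕ × GWord × GWord × Bool)
  ⟨fun d => (d.origin, d.terminus, d.inverse, d.type, d.alpha, d.omega, d.infinite),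
    fun t => ⟨t.1, t.2.1, t.2.2.1, t.2.2.2.1, t.2.2.2.2.1, t.2.2.2.2.2.1, t.2.2.2.2.2.2⟩,
    fun _ => rfl, fun _ => rfl⟩

instance : Primcodable AGraphData :=
  Primcodable.ofEquiv (List AVertexData × List AEdgeData × Code)
  ⟨fun d => (d.verts, d.edges, d.interCode), fun t => ⟨t.1, t.2.1, t.2.2⟩,
    fun _ => rfl, fun _ => rfl⟩

instance : Primcodable ReadPowerInput :=
  Primcodable.ofEquiv (GraphData × AGraphData × ℕ × PathCode × ℕ × ℕ)
  ⟨fun d => (d.graph, d.agraph, d.base, d.loop, d.start, d.finish),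
    fun t => ⟨t.1, t.2.1, t.2.2.1, t.2.2.2.1, t.2.2.2.2.1, t.2.2.2.2.2⟩,
    fun _ => rfl, fun _ => rfl⟩

/-- `l` describes the path `p`, where `r v a w` says that the word `w` describes the element `a` of
the group at `v`, and `num e` is the number of the edge `e`. -/
def GraphOfGroups.Path.DescribedBy {V : Type u₁} [Quiver.{v₁} V] [HasInvolutiveReverse V]
    {𝔸 : GraphOfGroups.{u₁, u₃, u₄, v₁} V} (r : ∀ v : V, 𝔸.vert v → GWord → Prop) (num : Quiver.Total V → ℕ) :
    ∀ {v w : V}, 𝔸.Path v w → PathCode → Prop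
  | v, _, .nil a, l => r v a l.1 ∧ l.2 = []
  | v, _, .cons a e p, l => r v a l.1 ∧
      ∃ l' : PathCode, l.2 = (num ⟨_, _, e⟩, l'.1) :: l'.2 ∧ p.DescribedBy r num l'

/-- A numbering of the vertices and edges of a finite graph of finitely generated groups `𝔸`, and
finite generating lists of its vertex and edge groups, with respect to which `d` describes `𝔸`. -/
structure GraphOfGroups.Presentation {V : Type u₁} [Quiver.{v₁} V] [HasInvolutiveReverse V]
    (𝔸 : GraphOfGroups.{u₁, u₃, u₄, v₁} V) (d : GraphData) where
  vNum : V ≃ Fin d.verts.length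
  eNum : Quiver.Total V ≃ Fin d.edges.length
  vGens : ∀ v : V, List (𝔸.vert v)
  eGens : ∀ {v w : V} (e : v ⟶ w), List (𝔸.edge e)
  closure_vGens : ∀ v, Subgroup.closure {g | g ∈ vGens v} = ⊤
  closure_eGens : ∀ {v w : V} (e : v ⟶ w), Subgroup.closure {g | g ∈ eGens e} = ⊤
  numGens : ∀ v, (d.verts.get (vNum v)).numGens = (vGens v).length
  origin : ∀ {v w : V} (e : v ⟶ w), (d.edges.get (eNum ⟨v, w, e⟩)).origin = vNum v
  terminus : ∀ {v w : V} (e : v ⟶ w), (d.edges.get (eNum ⟨v, w, e⟩)).terminus = vNum w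
  inverse : ∀ {v w : V} (e : v ⟶ w),
    (d.edges.get (eNum ⟨v, w, e⟩)).inverse = eNum ⟨w, v, reverse e⟩
  alpha : ∀ {v w : V} (e : v ⟶ w),
    (d.edges.get (eNum ⟨v, w, e⟩)).alpha.map (GWord.eval (vGens v)) = (eGens e).map (𝔸.α e)
  omega : ∀ {v w : V} (e : v ⟶ w),
    (d.edges.get (eNum ⟨v, w, e⟩)).omega.map (GWord.eval (vGens w)) = (eGens e).map (𝔸.ω e)

section Presentations

variable {V : Type u₁} [Quiver.{v₁} V] [HasInvolutiveReverse V] {𝔸 : GraphOfGroups.{u₁, u₃, u₄, v₁} V}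
  {U : Type u₂} [Quiver.{v₂} U] [HasInvolutiveReverse U]

/-- `l` describes the `𝔸`-path `p`. -/
def GraphOfGroups.Presentation.Describes {d : GraphData} (P : 𝔸.Presentation d) {v w : V}
    (p : 𝔸.Path v w) (l : PathCode) : Prop :=
  p.DescribedBy (fun v a s => GWord.eval (P.vGens v) s = a) (fun e => P.eNum e) l

/-- A numbering of the vertices and edges of a finite `𝔸`-graph `𝔹` with finitely generated vertex
groups, with respect to which `d'` describes `𝔹`. -/
structure AGraph.Presentation (𝔹 : AGraph 𝔸 U) {d : GraphData} (P : 𝔸.Presentation d)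
    (d' : AGraphData) where
  vNum : U ≃ Fin d'.verts.length
  eNum : Quiver.Total U ≃ Fin d'.edges.length
  vert_type : ∀ u, (d'.verts.get (vNum u)).type = P.vNum (𝔹.type.obj u)
  gens : ∀ u, GWord.span (P.vGens (𝔹.type.obj u)) (d'.verts.get (vNum u)).gens = 𝔹.vert u
  origin : ∀ {u w : U} (f : u ⟶ w), (d'.edges.get (eNum ⟨u, w, f⟩)).origin = vNum u
  terminus : ∀ {u w : U} (f : u ⟶ w), (d'.edges.get (eNum ⟨u, w, f⟩)).terminus = vNum w
  inverse : ∀ {u w : U} (f : u ⟶ w),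
    (d'.edges.get (eNum ⟨u, w, f⟩)).inverse = eNum ⟨w, u, reverse f⟩
  edge_type : ∀ {u w : U} (f : u ⟶ w),
    (d'.edges.get (eNum ⟨u, w, f⟩)).type = P.eNum ⟨_, _, 𝔹.type.map f⟩
  alpha : ∀ {u w : U} (f : u ⟶ w),
    GWord.eval (P.vGens (𝔹.type.obj u)) (d'.edges.get (eNum ⟨u, w, f⟩)).alpha = 𝔹.lα f
  omega : ∀ {u w : U} (f : u ⟶ w),
    GWord.eval (P.vGens (𝔹.type.obj w)) (d'.edges.get (eNum ⟨u, w, f⟩)).omega = 𝔹.lω f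

/-- `l` describes the `𝔹`-path `q`; elements of `B_u` are written as words in the generators of
`A_[u]`. -/
def AGraph.Presentation.Describes {𝔹 : AGraph 𝔸 U} {d : GraphData} {P : 𝔸.Presentation d}
    {d' : AGraphData} (Q : 𝔹.Presentation P d') {u w : U} (q : 𝔹.Path u w) (l : PathCode) : Prop :=
  q.DescribedBy (fun u b s => GWord.eval (P.vGens (𝔹.type.obj u)) s = Subtype.val b)
    (fun f => Q.eNum f) l

/-- The condition on a pair of consecutive edges `f`, `g` of an edge cycle, with types `e = [f]` and
`e' = [g]`: if `e' ≠ e⁻¹` then the pair property holds for `ω_e(A_e) ^ f_ω` and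
`α_{e'}(A_{e'}) ^ (g_α⁻¹)`, and if `e' = e⁻¹` then the property holds for `ω_e(A_e) ^ f_ω`. -/
def AGraph.GoodPair (𝔹 : AGraph 𝔸 U) {x u y : U} (f : x ⟶ u) (g : u ⟶ y) : Prop :=
  (Quiver.Star.mk (𝔹.type.map g) ≠ Quiver.Star.mk (reverse (𝔹.type.map f)) →
    DoubleCosetPairProperty ((𝔸.ω (𝔹.type.map f)).range.conjBy (𝔹.lω f))
      ((𝔸.α (𝔹.type.map g)).range.conjBy (𝔹.lα g)⁻¹)) ∧
  (Quiver.Star.mk (𝔹.type.map g) = Quiver.Star.mk (reverse (𝔹.type.map f)) →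
    DoubleCosetProperty ((𝔸.ω (𝔹.type.map f)).range.conjBy (𝔹.lω f)))

/-- The conditions on `(𝔸, 𝔹)` under which powers can be read; the algorithms that they ask for are
the programs that are part of the descriptions `d` and `d'`. -/
structure AGraph.PowerReadingConditions {𝔹 : AGraph 𝔸 U} {d : GraphData} {P : 𝔸.Presentation d}
    {d' : AGraphData} (Q : 𝔹.Presentation P d') : Prop where
  /-- Every vertex group of `𝔸` has decidable membership problem … -/
  membership : ∀ (v : V) (X : List GWord) (g : GWord),
    (d.verts.get (P.vNum v)).memCode.Answers (X, g)
      (GWord.eval (P.vGens v) g ∈ GWord.span (P.vGens v) X)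
  /-- … and decidable power membership problem. -/
  powerMembership : ∀ (v : V) (X : List GWord) (g : GWord),
    (d.verts.get (P.vNum v)).powCode.Answers (X, g)
      (∃ k : ℤ, k ≠ 0 ∧ GWord.eval (P.vGens v) g ^ k ∈ GWord.span (P.vGens v) X)
  /-- For an edge `f` and an element `x` of `A_[o(f)]` it is decidable whether `x B_{o(f)}` meets
  `α_[f](A_[f]) ^ (f_α⁻¹)`. -/
  intersection : ∀ {u w : U} (f : u ⟶ w) (x : GWord),
    d'.interCode.Answers ((Q.eNum ⟨u, w, f⟩ : ℕ), x)
      (∃ b ∈ 𝔹.vert u, GWord.eval (P.vGens (𝔹.type.obj u)) x * b ∈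
        (𝔸.α (𝔹.type.map f)).range.conjBy (𝔹.lα f)⁻¹)
  /-- An infinite edge group `B_f` has finite index in `A_[f]` … -/
  finiteIndex : ∀ {u w : U} (f : u ⟶ w), Infinite (𝔹.edge f) → (𝔹.edge f).FiniteIndex
  /-- … and it is known which `B_f` are infinite. -/
  infinite_iff : ∀ {u w : U} (f : u ⟶ w),
    (d'.edges.get (Q.eNum ⟨u, w, f⟩)).infinite = true ↔ Infinite (𝔹.edge f)
  /-- Every edge cycle `f₁, …, fₘ` (indexed by `ZMod m`) whose edge groups are all finite contains a
  good pair of cyclically consecutive edges. -/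
  cycle : ∀ (m : ℕ), 0 < m → ∀ (u : ZMod m → U) (f : ∀ i, u i ⟶ u (i + 1)),
    (∀ i, Finite (𝔹.edge (f i))) → ∃ i, 𝔹.GoodPair (f i) (f (i + 1))

end Presentations

/-!
Reading the powers of `p` in `𝔹` from `u'` is a deterministic process up to the edge groups. By the
normal form theorem (`Path.Equivalent.shift`), equivalent reduced paths differ only by shifting
elements of edge groups across edges. As `𝔹` is folded, `μ` maps reduced paths to reduced paths
(`AGraph.Folded.reduced_μ`). So, if a reduced path that begins with `⟨a, e⟩` can be read from a
vertex `u`, then an edge `f` at `u` of type `e` and an element `c` of `A_e` with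
`a α_e(c)⁻¹ f_α⁻¹ ∈ B_u` carry on the reading (`AGraph.CanRead`); conversely, after such a step the
path is readable if and only if the remaining path is (`AGraph.ReadsInitial.readable`), so that a
wrong choice is impossible. A reading of `p ^ m` therefore either gets stuck, and then no higher
power of `p` can be read (`AGraph.ReadsInitial.blocked`), or it ends at a vertex `w` with a last
element `a`, and then `p ^ m` can be read to `w` if and only if `a ∈ B_w`, and to no other vertex.

If a loop at `u'` reads `p ^ m`, then readings of higher powers can be shortened
(`AGraph.Readable.shorten`), so only exponents up to `m` need to be examined. It remains to see
that, for `p` of positive length, the reading of powers of `p` gets stuck or closes up in a loop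
(`AGraph.Folded.exists_loop_or_blocked`). Otherwise there is an infinite reading. At each moment
record the edge `f`, the part of `p` after it, and the element `c`. If two moments agree in the
first two, and in `c` up to `B_f`, then the part of the reading between them gives the loop. If
edges with infinite `B_f` occur infinitely often, such moments exist because `B_f` has finite index.
Otherwise the edge groups are finite from some time on, each closed part of the reading contains a
good pair, and the double coset property at a good pair leaves only finitely many elements `c`
(`AGraph.Folded.finite_of_goodPair`). For `p` of length `0` the power membership problem replaces
this argument.

The program searches for a certificate: an exponent, descriptions of readings of the powers up to
this exponent, and a time bound within which the given programs confirm all the facts that the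
readings use. Checking a certificate is primitive recursive, because `Nat.Partrec.Code.evaln` is;
certificates prove only correct answers (`ReadPowerInput.verdict_sound`), and some certificate
proves an answer (`ReadPowerInput.exists_verdict`).
-/

/-! ### Paths in a graph of groups -/

namespace GraphOfGroups.Path

variable {V : Type u₁} [Quiver.{v₁} V] [HasInvolutiveReverse V]
  {𝔸 : GraphOfGroups.{u₁, u₃, u₄, v₁} V}

/-- The number of edges of a path. -/
def length {v w : V} : 𝔸.Path v w → ℕ
  | nil _ => 0
  | cons _ _ p => p.length + 1

/-- The inverse path. -/
def inv {v w : V} : 𝔸.Path v w → 𝔸.Path w v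
  | nil a => nil a⁻¹
  | cons a e p => p.inv.comp (cons 1 (reverse e) (nil a⁻¹))

@[simp] theorem mulLeft_nil {v : V} (a b : 𝔸.vert v) : (nil b).mulLeft a = nil (a * b) := rfl

@[simp] theorem mulLeft_cons {v x w : V} (a b : 𝔸.vert v) (e : v ⟶ x) (p : 𝔸.Path x w) :
    (cons b e p).mulLeft a = cons (a * b) e p := rfl

@[simp] theorem nil_comp {v w : V} (a : 𝔸.vert v) (q : 𝔸.Path v w) :
    (nil a).comp q = q.mulLeft a := rfl

@[simp] theorem cons_comp {v w x y : V} (a : 𝔸.vert v) (e : v ⟶ w) (p : 𝔸.Path w x)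
    (q : 𝔸.Path x y) : (cons a e p).comp q = cons a e (p.comp q) := rfl

@[simp] theorem mulLeft_one {v w : V} (p : 𝔸.Path v w) : p.mulLeft 1 = p := by
  cases p <;> simp

@[simp] theorem mulLeft_mulLeft {v w : V} (a b : 𝔸.vert v) (p : 𝔸.Path v w) :
    (p.mulLeft b).mulLeft a = p.mulLeft (a * b) := by
  cases p <;> simp [mul_assoc]

@[simp] theorem length_mulLeft {v w : V} (a : 𝔸.vert v) (p : 𝔸.Path v w) :
    (p.mulLeft a).length = p.length := by
  cases p <;> simp [length]

@[simp] theorem mulLeft_comp {v w x : V} (a : 𝔸.vert v) (p : 𝔸.Path v w) (q : 𝔸.Path w x) :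
    (p.mulLeft a).comp q = (p.comp q).mulLeft a := by
  cases p <;> simp

theorem comp_assoc {v w x y : V} (p : 𝔸.Path v w) (q : 𝔸.Path w x) (r : 𝔸.Path x y) :
    (p.comp q).comp r = p.comp (q.comp r) := by
  induction p with
  | nil a => simp
  | cons a e p ih => simp [ih]

@[simp] theorem comp_nil_one {v w : V} (p : 𝔸.Path v w) : p.comp (nil 1) = p := by
  induction p with
  | nil a => simp
  | cons a e p ih => simp [ih]

@[simp] theorem length_comp {v w x : V} (p : 𝔸.Path v w) (q : 𝔸.Path w x) :
    (p.comp q).length = p.length + q.length := by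
  induction p with
  | nil a => simp [length]
  | cons a e p ih => simp [length, ih]; omega

theorem pow_succ {v : V} (p : 𝔸.Path v v) (n : ℕ) : p.pow (n + 1) = (p.pow n).comp p := by
  cases n <;> simp [pow]

theorem pow_add {v : V} (p : 𝔸.Path v v) (m n : ℕ) : p.pow (m + n) = (p.pow m).comp (p.pow n) := by
  induction n with
  | zero => simp [pow]
  | succ n ih => rw [← add_assoc, pow_succ, ih, pow_succ, comp_assoc]

theorem nil_pow {v : V} (a : 𝔸.vert v) (n : ℕ) : (nil a : 𝔸.Path v v).pow n = nil (a ^ n) := by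
  induction n with
  | zero => simp [pow]
  | succ n ih => rw [pow_succ, ih]; simp [_root_.pow_succ]

/-! ### Equivalence of paths -/

@[refl] theorem Equivalent.refl {v w : V} (p : 𝔸.Path v w) : p.Equivalent p :=
  Relation.EqvGen.refl p

@[symm] theorem Equivalent.symm {v w : V} {p q : 𝔸.Path v w} (h : p.Equivalent q) :
    q.Equivalent p := Relation.EqvGen.symm _ _ h

@[trans] theorem Equivalent.trans {v w : V} {p q r : 𝔸.Path v w} (h : p.Equivalent q)
    (h' : q.Equivalent r) : p.Equivalent r := Relation.EqvGen.trans _ _ _ h h'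

theorem Equivalent.map {V' : Type*} [Quiver V'] [HasInvolutiveReverse V'] {𝔸' : GraphOfGroups V'}
    {v w : V} {v' w' : V'} {F : 𝔸.Path v w → 𝔸'.Path v' w'}
    (hF : ∀ p q, ElemRed p q → ElemRed (F p) (F q)) {p q : 𝔸.Path v w} (h : p.Equivalent q) :
    (F p).Equivalent (F q) := by
  induction h with
  | rel p q h => exact .rel _ _ (hF _ _ h)
  | refl p => rfl
  | symm p q _ ih => exact ih.symm
  | trans p q r _ _ ih₁ ih₂ => exact ih₁.trans ih₂

theorem ElemRed.mulLeft {v w : V} {p q : 𝔸.Path v w} (h : ElemRed p q) (a : 𝔸.vert v) :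
    ElemRed (p.mulLeft a) (q.mulLeft a) := by
  cases h with
  | head b e c p =>
    rw [mulLeft_mulLeft, ← mul_assoc]
    exact .head (a * b) e c p
  | tail b e h => exact .tail (a * b) e h

theorem ElemRed.comp_left {v w x : V} {p q : 𝔸.Path v w} (h : ElemRed p q) (r : 𝔸.Path w x) :
    ElemRed (p.comp r) (q.comp r) := by
  induction h with
  | head b e c p => simpa using ElemRed.head b e c (p.comp r)
  | tail b e h ih => exact .tail b e (ih r)

theorem ElemRed.comp_right {v w x : V} {p q : 𝔸.Path w x} (h : ElemRed p q) (r : 𝔸.Path v w) :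
    ElemRed (r.comp p) (r.comp q) := by
  induction r with
  | nil a => exact h.mulLeft a
  | cons a e r ih => exact .tail a e (ih h)

theorem Equivalent.mulLeft {v w : V} {p q : 𝔸.Path v w} (h : p.Equivalent q) (a : 𝔸.vert v) :
    (p.mulLeft a).Equivalent (q.mulLeft a) := h.map fun _ _ h => h.mulLeft a

theorem Equivalent.comp {v w x : V} {p q : 𝔸.Path v w} {r s : 𝔸.Path w x} (h : p.Equivalent q)
    (h' : r.Equivalent s) : (p.comp r).Equivalent (q.comp s) :=
  (h.map (F := fun p => p.comp r) fun _ _ h => h.comp_left r).trans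
    (h'.map fun _ _ h => h.comp_right q)

theorem Equivalent.cons {v w x : V} {p q : 𝔸.Path w x} (h : p.Equivalent q) (a : 𝔸.vert v)
    (e : v ⟶ w) : (cons a e p).Equivalent (cons a e q) :=
  h.map fun _ _ h => .tail a e h

theorem ElemRed.length {v w : V} {p q : 𝔸.Path v w} (h : ElemRed p q) :
    q.length < p.length := by
  induction h with
  | head a e c p => simp [Path.length]
  | tail a e h ih => simpa [Path.length] using ih

theorem cons_reverse_cons_equivalent {v w x : V} (a b : 𝔸.vert v) (e : v ⟶ w) (p : 𝔸.Path v x) :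
    (cons a e (cons 1 (reverse e) (p.mulLeft b))).Equivalent (p.mulLeft (a * b)) := by
  have h := ElemRed.head a e (1 : 𝔸.edge e) (p.mulLeft b)
  simp only [map_one, mul_one, mulLeft_mulLeft] at h
  exact .rel _ _ h

theorem cons_mul_α_equivalent {v w x : V} (a : 𝔸.vert v) (e : v ⟶ w) (c : 𝔸.edge e)
    (p : 𝔸.Path w x) : (cons (a * 𝔸.α e c) e p).Equivalent (cons a e (p.mulLeft (𝔸.ω e c))) := by
  have h₁ := Equivalent.cons (.rel _ _ (ElemRed.head (𝔸.ω e c) (reverse e) 1 p)) a e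
  have h₂ := ElemRed.head a e c (Path.cons 1 (reverse (reverse e)) p)
  simp only [map_one, mul_one, reverse_reverse] at h₁
  simp only [mulLeft_cons, reverse_reverse, mul_one] at h₂
  exact (Equivalent.symm (.rel _ _ h₂)).trans h₁

theorem comp_inv_equivalent {v w : V} (p : 𝔸.Path v w) : (p.comp p.inv).Equivalent (nil 1) := by
  induction p with
  | nil a => simpa [inv] using Equivalent.refl _
  | cons a e p ih =>
    simp only [inv, cons_comp]
    rw [← comp_assoc]
    refine ((ih.comp (.refl _)).cons a e).trans ?_
    simpa using cons_reverse_cons_equivalent a a⁻¹ e (nil (1 : 𝔸.vert _))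

theorem inv_comp_equivalent {v w : V} (p : 𝔸.Path v w) : (p.inv.comp p).Equivalent (nil 1) := by
  induction p with
  | nil a => simpa [inv] using Equivalent.refl _
  | cons a e p ih =>
    rw [inv, comp_assoc]
    refine Equivalent.trans (Equivalent.comp (.refl _) ?_) ih
    have h := cons_reverse_cons_equivalent 1 1 (reverse e) p
    simpa using h

theorem Equivalent.cancel_right {v w x : V} {p q : 𝔸.Path v w} {r : 𝔸.Path w x}
    (h : (p.comp r).Equivalent (q.comp r)) : p.Equivalent q := by
  have h' := h.comp (.refl r.inv)
  simp only [comp_assoc] at h'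
  have key (s : 𝔸.Path v w) : (s.comp (r.comp r.inv)).Equivalent s := by
    simpa using (Equivalent.refl s).comp r.comp_inv_equivalent
  exact (key p).symm.trans (h'.trans (key q))

/-! ### Reduced paths -/

theorem reduced_nil {v : V} (a : 𝔸.vert v) : (nil a : 𝔸.Path v v).Reduced := fun _ h => by
  cases h

theorem reduced_cons_iff {v w x : V} (a : 𝔸.vert v) (e : v ⟶ w) (p : 𝔸.Path w x) :
    (cons a e p).Reduced ↔
      p.Reduced ∧ ¬ ∃ c p', p = cons (𝔸.ω e c) (reverse e) p' := by
  constructor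
  · refine fun h => ⟨fun q hq => h _ (.tail a e hq), ?_⟩
    rintro ⟨c, p', rfl⟩
    exact h _ (.head a e c p')
  · rintro ⟨h, h'⟩ q hq
    cases hq with
    | head _ _ c p' => exact h' ⟨c, p', rfl⟩
    | tail _ _ hq => exact h _ hq

theorem Reduced.mulLeft {v w : V} {p : 𝔸.Path v w} (h : p.Reduced) (a : 𝔸.vert v) :
    (p.mulLeft a).Reduced := fun q hq => h (q.mulLeft a⁻¹) (by simpa using hq.mulLeft a⁻¹)

theorem Reduced.comp_nil {v w : V} {p : 𝔸.Path v w} (h : p.Reduced) (a : 𝔸.vert w) :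
    (p.comp (nil a)).Reduced := fun q hq => by
  have := hq.comp_left (nil a⁻¹)
  rw [comp_assoc] at this
  exact h _ (by simpa using this)

/-- Paths that overlap in a path of positive length can be glued without losing reducedness. -/
theorem Reduced.glue {v w x y : V} {p : 𝔸.Path v w} {q : 𝔸.Path w x} {r : 𝔸.Path x y}
    (h : (p.comp q).Reduced) (h' : (q.comp r).Reduced) (hq : q.length ≠ 0) :
    (p.comp (q.comp r)).Reduced := by
  induction p with
  | nil a => exact h'.mulLeft a
  | cons a e p ih =>
    rw [cons_comp, reduced_cons_iff] at h ⊢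
    refine ⟨ih h.1 h' hq, ?_⟩
    rintro ⟨c, s, hs⟩
    have hpos : (p.comp q).length ≠ 0 := by simp [hq]
    rw [← comp_assoc] at hs
    have := h.2
    revert hs hpos this
    generalize p.comp q = t
    intro hs hpos hn
    cases t with
    | nil b => simp [Path.length] at hpos
    | cons b e' t =>
      simp only [cons_comp, cons.injEq] at hs
      obtain ⟨hx, hb, he, -⟩ := hs
      subst hx
      obtain rfl := eq_of_heq he
      exact hn ⟨c, t, by rw [hb]⟩

theorem CyclicallyReduced.pow_succ_reduced {v : V} {p : 𝔸.Path v v} (h : p.CyclicallyReduced)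
    (n : ℕ) :
    (p.pow (n + 1)).Reduced := by
  by_cases hp : p.length = 0
  · cases p with
    | nil a => rw [nil_pow]; exact reduced_nil _
    | cons => simp [Path.length] at hp
  · induction n with
    | zero => exact h.1
    | succ n ih =>
      rw [pow_succ] at ih
      rw [pow_succ, pow_succ, comp_assoc]
      exact ih.glue h.2 hp

theorem exists_reduced_equivalent {v w : V} (p : 𝔸.Path v w) :
    ∃ q : 𝔸.Path v w, q.Reduced ∧ p.Equivalent q := by
  induction hn : p.length using Nat.strong_induction_on generalizing p with
  | _ n ih =>
    by_cases hp : p.Reduced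
    · exact ⟨p, hp, .refl p⟩
    · simp only [Reduced, not_forall, not_not] at hp
      obtain ⟨r, hr⟩ := hp
      obtain ⟨q, hq, hrq⟩ := ih _ (hn ▸ hr.length) r rfl
      exact ⟨q, hq, .trans (.rel _ _ hr) hrq⟩

/-! ### The normal form theorem -/

/-- Two paths with the same edges that differ by shifting elements of edge groups across edges. -/
inductive Shift : ∀ {v w : V}, 𝔸.Path v w → 𝔸.Path v w → Prop
  | nil {v : V} (a : 𝔸.vert v) : Shift (nil a) (nil a)
  | cons {v x w : V} (a b : 𝔸.vert v) (e : v ⟶ x) (c : 𝔸.edge e) {p q r : 𝔸.Path x w} (h : Shift p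
      q)
      (hb : b = a * 𝔸.α e c) (hr : r = q.mulLeft (𝔸.ω e c)) : Shift (cons b e p) (cons a e r)

theorem Shift.refl {v w : V} (p : 𝔸.Path v w) : Shift p p := by
  induction p with
  | nil a => exact .nil a
  | cons a e p ih => exact .cons a a e 1 ih (by simp) (by simp)

theorem Shift.mulLeft {v w : V} {p q : 𝔸.Path v w} (h : Shift p q) (g : 𝔸.vert v) :
    Shift (p.mulLeft g) (q.mulLeft g) := by
  cases h with
  | nil a => exact .nil _
  | cons a b e c h hb hr => exact .cons _ _ e c h (by rw [hb, mul_assoc]) hr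

theorem Shift.symm {v w : V} {p q : 𝔸.Path v w} (h : Shift p q) : Shift q p := by
  induction h with
  | nil a => exact .nil a
  | cons a b e c h hb hr ih =>
    subst hb hr
    exact .cons _ _ e c⁻¹ (ih.mulLeft _) (by simp) (by simp)

theorem Shift.cons_inv {v w x : V} {b : 𝔸.vert v} {e : v ⟶ x} {p : 𝔸.Path x w} {s : 𝔸.Path v w}
    (h : Shift (Path.cons b e p) s) :
    ∃ a c q, Shift p q ∧ b = a * 𝔸.α e c ∧ s = Path.cons a e (q.mulLeft (𝔸.ω e c)) := by
  cases h with
  | cons a _ _ c h hb hr => exact ⟨a, c, _, h, hb, by rw [hr]⟩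

theorem Shift.trans {v w : V} {p q r : 𝔸.Path v w} (h : Shift p q) (h' : Shift q r) :
    Shift p r := by
  induction h with
  | nil a => exact h'
  | cons a b e c h hb hr ih =>
    subst hb hr
    obtain ⟨a', d, s, hs, rfl, rfl⟩ := h'.cons_inv
    have := ih (r := s.mulLeft (𝔸.ω e c)⁻¹) (by simpa using hs.mulLeft (𝔸.ω e c)⁻¹)
    exact .cons _ _ e (d * c) this (by simp [mul_assoc]) (by simp)

open Classical in
/-- Prolong a reduced path on the left by `⟨a, e⟩`, and carry out the elementary reduction that
becomes applicable, if any. -/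
noncomputable def reduceCons {v x w : V} (a : 𝔸.vert v) (e : v ⟶ x) (p : 𝔸.Path x w) : 𝔸.Path v w :=
  if h : ∃ c, ∃ q : 𝔸.Path v w, p = cons (𝔸.ω e c) (reverse e) q then
    h.choose_spec.choose.mulLeft (a * 𝔸.α e h.choose)
  else cons a e p

/-- A reduced path equivalent to a given path. -/
noncomputable def reduce {v w : V} : 𝔸.Path v w → 𝔸.Path v w
  | nil a => nil a
  | cons a e p => reduceCons a e p.reduce

theorem reduceCons_pos {v x w : V} (a : 𝔸.vert v) (e : v ⟶ x) (c : 𝔸.edge e) (q : 𝔸.Path v w) :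
    reduceCons a e (cons (𝔸.ω e c) (reverse e) q) = q.mulLeft (a * 𝔸.α e c) := by
  have h : ∃ d, ∃ r : 𝔸.Path v w, cons (𝔸.ω e c) (reverse e) q = cons (𝔸.ω e d) (reverse e) r :=
    ⟨c, q, rfl⟩
  rw [reduceCons, dif_pos h]
  have hs := h.choose_spec.choose_spec
  generalize h.choose_spec.choose = r at hs ⊢
  generalize h.choose = d at hs ⊢
  simp only [cons.injEq, heq_eq_eq, true_and] at hs
  rw [← hs.2, ← 𝔸.ω_injective e hs.1]

theorem reduceCons_neg {v x w : V} (a : 𝔸.vert v) (e : v ⟶ x) {p : 𝔸.Path x w}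
    (h : ¬ ∃ c, ∃ q : 𝔸.Path v w, p = cons (𝔸.ω e c) (reverse e) q) :
    reduceCons a e p = cons a e p := dif_neg h

theorem reduceCons_mulLeft {v x w : V} (g a : 𝔸.vert v) (e : v ⟶ x) (p : 𝔸.Path x w) :
    (reduceCons a e p).mulLeft g = reduceCons (g * a) e p := by
  by_cases h : ∃ c, ∃ q : 𝔸.Path v w, p = cons (𝔸.ω e c) (reverse e) q
  · obtain ⟨c, q, rfl⟩ := h
    simp [reduceCons_pos, mul_assoc]
  · simp [reduceCons_neg _ _ h]

theorem reduce_mulLeft {v w : V} (g : 𝔸.vert v) (p : 𝔸.Path v w) :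
    (p.mulLeft g).reduce = p.reduce.mulLeft g := by
  cases p with
  | nil a => rfl
  | cons a e p => exact (reduceCons_mulLeft g a e _).symm

theorem Reduced.reduceCons {v x w : V} (a : 𝔸.vert v) (e : v ⟶ x) {p : 𝔸.Path x w}
    (hp : p.Reduced) : (reduceCons a e p).Reduced := by
  by_cases h : ∃ c, ∃ q : 𝔸.Path v w, p = Path.cons (𝔸.ω e c) (reverse e) q
  · obtain ⟨c, q, rfl⟩ := h
    rw [reduceCons_pos]
    exact ((reduced_cons_iff _ _ _).1 hp).1.mulLeft _
  · rw [reduceCons_neg _ _ h]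
    exact (reduced_cons_iff _ _ _).2 ⟨hp, h⟩

theorem reduced_reduce {v w : V} (p : 𝔸.Path v w) : p.reduce.Reduced := by
  induction p with
  | nil a => exact reduced_nil a
  | cons a e p ih => exact ih.reduceCons a e

theorem Reduced.reduce_eq {v w : V} {p : 𝔸.Path v w} (h : p.Reduced) : p.reduce = p := by
  induction p with
  | nil a => rfl
  | cons a e p ih =>
    rw [reduced_cons_iff] at h
    rw [reduce, ih h.1, reduceCons_neg a e h.2]

theorem exists_bar_eq {v x : V} (e : v ⟶ x) (d : 𝔸.edge (reverse e)) :
    ∃ c : 𝔸.edge e, 𝔸.α (reverse e) d = 𝔸.ω e c ∧ 𝔸.ω (reverse e) d = 𝔸.α e c :=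
  ⟨(𝔸.bar e).symm d, by rw [← 𝔸.α_bar, MulEquiv.apply_symm_apply],
    by rw [← 𝔸.ω_bar, MulEquiv.apply_symm_apply]⟩

theorem Shift.exists_cons_reverse {v x w : V} {e : v ⟶ x} {p q : 𝔸.Path x w} (h : Shift p q)
    {c : 𝔸.edge e} {r : 𝔸.Path v w} (hp : p = Path.cons (𝔸.ω e c) (reverse e) r) :
    ∃ d s, Shift r s ∧ q = Path.cons (𝔸.ω e (c * d⁻¹)) (reverse e) (s.mulLeft (𝔸.α e d)) := by
  subst hp
  obtain ⟨a, d, s, hs, ha, rfl⟩ := h.cons_inv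
  obtain ⟨d, hd, hd'⟩ := exists_bar_eq e d
  refine ⟨d, s, hs, ?_⟩
  rw [hd']
  rw [hd] at ha
  simp [ha]

theorem Shift.reduceCons {v x w : V} (a : 𝔸.vert v) (e : v ⟶ x) {p q : 𝔸.Path x w}
    (h : Shift p q) : Shift (reduceCons a e p) (reduceCons a e q) := by
  by_cases hp : ∃ c, ∃ r : 𝔸.Path v w, p = Path.cons (𝔸.ω e c) (reverse e) r
  · obtain ⟨c, r, rfl⟩ := hp
    obtain ⟨d, s, hs, rfl⟩ := h.exists_cons_reverse rfl
    rw [reduceCons_pos, reduceCons_pos]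
    simpa [mul_assoc] using hs.mulLeft (a * 𝔸.α e c)
  · have hq : ¬ ∃ c, ∃ r : 𝔸.Path v w, q = Path.cons (𝔸.ω e c) (reverse e) r := by
      rintro ⟨c, r, hr⟩
      obtain ⟨d, s, -, hs⟩ := h.symm.exists_cons_reverse hr
      exact hp ⟨_, _, hs⟩
    rw [reduceCons_neg _ _ hp, reduceCons_neg _ _ hq]
    exact .cons a a e 1 h (by simp) (by simp)

theorem reduceCons_reduceCons {v x w : V} (a : 𝔸.vert v) (e : v ⟶ x) (c : 𝔸.edge e)
    {p : 𝔸.Path v w} (h : p.Reduced) :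
    Shift (reduceCons a e (reduceCons (𝔸.ω e c) (reverse e) p)) (p.mulLeft (a * 𝔸.α e c)) := by
  by_cases hp : ∃ d, ∃ r : 𝔸.Path x w,
      p = cons (𝔸.ω (reverse e) d) (reverse (reverse e)) r
  · obtain ⟨d, r, rfl⟩ := hp
    rw [reduceCons_pos]
    obtain ⟨d', hd, hd'⟩ := exists_bar_eq e d
    rw [reverse_reverse, hd', reduced_cons_iff] at h
    have hr : ¬ ∃ g, ∃ s : 𝔸.Path v w,
        r.mulLeft (𝔸.ω e (c * d')) = cons (𝔸.ω e g) (reverse e) s := by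
      rintro ⟨g, s, hs⟩
      refine h.2 ⟨(c * d')⁻¹ * g, s, ?_⟩
      simpa using congrArg (Path.mulLeft (𝔸.ω e (c * d'))⁻¹) hs
    rw [hd, ← map_mul, reduceCons_neg _ _ hr, hd', reverse_reverse]
    refine .cons _ _ e (c * d')⁻¹ (.refl _) ?_ ?_ <;> simp [mul_assoc]
  · rw [reduceCons_neg _ _ hp, reduceCons_pos]
    exact .refl _

theorem ElemRed.shift_reduce {v w : V} {p q : 𝔸.Path v w} (h : ElemRed p q) :
    Shift p.reduce q.reduce := by
  induction h with
  | head a e c p =>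
    rw [reduce_mulLeft]
    exact reduceCons_reduceCons a e c p.reduced_reduce
  | tail a e h ih => exact ih.reduceCons a e

theorem Equivalent.shift_reduce {v w : V} {p q : 𝔸.Path v w} (h : p.Equivalent q) :
    Shift p.reduce q.reduce := by
  induction h with
  | rel p q h => exact h.shift_reduce
  | refl p => exact .refl _
  | symm p q _ ih => exact ih.symm
  | trans p q r _ _ ih₁ ih₂ => exact ih₁.trans ih₂

/-- The normal form theorem for graphs of groups. -/
theorem Equivalent.shift {v w : V} {p q : 𝔸.Path v w} (h : p.Equivalent q) (hp : p.Reduced)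
    (hq : q.Reduced) : Shift p q := by
  simpa [hp.reduce_eq, hq.reduce_eq] using h.shift_reduce

end GraphOfGroups.Path

/-! ### Reading a path in a folded graph -/

namespace AGraph

open GraphOfGroups GraphOfGroups.Path

variable {V : Type u₁} [Quiver.{v₁} V] [HasInvolutiveReverse V]
  {𝔸 : GraphOfGroups.{u₁, u₃, u₄, v₁} V} {U : Type u₂} [Quiver.{v₂} U] [HasInvolutiveReverse U]
  {𝔹 : AGraph 𝔸 U}

/-- The inclusion of the vertex group `B_u` in `A_[u]`. -/
def incl (𝔹 : AGraph 𝔸 U) (u : U) : 𝔹.toGraphOfGroups.vert u →* 𝔸.vert (𝔹.type.obj u) :=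
  (𝔹.vert u).subtype

/-- The inclusion of the edge group `B_f` in `A_[f]`. -/
def inclEdge (𝔹 : AGraph 𝔸 U) {u w : U} (f : u ⟶ w) :
    𝔹.toGraphOfGroups.edge f →* 𝔸.edge (𝔹.type.map f) :=
  (𝔹.edge f).subtype

/-- An element of `B_u`, as an element of the vertex group of the graph of groups. -/
def toVert {u : U} {a : 𝔸.vert (𝔹.type.obj u)} (h : a ∈ 𝔹.vert u) : 𝔹.toGraphOfGroups.vert u :=
  (⟨a, h⟩ : 𝔹.vert u)

@[simp] theorem incl_toVert {u : U} {a : 𝔸.vert (𝔹.type.obj u)} (h : a ∈ 𝔹.vert u) :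
    𝔹.incl u (toVert h) = a := rfl

theorem incl_mem {u : U} (b : 𝔹.toGraphOfGroups.vert u) : 𝔹.incl u b ∈ 𝔹.vert u :=
  Subtype.property (p := (· ∈ 𝔹.vert u)) b

theorem incl_injective (u : U) : Function.Injective (𝔹.incl u) := Subtype.val_injective

@[simp] theorem μ_nil {u : U} (b : 𝔹.toGraphOfGroups.vert u) :
    𝔹.μ (.nil b) = .nil (𝔹.incl u b) := rfl

@[simp] theorem μ_cons {u w x : U} (b : 𝔹.toGraphOfGroups.vert u) (f : u ⟶ w) (q : 𝔹.Path w x) :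
    𝔹.μ (.cons b f q) =
      .cons (𝔹.incl u b * 𝔹.lα f) (𝔹.type.map f) ((𝔹.μ q).mulLeft (𝔹.lω f)) := rfl

@[simp] theorem μ_mulLeft {u w : U} (b : 𝔹.toGraphOfGroups.vert u) (q : 𝔹.Path u w) :
    𝔹.μ (q.mulLeft b) = (𝔹.μ q).mulLeft (𝔹.incl u b) := by
  cases q <;> simp [mul_assoc]

theorem μ_comp {u w x : U} (q : 𝔹.Path u w) (r : 𝔹.Path w x) :
    𝔹.μ (q.comp r) = (𝔹.μ q).comp (𝔹.μ r) := by
  induction q with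
  | nil b => simp
  | cons b f q ih => simp [ih]

theorem incl_α {u w : U} (f : u ⟶ w) (c : 𝔹.toGraphOfGroups.edge f) :
    𝔹.incl u (𝔹.toGraphOfGroups.α f c) =
      𝔹.lα f * 𝔸.α (𝔹.type.map f) (𝔹.inclEdge f c) * (𝔹.lα f)⁻¹ := rfl

theorem incl_ω {u w : U} (f : u ⟶ w) (c : 𝔹.toGraphOfGroups.edge f) :
    𝔹.incl w (𝔹.toGraphOfGroups.ω f c) =
      (𝔹.lω f)⁻¹ * 𝔸.ω (𝔹.type.map f) (𝔹.inclEdge f c) * 𝔹.lω f := by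
  change (𝔹.lω f)⁻¹ * 𝔸.ω (𝔹.type.map f) (𝔹.inclEdge f c) * (𝔹.lω f)⁻¹⁻¹ = _
  rw [inv_inv]

theorem elemRed_μ {u w : U} {q r : 𝔹.Path u w} (h : ElemRed q r) : ElemRed (𝔹.μ q) (𝔹.μ r) := by
  induction h with
  | head b f c q =>
    have h := ElemRed.head (𝔹.incl _ b * 𝔹.lα f) (𝔹.type.map f) (𝔹.inclEdge f c)
      ((𝔹.μ q).mulLeft (𝔹.lα f)⁻¹)
    rw [mulLeft_mulLeft] at h
    rw [μ_cons, μ_cons, μ_mulLeft, mulLeft_cons, lα_reverse, lω_reverse, type_reverse, incl_ω]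
    convert h using 3
    · group
    · rw [map_mul, incl_α]
      group
  | tail b f h ih =>
    rw [μ_cons, μ_cons]
    exact .tail _ _ (ih.mulLeft _)

theorem equivalent_μ {u w : U} {q r : 𝔹.Path u w} (h : q.Equivalent r) :
    (𝔹.μ q).Equivalent (𝔹.μ r) := h.map (F := 𝔹.μ) fun _ _ h => elemRed_μ h

theorem inv_comp_μ_equivalent {u w : U} {x : V} (q : 𝔹.Path u w) (r : 𝔸.Path (𝔹.type.obj w) x) :
    ((𝔹.μ q.inv).comp ((𝔹.μ q).comp r)).Equivalent r := by
  rw [← comp_assoc, ← μ_comp]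
  simpa only [μ_nil, map_one, nil_comp, mulLeft_one] using
    (equivalent_μ (inv_comp_equivalent q)).comp (.refl r)

theorem Folded.reduced_μ (h𝔹 : 𝔹.Folded) {u w : U} {q : 𝔹.Path u w} (hq : q.Reduced) :
    (𝔹.μ q).Reduced := by
  induction q with
  | nil b => exact reduced_nil _
  | cons b f q ih =>
    rw [reduced_cons_iff] at hq
    rw [μ_cons, reduced_cons_iff]
    refine ⟨(ih hq.1).mulLeft _, ?_⟩
    rintro ⟨c, r, hr⟩
    cases q with
    | nil d =>
      rw [μ_nil, mulLeft_nil] at hr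
      generalize reverse (𝔹.type.map f) = e at *
      cases hr
    | cons d g q =>
      rw [μ_cons, mulLeft_cons] at hr
      injection hr with _ hx _ hd he
      have hstar : Quiver.Star.mk (𝔹.type.map g) = Quiver.Star.mk (reverse (𝔹.type.map f)) :=
        Sigma.ext hx he
      have hfg : Quiver.Star.mk g = Quiver.Star.mk (reverse f) := by
        by_contra hne
        exact h𝔹.no_fold f g hne hstar _ (incl_mem d) c (by rw [← hd, mul_assoc])
      injection hfg with hx' hg
      subst hx'
      obtain rfl := eq_of_heq hg
      rw [lα_reverse] at hd
      have hd' : 𝔹.incl _ d = (𝔹.lω f)⁻¹ * 𝔸.ω _ c * 𝔹.lω f := by rw [← hd]; group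
      have hc : c ∈ 𝔹.edgeω f := by
        simp only [edgeω, Subgroup.mem_comap, Subgroup.mem_conjBy, inv_inv, ← hd']
        exact incl_mem d
      have hc' : c ∈ 𝔹.edge f := ⟨by rw [h𝔹.edge_eq]; exact hc, hc⟩
      refine hq.2 ⟨(⟨c, hc'⟩ : 𝔹.edge f), q, ?_⟩
      congr 1
      apply incl_injective
      rw [hd']
      exact (incl_ω f (⟨c, hc'⟩ : 𝔹.edge f)).symm

/-- Some `𝔹`-path from `u` to `w` reads `p`. -/
def Readable (𝔹 : AGraph 𝔸 U) (u w : U) {v x : V} (p : 𝔸.Path v x) : Prop :=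
  ∃ q : 𝔹.Path u w, 𝔹.Reads q p

theorem readable_iff {u w : U} {p : 𝔸.Path (𝔹.type.obj u) (𝔹.type.obj w)} :
    𝔹.Readable u w p ↔ ∃ q : 𝔹.Path u w, (𝔹.μ q).Equivalent p :=
  ⟨fun ⟨q, _, _, h⟩ => ⟨q, h⟩, fun ⟨q, h⟩ => ⟨q, rfl, rfl, h⟩⟩

theorem Folded.exists_shift (h𝔹 : 𝔹.Folded) {u w : U} {x : V} {p : 𝔸.Path (𝔹.type.obj u) x}
    (hp : p.Reduced) (h : 𝔹.Readable u w p) :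
    ∃ hx : 𝔹.type.obj w = x, ∃ q : 𝔹.Path u w, Shift p ((𝔹.μ q).cast rfl hx) := by
  obtain ⟨q, hu, hw, hq⟩ := h
  subst hw
  obtain ⟨r, hr, hqr⟩ := q.exists_reduced_equivalent
  exact ⟨rfl, r, (hq.symm.trans (equivalent_μ hqr)).shift hp (h𝔹.reduced_μ hr)⟩

/-- The edge `f` and the element `c` carry on a reading at the vertex `u` whose remaining path
begins with the group element `a`. -/
def CanRead (𝔹 : AGraph 𝔸 U) {u w : U} (a : 𝔸.vert (𝔹.type.obj u)) (f : u ⟶ w)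
    (c : 𝔸.edge (𝔹.type.map f)) : Prop :=
  a * (𝔸.α (𝔹.type.map f) c)⁻¹ * (𝔹.lα f)⁻¹ ∈ 𝔹.vert u

/-- No edge can carry on a reading at `u` whose remaining path begins with `⟨a, e⟩`. -/
def Stuck (𝔹 : AGraph 𝔸 U) (u : U) {x : V} (a : 𝔸.vert (𝔹.type.obj u)) (e : 𝔹.type.obj u ⟶ x) :
    Prop :=
  ∀ (w : U) (f : u ⟶ w) (c : 𝔸.edge (𝔹.type.map f)),
    Quiver.Star.mk (𝔹.type.map f) = Quiver.Star.mk e → ¬ 𝔹.CanRead a f c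

theorem Folded.not_stuck (h𝔹 : 𝔹.Folded) {u w : U} {x y : V} {a : 𝔸.vert (𝔹.type.obj u)}
    {e : 𝔹.type.obj u ⟶ y} {p : 𝔸.Path y x} (hp : (Path.cons a e p).Reduced)
    (h : 𝔹.Readable u w (Path.cons a e p)) : ¬ 𝔹.Stuck u a e := by
  obtain ⟨rfl, q, hq⟩ := h𝔹.exists_shift hp h
  obtain ⟨b, c, r, -, rfl, hr⟩ := hq.cons_inv
  intro hs
  cases q with
  | nil d => cases hr
  | cons d f q =>
    rw [μ_cons] at hr
    injection hr with _ hx _ hd he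
    subst hx
    obtain rfl := eq_of_heq he
    exact hs _ f c rfl (by simpa [CanRead, ← hd] using incl_mem d)

theorem Folded.readable_nil_iff (h𝔹 : 𝔹.Folded) {u w : U} {a : 𝔸.vert (𝔹.type.obj u)} :
    𝔹.Readable u w (Path.nil a) ↔ u = w ∧ a ∈ 𝔹.vert u := by
  constructor
  · intro h
    obtain ⟨hx, q, hq⟩ := h𝔹.exists_shift (reduced_nil a) h
    cases q with
    | nil d =>
      cases hq
      exact ⟨rfl, incl_mem d⟩
    | cons d f q =>
      rw [μ_cons] at hq
      have key : ∀ (y : V) (hy : y = 𝔹.type.obj u) (s : 𝔸.Path (𝔹.type.obj u) y),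
          s.length ≠ 0 → ¬ Shift (.nil a) (s.cast rfl hy) := by
        rintro _ rfl s hs h
        cases h
        exact hs rfl
      exact (key _ hx _ (by simp [GraphOfGroups.Path.length]) hq).elim
  · rintro ⟨rfl, ha⟩
    exact readable_iff.2 ⟨.nil (toVert ha), .refl _⟩

/-- `q` reads an initial part of `p`, and `r` is what remains to be read. -/
structure ReadsInitial (𝔹 : AGraph 𝔸 U) {u w : U} {x : V} (p : 𝔸.Path (𝔹.type.obj u) x)
    (q : 𝔹.Path u w) (r : 𝔸.Path (𝔹.type.obj w) x) : Prop where
  equivalent : ((𝔹.μ q).comp r).Equivalent p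
  reduced : ∀ ⦃y : V⦄ (s : 𝔸.Path x y), (p.comp s).Reduced → (r.comp s).Reduced

theorem ReadsInitial.refl {u : U} {x : V} (p : 𝔸.Path (𝔹.type.obj u) x) :
    𝔹.ReadsInitial p (.nil 1) p :=
  ⟨by simpa using Equivalent.refl p, fun _ _ h => h⟩

theorem ReadsInitial.comp {u w : U} {x y : V} {p : 𝔸.Path (𝔹.type.obj u) x} {q : 𝔹.Path u w}
    {r : 𝔸.Path (𝔹.type.obj w) x} (h : 𝔹.ReadsInitial p q r) (s : 𝔸.Path x y) :
    𝔹.ReadsInitial (p.comp s) q (r.comp s) :=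
  ⟨by simpa [comp_assoc] using h.equivalent.comp (.refl s), fun _ t ht => by
    rw [comp_assoc] at ht ⊢
    exact h.reduced _ ht⟩

/-- The reading of one more edge. -/
theorem ReadsInitial.step {u w y : U} {x : V} {p : 𝔸.Path (𝔹.type.obj u) x} {q : 𝔹.Path u w}
    {a : 𝔸.vert (𝔹.type.obj w)} {f : w ⟶ y} {r : 𝔸.Path (𝔹.type.obj y) x}
    (h : 𝔹.ReadsInitial p q (.cons a (𝔹.type.map f) r)) {c : 𝔸.edge (𝔹.type.map f)}
    (hc : 𝔹.CanRead a f c) :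
    𝔹.ReadsInitial p
      (q.comp (.cons (toVert hc) f (.nil 1)))
      (r.mulLeft ((𝔹.lω f)⁻¹ * 𝔸.ω (𝔹.type.map f) c)) := by
  refine ⟨?_, fun z s hs => ?_⟩
  · refine .trans ?_ h.equivalent
    rw [μ_comp, comp_assoc]
    refine (Equivalent.refl _).comp ?_
    have hb : 𝔹.incl w (toVert hc) = a * (𝔸.α (𝔹.type.map f) c)⁻¹ * (𝔹.lα f)⁻¹ := rfl
    have := cons_mul_α_equivalent (a * (𝔸.α _ c)⁻¹) (𝔹.type.map f) c r
    simpa [hb] using this.symm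
  · have := h.reduced s hs
    rw [cons_comp, reduced_cons_iff] at this
    simpa using this.1.mulLeft _

theorem ReadsInitial.readable {u w z : U} {x : V} {p : 𝔸.Path (𝔹.type.obj u) x} {q : 𝔹.Path u w}
    {r : 𝔸.Path (𝔹.type.obj w) x} (h : 𝔹.ReadsInitial p q r) :
    𝔹.Readable u z p ↔ 𝔹.Readable w z r := by
  constructor
  · rintro ⟨s, hu, hz, hs⟩
    subst hz
    refine readable_iff.2 ⟨q.inv.comp s, ?_⟩
    rw [μ_comp]
    exact ((Equivalent.refl _).comp (hs.trans h.equivalent.symm)).trans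
      (inv_comp_μ_equivalent q r)
  · rintro ⟨s, hu, hz, hs⟩
    subst hz
    refine readable_iff.2 ⟨q.comp s, ?_⟩
    rw [μ_comp]
    exact ((Equivalent.refl _).comp hs).trans h.equivalent

/-- No reduced prolongation of `p` can be read from `u`. -/
def Blocked (𝔹 : AGraph 𝔸 U) (u : U) {v x : V} (p : 𝔸.Path v x) : Prop :=
  ∀ ⦃y : V⦄ (s : 𝔸.Path x y), (p.comp s).Reduced → ∀ w, ¬ 𝔹.Readable u w (p.comp s)

theorem ReadsInitial.blocked (h𝔹 : 𝔹.Folded) {u w : U} {x y : V} {p : 𝔸.Path (𝔹.type.obj u) x}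
    {q : 𝔹.Path u w} {a : 𝔸.vert (𝔹.type.obj w)} {e : 𝔹.type.obj w ⟶ y} {r : 𝔸.Path y x}
    (h : 𝔹.ReadsInitial p q (.cons a e r)) (hs : 𝔹.Stuck w a e) : 𝔹.Blocked u p := by
  intro y s hred z hz
  refine h𝔹.not_stuck ?_ ((h.comp s).readable.1 hz) hs
  exact h.reduced s hred

/-- A reading that was completed up to a last group element refutes blockedness. -/
theorem ReadsInitial.not_blocked {u w : U} {p : 𝔸.Path (𝔹.type.obj u) (𝔹.type.obj w)}
    {q : 𝔹.Path u w} {a : 𝔸.vert (𝔹.type.obj w)} (h : 𝔹.ReadsInitial p q (.nil a))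
    (hp : p.Reduced) : ¬ 𝔹.Blocked u p := fun hb => by
  refine hb (.nil a⁻¹) (hp.comp_nil _) w (readable_iff.2 ⟨q, ?_⟩)
  have := h.equivalent.comp (.refl (.nil a⁻¹))
  rw [comp_assoc] at this
  simpa using this

/-- If a loop at `u` reads `p ^ m`, then a reading of `p ^ n` with `n > m` can be shortened. -/
theorem Readable.shorten {u w : U} {v : V} {p : 𝔸.Path v v} {m n : ℕ}
    (h : 𝔹.Readable u u (p.pow m)) (h' : 𝔹.Readable u w (p.pow (m + n))) :
    𝔹.Readable u w (p.pow n) := by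
  obtain ⟨q, hu, hw, hq⟩ := h
  subst hu
  have hq' : ((𝔹.μ q).comp (p.pow n)).Equivalent (p.pow (m + n)) := by
    rw [Path.pow_add]
    exact Equivalent.comp hq (.refl _)
  obtain ⟨r, _, hw', hr⟩ := h'
  refine ⟨q.inv.comp r, rfl, hw', ?_⟩
  have key : ∀ {x : V} (hx : 𝔹.type.obj w = x) (s : 𝔸.Path (𝔹.type.obj u) x),
      ((𝔹.μ r).cast rfl hx).Equivalent ((𝔹.μ q).comp s) →
      ((𝔹.μ (q.inv.comp r)).cast rfl hx).Equivalent s := by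
    rintro _ rfl s hs
    change (𝔹.μ (q.inv.comp r)).Equivalent s
    rw [μ_comp]
    exact ((Equivalent.refl _).comp hs).trans (inv_comp_μ_equivalent q s)
  exact key hw' _ (hr.trans hq'.symm)

end AGraph

/-! ### Readings of powers repeat or break off -/

namespace GraphOfGroups

variable {V : Type u₁} [Quiver.{v₁} V] [HasInvolutiveReverse V]
  {𝔸 : GraphOfGroups.{u₁, u₃, u₄, v₁} V}

theorem range_α_reverse {v x : V} (e : v ⟶ x) : (𝔸.α (reverse e)).range = (𝔸.ω e).range := by
  ext a
  constructor
  · rintro ⟨d, rfl⟩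
    obtain ⟨c, hc, -⟩ := Path.exists_bar_eq e d
    exact ⟨c, hc.symm⟩
  · rintro ⟨c, rfl⟩
    exact ⟨_, 𝔸.α_bar e c⟩

theorem range_α_congr {v x y : V} {e : v ⟶ x} {e' : v ⟶ y}
    (h : Quiver.Star.mk e = Quiver.Star.mk e') : (𝔸.α e).range = (𝔸.α e').range := by
  cases h
  rfl

namespace Path

theorem exists_cons_eq_of_star_eq {v x y w : V} {e : v ⟶ x} {e' : v ⟶ y}
    (h : Quiver.Star.mk e = Quiver.Star.mk e') (a : 𝔸.vert v) (p : 𝔸.Path x w) :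
    ∃ q : 𝔸.Path y w, cons a e p = cons a e' q := by
  cases h
  exact ⟨p, rfl⟩

/-- The first group element of a path. -/
def head {v w : V} : 𝔸.Path v w → 𝔸.vert v
  | nil a => a
  | cons a _ _ => a

/-- The paths that remain when a path is cut after one of its edges. -/
def tails {v w : V} : 𝔸.Path v w → Set (Σ x : V, 𝔸.Path x w)
  | nil _ => ∅
  | cons _ _ p => insert ⟨_, p⟩ p.tails

theorem finite_tails {v w : V} (p : 𝔸.Path v w) : p.tails.Finite := by
  induction p with
  | nil a => exact Set.finite_empty
  | cons a e p ih => exact ih.insert _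

theorem tails_subset_tails {v w : V} {p : 𝔸.Path v w} {q : Σ x : V, 𝔸.Path x w} (h : q ∈ p.tails) :
    q.2.tails ⊆ p.tails := by
  induction p with
  | nil a => exact absurd h (Set.notMem_empty _)
  | cons a e p ih =>
    rcases h with rfl | h
    · exact Set.subset_insert _ _
    · exact (ih h).trans (Set.subset_insert _ _)

theorem mem_tails_cons {v x w : V} (a : 𝔸.vert v) (e : v ⟶ x) (p : 𝔸.Path x w) :
    (⟨x, p⟩ : Σ x : V, 𝔸.Path x w) ∈ (cons a e p).tails := Set.mem_insert _ _

end Path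

end GraphOfGroups

theorem Subgroup.conjBy_conjBy {G : Type*} [Group G] (C : Subgroup G) (x y : G) :
    (C.conjBy x).conjBy y = C.conjBy (x * y) := by
  ext g
  simp [Subgroup.mem_conjBy, mul_assoc]

theorem Set.Infinite.exists_infinite_fiber {α β : Type*} {A : Set α} (hA : A.Infinite) {g : α → β}
    {F : Set β} (hF : F.Finite) (h : ∀ i ∈ A, g i ∈ F) : ∃ b ∈ F, {i ∈ A | g i = b}.Infinite := by
  by_contra! hcon
  refine hA ((hF.biUnion fun b hb => hcon b hb).subset fun i hi => ?_)
  exact Set.mem_biUnion (h i hi) ⟨hi, rfl⟩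

namespace AGraph

open GraphOfGroups GraphOfGroups.Path

variable {V : Type u₁} [Quiver.{v₁} V] [HasInvolutiveReverse V]
  {𝔸 : GraphOfGroups.{u₁, u₃, u₄, v₁} V} {U : Type u₂} [Quiver.{v₂} U] [HasInvolutiveReverse U]
  {𝔹 : AGraph 𝔸 U}

theorem Folded.mem_edge_of_α (h𝔹 : 𝔹.Folded) {u w : U} {f : u ⟶ w} {c : 𝔸.edge (𝔹.type.map f)}
    (h : 𝔹.lα f * 𝔸.α (𝔹.type.map f) c * (𝔹.lα f)⁻¹ ∈ 𝔹.vert u) : c ∈ 𝔹.edge f := by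
  have hc : c ∈ 𝔹.edgeα f := by simpa [edgeα, Subgroup.mem_conjBy] using h
  exact ⟨hc, h𝔹.edge_eq f ▸ hc⟩

theorem Folded.mem_edge_of_ω (h𝔹 : 𝔹.Folded) {u w : U} {f : u ⟶ w} {c : 𝔸.edge (𝔹.type.map f)}
    (h : (𝔹.lω f)⁻¹ * 𝔸.ω (𝔹.type.map f) c * 𝔹.lω f ∈ 𝔹.vert w) : c ∈ 𝔹.edge f := by
  have hc : c ∈ 𝔹.edgeω f := by simpa [edgeω, Subgroup.mem_conjBy] using h
  exact ⟨by rw [h𝔹.edge_eq]; exact hc, hc⟩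

theorem Folded.finite_inf_ω (h𝔹 : 𝔹.Folded) {u w : U} (f : u ⟶ w) [Finite (𝔹.edge f)] :
    Finite ↥(𝔹.vert w ⊓ (𝔸.ω (𝔹.type.map f)).range.conjBy (𝔹.lω f)) := by
  refine (Set.Finite.subset (Set.toFinite (Set.range fun c : 𝔹.edge f =>
    (𝔹.lω f)⁻¹ * 𝔸.ω (𝔹.type.map f) c * 𝔹.lω f)) ?_).to_subtype
  rintro g ⟨hg, hg'⟩
  obtain ⟨c, hc⟩ := (Subgroup.mem_conjBy _ _ _).1 hg'
  have hgc : g = (𝔹.lω f)⁻¹ * 𝔸.ω (𝔹.type.map f) c * 𝔹.lω f := by rw [hc]; group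
  exact ⟨⟨c, h𝔹.mem_edge_of_ω (hgc ▸ hg)⟩, hgc.symm⟩

theorem Folded.finite_inf_α (h𝔹 : 𝔹.Folded) {u w : U} (f : u ⟶ w) [Finite (𝔹.edge f)] :
    Finite ↥(𝔹.vert u ⊓ (𝔸.α (𝔹.type.map f)).range.conjBy (𝔹.lα f)⁻¹) := by
  refine (Set.Finite.subset (Set.toFinite (Set.range fun c : 𝔹.edge f =>
    𝔹.lα f * 𝔸.α (𝔹.type.map f) c * (𝔹.lα f)⁻¹)) ?_).to_subtype
  rintro g ⟨hg, hg'⟩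
  obtain ⟨c, hc⟩ := (Subgroup.mem_conjBy _ _ _).1 hg'
  have hgc : g = 𝔹.lα f * 𝔸.α (𝔹.type.map f) c * (𝔹.lα f)⁻¹ := by rw [hc]; group
  exact ⟨⟨c, h𝔹.mem_edge_of_α (hgc ▸ hg)⟩, hgc.symm⟩

/-- At a good pair of edges with finite edge groups, the double coset property leaves only finitely
many elements of the first edge group from which the reading can go on along the second edge. -/
theorem Folded.finite_of_goodPair (h𝔹 : 𝔹.Folded) {x u y : U} {f : x ⟶ u} {g : u ⟶ y}
    (hfg : 𝔹.GoodPair f g) (hFG : (𝔹.vert u).FG) (hf : Finite (𝔹.edge f)) (hg : Finite (𝔹.edge g))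
    (a : 𝔸.vert (𝔹.type.obj u)) :
    {c | ∃ c', 𝔹.CanRead ((𝔹.lω f)⁻¹ * 𝔸.ω (𝔹.type.map f) c * a) g c' ∧
      ¬ (Quiver.Star.mk (𝔹.type.map g) = Quiver.Star.mk (reverse (𝔹.type.map f)) ∧
        a ∈ (𝔸.ω (𝔹.type.map f)).range)}.Finite := by
  by_cases hcase : Quiver.Star.mk (𝔹.type.map g) = Quiver.Star.mk (reverse (𝔹.type.map f)) ∧
        a ∈ (𝔸.ω (𝔹.type.map f)).range
  · simp [hcase]
  simp only [hcase, not_false_eq_true, and_true]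
  have hω := h𝔹.finite_inf_ω f
  have hα := h𝔹.finite_inf_α g
  have key : {c : 𝔸.vert (𝔹.type.obj u) × 𝔸.vert (𝔹.type.obj u) |
      c.1 ∈ (𝔸.ω (𝔹.type.map f)).range.conjBy (𝔹.lω f) ∧
      c.2 ∈ (𝔸.α (𝔹.type.map g)).range.conjBy (𝔹.lα g)⁻¹ ∧
      c.1 * ((𝔹.lω f)⁻¹ * a * (𝔹.lα g)⁻¹) * c.2 ∈ 𝔹.vert u}.Finite := by
    by_cases hstar : Quiver.Star.mk (𝔹.type.map g) = Quiver.Star.mk (reverse (𝔹.type.map f))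
    -- If `[g] = [f]⁻¹`, then the two subgroups are conjugate by `x = f_ω⁻¹ g_α⁻¹`.
    · have hC : (𝔸.α (𝔹.type.map g)).range.conjBy (𝔹.lα g)⁻¹ =
          ((𝔸.ω (𝔹.type.map f)).range.conjBy (𝔹.lω f)).conjBy ((𝔹.lω f)⁻¹ * (𝔹.lα g)⁻¹) := by
        rw [Subgroup.conjBy_conjBy, mul_inv_cancel_left, range_α_congr hstar, range_α_reverse]
      rw [hC] at hα ⊢
      refine hfg.2 hstar _ hFG _ _ ?_ hω hα
      rw [Subgroup.mem_conjBy]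
      simpa [mul_assoc] using fun h => hcase ⟨hstar, h⟩
    · exact hfg.1 hstar _ hFG _ hω hα
  refine Set.Finite.of_finite_image ((key.image Prod.fst).subset ?_)
    (f := fun c => (𝔹.lω f)⁻¹ * 𝔸.ω (𝔹.type.map f) c * 𝔹.lω f) ?_
  · rintro _ ⟨c, ⟨c', hc⟩, rfl⟩
    refine ⟨(_, 𝔹.lα g * (𝔸.α (𝔹.type.map g) c')⁻¹ * (𝔹.lα g)⁻¹), ⟨?_, ?_, ?_⟩, rfl⟩
    · simp [Subgroup.mem_conjBy, mul_assoc]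
    · simp [Subgroup.mem_conjBy, mul_assoc]
    · simpa [CanRead, mul_assoc] using hc
  · intro c _ d _ h
    exact 𝔸.ω_injective _ (by simpa using h)

/-- If two powers are read up to the same remaining path and the same vertex, modulo the group of
this vertex, then their quotient is read by a loop. -/
theorem ReadsInitial.readable_loop {u w : U} {p : 𝔸.Path (𝔹.type.obj u) (𝔹.type.obj u)} {k n : ℕ}
    {q q' : 𝔹.Path u w} {r r' : 𝔸.Path (𝔹.type.obj w) (𝔹.type.obj u)}
    (h : 𝔹.ReadsInitial (p.pow k) q r) (h' : 𝔹.ReadsInitial (p.pow (n + k)) q' r')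
    {b : 𝔸.vert (𝔹.type.obj w)} (hb : b ∈ 𝔹.vert w) (hr : r' = r.mulLeft b) :
    𝔹.Readable u u (p.pow n) := by
  subst hr
  refine readable_iff.2 ⟨q'.comp (q.inv.mulLeft (toVert hb)), ?_⟩
  refine Equivalent.cancel_right (r := p.pow k) ?_
  rw [← Path.pow_add]
  refine .trans ?_ h'.equivalent
  rw [μ_comp, μ_mulLeft, comp_assoc, mulLeft_comp, incl_toVert]
  refine (Equivalent.refl _).comp (Equivalent.mulLeft ?_ b)
  exact ((Equivalent.refl _).comp h.equivalent.symm).trans (inv_comp_μ_equivalent q r)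

/-- The pair condition for edges that are given with their end points. -/
def GoodTotal (𝔹 : AGraph 𝔸 U) (T T' : Quiver.Total U) : Prop :=
  ∃ (x u y : U) (f : x ⟶ u) (g : u ⟶ y), T = ⟨x, u, f⟩ ∧ T' = ⟨u, y, g⟩ ∧ 𝔹.GoodPair f g

/-- An infinite edge path with finite edge groups contains a good pair of consecutive edges in each
of its closed parts. -/
theorem exists_goodTotal
    (hcycle : ∀ (m : ℕ), 0 < m → ∀ (u : ZMod m → U) (f : ∀ i, u i ⟶ u (i + 1)),
      (∀ i, Finite (𝔹.edge (f i))) → ∃ i, 𝔹.GoodPair (f i) (f (i + 1)))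
    {T : ℕ → Quiver.Total U} (hT : ∀ i, (T i).right = (T (i + 1)).left) {i j : ℕ} (hij : i < j)
    (h : T i = T j) (hfin : ∀ k, i ≤ k → Finite (𝔹.edge (T k).hom)) :
    ∃ k, i ≤ k ∧ 𝔹.GoodTotal (T k) (T (k + 1)) := by
  obtain ⟨m, rfl⟩ : ∃ m, j = i + m := ⟨j - i, by omega⟩
  have hm : 0 < m := by omega
  have : NeZero m := ⟨hm.ne'⟩
  have hτ (z : ZMod m) : T (i + (z + 1).val) = T (i + z.val + 1) := by
    have hz : (z + 1).val = (z.val + 1) % m := by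
      rw [← ZMod.val_natCast, Nat.cast_add, ZMod.natCast_zmod_val, Nat.cast_one]
    have hlt := z.val_lt
    rcases Nat.lt_or_ge (z.val + 1) m with h1 | h1
    · rw [hz, Nat.mod_eq_of_lt h1, add_assoc]
    · have h2 : z.val + 1 = m := by omega
      rw [hz, h2, Nat.mod_self, add_assoc, h2, add_zero, h]
  have hex (z : ZMod m) : ∃ f : (T (i + z.val)).left ⟶ (T (i + (z + 1).val)).left,
      T (i + z.val) = ⟨_, _, f⟩ := by
    have hr : (T (i + z.val)).right = (T (i + (z + 1).val)).left := by rw [hτ, hT]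
    rw [← hr]
    exact ⟨_, rfl⟩
  choose f hf using hex
  obtain ⟨z, hz⟩ := hcycle m hm _ f fun z => by
    have := hfin (i + z.val) (by omega)
    rw [hf z] at this
    exact this
  exact ⟨i + z.val, by omega, _, _, _, f z, f (z + 1), hf z, (hτ z).symm.trans (hf (z + 1)), hz⟩

/-- A path that is used up is prolonged by the loop `p`. -/
def refill {x v : V} (p : 𝔸.Path v v) (r : 𝔸.Path x v) : 𝔸.Path x v :=
  if r.length = 0 then r.comp p else r

theorem mem_tails_of_refill {x y v : V} {p : 𝔸.Path v v} {r : 𝔸.Path x v}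
    (hr : (⟨x, r⟩ : Σ x : V, 𝔸.Path x v) ∈ p.tails) {a : 𝔸.vert x} {e : x ⟶ y} {s : 𝔸.Path y v}
    (h : refill p r = .cons a e s) : (⟨y, s⟩ : Σ x : V, 𝔸.Path x v) ∈ p.tails := by
  rw [refill] at h
  split_ifs at h with h0
  · cases r with
    | nil b =>
      rw [nil_comp] at h
      have hp : p = .cons (b⁻¹ * a) e s := by simpa using congrArg (mulLeft b⁻¹) h
      rw [hp]
      exact mem_tails_cons _ _ _
    | cons => exact absurd h0 (Nat.succ_ne_zero _)
  · subst h
    exact tails_subset_tails hr (mem_tails_cons _ _ _)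

/-- A moment of a reading of powers of loops at `v`: the edge that is read and the path that remains
after it, together with an element of the group of the type of the edge. -/
abbrev ReadState (𝔹 : AGraph 𝔸 U) (v : V) :=
  Σ K : (Σ T : Quiver.Total U, 𝔸.Path (𝔹.type.obj T.right) v), 𝔸.edge (𝔹.type.map K.1.hom)

/-- The state `⟨⟨⟨u, w, f⟩, r⟩, c⟩` occurs at time `i` in the reading of powers of `p`: the first
`i` edges of a power of `p` have been read, and the edge `f` and `c` carry on the reading. -/
def Occurs (𝔹 : AGraph 𝔸 U) {z : U} (p : 𝔸.Path (𝔹.type.obj z) (𝔹.type.obj z)) (i : ℕ)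
    (S : ReadState 𝔹 (𝔹.type.obj z)) : Prop :=
  ∃ (a : 𝔸.vert (𝔹.type.obj S.1.1.left)) (q : 𝔹.Path z S.1.1.left) (m : ℕ),
    𝔹.ReadsInitial (p.pow (m + 1)) q (.cons a (𝔹.type.map S.1.1.hom) S.1.2) ∧
    𝔹.CanRead a S.1.1.hom S.2 ∧ i + (S.1.2.length + 1) = p.length * (m + 1) ∧
    (⟨_, S.1.2⟩ : Σ x : V, 𝔸.Path x _) ∈ p.tails

/-- The second state follows the first one in a reading of powers of `p`. -/
inductive Follows {v : V} (p : 𝔸.Path v v) : ReadState 𝔹 v → ReadState 𝔹 v → Prop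
  | mk {u w y : U} (f : u ⟶ w) (g : w ⟶ y) (r : 𝔸.Path (𝔹.type.obj w) v)
      (s : 𝔸.Path (𝔹.type.obj y) v) (c : 𝔸.edge (𝔹.type.map f)) (d : 𝔸.edge (𝔹.type.map g))
      (a : 𝔸.vert (𝔹.type.obj w)) (hr : refill p r = .cons a (𝔹.type.map g) s)
      (hd : 𝔹.CanRead ((𝔹.lω f)⁻¹ * 𝔸.ω (𝔹.type.map f) c * a) g d)
      (ha : ¬ (Quiver.Star.mk (𝔹.type.map g) = Quiver.Star.mk (reverse (𝔹.type.map f)) ∧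
        a ∈ (𝔸.ω (𝔹.type.map f)).range)) :
      Follows p ⟨⟨⟨u, w, f⟩, r⟩, c⟩ ⟨⟨⟨w, y, g⟩, s⟩, d⟩

theorem Folded.exists_canRead (h𝔹 : 𝔹.Folded) {u w : U} {x y : V} {p : 𝔸.Path (𝔹.type.obj u) x}
    {q : 𝔹.Path u w} {a : 𝔸.vert (𝔹.type.obj w)} {e : 𝔹.type.obj w ⟶ y} {r : 𝔸.Path y x}
    (h : 𝔹.ReadsInitial p q (.cons a e r)) (hp : ¬ 𝔹.Blocked u p) :
    ∃ (z : U) (f : w ⟶ z) (s : 𝔸.Path (𝔹.type.obj z) x) (c : 𝔸.edge (𝔹.type.map f)),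
      GraphOfGroups.Path.cons a e r = .cons a (𝔹.type.map f) s ∧ 𝔹.CanRead a f c := by
  have hs : ¬ 𝔹.Stuck w a e := fun hs => hp (h.blocked h𝔹 hs)
  simp only [Stuck, not_forall, not_not] at hs
  obtain ⟨z, f, c, hf, hc⟩ := hs
  obtain ⟨s, hs⟩ := exists_cons_eq_of_star_eq hf.symm a r
  exact ⟨z, f, s, c, hs, hc⟩

variable {z : U} {p : 𝔸.Path (𝔹.type.obj z) (𝔹.type.obj z)}

theorem Folded.exists_occurs_zero (h𝔹 : 𝔹.Folded) (hp0 : p.length ≠ 0)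
    (hp : ∀ m, ¬ 𝔹.Blocked z (p.pow (m + 1))) : ∃ S, 𝔹.Occurs p 0 S := by
  obtain ⟨x, a, e, r, hpr⟩ : ∃ (x : V) (a : 𝔸.vert _) (e : 𝔹.type.obj z ⟶ x) (r : 𝔸.Path x _),
      p = .cons a e r := by
    generalize 𝔹.type.obj z = v at *
    cases p with
    | nil => exact absurd rfl hp0
    | cons a e r => exact ⟨_, a, e, r, rfl⟩
  have hR := ReadsInitial.refl (𝔹 := 𝔹) (p.pow 1)
  have hR' := hR
  rw [Path.pow] at hR'
  nth_rw 2 [hpr] at hR'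
  obtain ⟨w, f, s, c, hs, hc⟩ := h𝔹.exists_canRead hR' (hp 0)
  rw [hs] at hpr
  refine ⟨⟨⟨⟨z, w, f⟩, s⟩, c⟩, a, .nil 1, 0, ?_, hc, ?_, ?_⟩
  · convert hR
    exact hpr.symm
  · rw [hpr]; simp [GraphOfGroups.Path.length]
  · rw [hpr]; exact mem_tails_cons _ _ _

theorem Folded.exists_follows (h𝔹 : 𝔹.Folded) (hcyc : p.CyclicallyReduced) (hp0 : p.length ≠ 0)
    (hp : ∀ m, ¬ 𝔹.Blocked z (p.pow (m + 1))) {i : ℕ} {S : ReadState 𝔹 (𝔹.type.obj z)}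
    (hS : 𝔹.Occurs p i S) : ∃ S', 𝔹.Occurs p (i + 1) S' ∧ Follows p S S' := by
  obtain ⟨⟨⟨u, w, f⟩, r⟩, c⟩ := S
  obtain ⟨a, q, m, hR, hc, hlen, htail⟩ := hS
  dsimp only at a q hR hc hlen htail
  have hstep := hR.step hc
  obtain ⟨m', hR', hlen', hred⟩ : ∃ m', 𝔹.ReadsInitial (p.pow (m' + 1))
      (q.comp (.cons (toVert hc) f (.nil 1)))
      ((refill p r).mulLeft ((𝔹.lω f)⁻¹ * 𝔸.ω (𝔹.type.map f) c)) ∧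
      i + 1 + (refill p r).length = p.length * (m' + 1) ∧
      (GraphOfGroups.Path.cons a (𝔹.type.map f) (refill p r)).Reduced := by
    by_cases h0 : r.length = 0
    · have hrf : refill p r = r.comp p := if_pos h0
      refine ⟨m + 1, ?_, ?_, ?_⟩
      · rw [hrf, Path.pow_succ, ← mulLeft_comp]
        exact hstep.comp p
      · rw [hrf, length_comp, mul_add, ← hlen]; omega
      · rw [hrf]
        refine hR.reduced p ?_
        rw [← Path.pow_succ]
        exact hcyc.pow_succ_reduced _
    · have hrf : refill p r = r := if_neg h0
      refine ⟨m, ?_, ?_, ?_⟩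
      · rw [hrf]; exact hstep
      · rw [hrf, ← hlen]; omega
      · rw [hrf]
        have := hR.reduced (.nil 1)
        simp only [comp_nil_one] at this
        exact this (hcyc.pow_succ_reduced _)
  have hrpos : (refill p r).length ≠ 0 := by
    rw [refill]
    split_ifs with h0
    · simp [hp0]
    · exact h0
  obtain ⟨x, b, e, s, hs⟩ : ∃ (x : V) (b : 𝔸.vert _) (e : 𝔹.type.obj w ⟶ x) (s : 𝔸.Path x _),
      refill p r = .cons b e s := by
    generalize refill p r = t at hrpos
    revert t
    generalize 𝔹.type.obj w = v
    intro t ht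
    cases t with
    | nil => exact absurd rfl ht
    | cons a e r => exact ⟨_, a, e, r, rfl⟩
  rw [hs, mulLeft_cons] at hR'
  obtain ⟨y, g, t, d, ht, hd⟩ := h𝔹.exists_canRead hR' (hp m')
  rw [ht] at hR'
  have hbt : refill p r = .cons b (𝔹.type.map g) t := by
    rw [hs]
    have := congrArg (mulLeft ((𝔹.lω f)⁻¹ * 𝔸.ω (𝔹.type.map f) c)⁻¹) ht
    simpa only [mulLeft_cons, inv_mul_cancel_left] using this
  refine ⟨⟨⟨⟨w, y, g⟩, t⟩, d⟩, ⟨_, _, m', hR', hd, ?_, mem_tails_of_refill htail hbt⟩,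
    .mk f g r t c d b hbt hd ?_⟩
  · rw [← hlen', hbt]; rfl
  · rintro ⟨hst, c', rfl⟩
    rw [hbt] at hred
    obtain ⟨t', ht'⟩ := exists_cons_eq_of_star_eq hst (𝔸.ω (𝔹.type.map f) c') t
    exact ((reduced_cons_iff _ _ _).1 hred).2 ⟨c', t', ht'⟩

/-- A repetition of a state, modulo the edge group, yields a loop that reads a power. -/
theorem Occurs.readable_loop {K : Σ T : Quiver.Total U, 𝔸.Path (𝔹.type.obj T.right) (𝔹.type.obj z)}
    {c d : 𝔸.edge (𝔹.type.map K.1.hom)} {i j : ℕ} (hij : i < j) (hc : 𝔹.Occurs p i ⟨K, c⟩)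
    (hd : 𝔹.Occurs p j ⟨K, d⟩) (hcd : d * c⁻¹ ∈ 𝔹.edge K.1.hom) :
    ∃ m, 0 < m ∧ 𝔹.Readable z z (p.pow m) := by
  obtain ⟨⟨u, w, f⟩, r⟩ := K
  obtain ⟨a, q, m, hR, hc, hlen, -⟩ := hc
  obtain ⟨a', q', m', hR', hd, hlen', -⟩ := hd
  dsimp only at *
  have hm : m < m' := by
    have : p.length * (m + 1) < p.length * (m' + 1) := by omega
    have := Nat.lt_of_mul_lt_mul_left this
    omega
  refine ⟨m' - m, by omega, ?_⟩
  have h1 := hR.step hc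
  have h2 := hR'.step hd
  rw [show m' + 1 = (m' - m) + (m + 1) by omega] at h2
  refine h1.readable_loop h2 ((𝔹.mem_edge_iff f _).1 hcd).2 ?_
  simp [mul_assoc]

theorem Folded.finite_follows (h𝔹 : 𝔹.Folded) (hFG : ∀ u, (𝔹.vert u).FG) {v : V} {p : 𝔸.Path v v}
    {K : Σ T : Quiver.Total U, 𝔸.Path (𝔹.type.obj T.right) v} {T' : Quiver.Total U}
    (h : 𝔹.GoodTotal K.1 T') (hf : Finite (𝔹.edge K.1.hom)) (hg : Finite (𝔹.edge T'.hom)) :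
    {c : 𝔸.edge (𝔹.type.map K.1.hom) | ∃ S', Follows p ⟨K, c⟩ S' ∧ S'.1.1 = T'}.Finite := by
  obtain ⟨T, r⟩ := K
  obtain ⟨x, u, y, f, g, hT, rfl, hgood⟩ := h
  dsimp only at hT
  subst hT
  refine (h𝔹.finite_of_goodPair hgood (hFG u) hf hg (refill p r).head).subset ?_
  rintro c ⟨S', hS', hST⟩
  generalize hS : (⟨⟨⟨x, u, f⟩, r⟩, c⟩ : ReadState 𝔹 v) = S at hS'
  cases hS' with
  | mk f₁ g₁ r₁ s₁ c₁ d₁ a₁ hr hd ha =>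
    cases hS
    cases hST
    refine ⟨d₁, ?_⟩
    rw [hr]
    exact ⟨hd, ha⟩

/-- A reading of the powers of `p` breaks off or closes up. -/
theorem Folded.exists_loop_or_blocked [Finite (Quiver.Total U)] (h𝔹 : 𝔹.Folded)
    (hFG : ∀ u, (𝔹.vert u).FG)
    (hindex : ∀ {u w : U} (f : u ⟶ w), Infinite (𝔹.edge f) → (𝔹.edge f).FiniteIndex)
    (hcycle : ∀ (m : ℕ), 0 < m → ∀ (u : ZMod m → U) (f : ∀ i, u i ⟶ u (i + 1)),
      (∀ i, Finite (𝔹.edge (f i))) → ∃ i, 𝔹.GoodPair (f i) (f (i + 1)))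
    (hcyc : p.CyclicallyReduced) (hp0 : p.length ≠ 0) :
    ∃ m, 0 < m ∧ (𝔹.Readable z z (p.pow m) ∨ 𝔹.Blocked z (p.pow m)) := by
  by_cases hp : ∃ m, 𝔹.Blocked z (p.pow (m + 1))
  · obtain ⟨m, hm⟩ := hp
    exact ⟨m + 1, m.succ_pos, .inr hm⟩
  push Not at hp
  suffices ∃ m, 0 < m ∧ 𝔹.Readable z z (p.pow m) from this.imp fun m h => ⟨h.1, .inl h.2⟩
  -- `s i` is the state at time `i` of an infinite reading.
  obtain ⟨S₀, hS₀⟩ := h𝔹.exists_occurs_zero hp0 hp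
  have : Nonempty (ReadState 𝔹 (𝔹.type.obj z)) := ⟨S₀⟩
  choose! next hnext using fun (x : ℕ × ReadState 𝔹 (𝔹.type.obj z)) (hx : 𝔹.Occurs p x.1 x.2) =>
    h𝔹.exists_follows hcyc hp0 hp hx
  let s : ℕ → ReadState 𝔹 (𝔹.type.obj z) := Nat.rec S₀ fun i S => next (i, S)
  have hs (i : ℕ) : 𝔹.Occurs p i (s i) := by
    induction i with
    | zero => exact hS₀
    | succ i ih => exact (hnext (i, s i) ih).1
  have hfollows (i : ℕ) : Follows p (s i) (s (i + 1)) := (hnext (i, s i) (hs i)).2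
  have hF : {K : Σ T : Quiver.Total U, 𝔸.Path (𝔹.type.obj T.right) (𝔹.type.obj z) |
      (⟨_, K.2⟩ : Σ x : V, 𝔸.Path x _) ∈ p.tails}.Finite := by
    have := (Set.finite_univ (α := Quiver.Total U)).prod p.finite_tails
    refine (this.preimage (f := fun K : Σ T : Quiver.Total U,
      𝔸.Path (𝔹.type.obj T.right) (𝔹.type.obj z) =>
        (K.1, (⟨_, K.2⟩ : Σ x : V, 𝔸.Path x (𝔹.type.obj z)))) ?_).subset fun K hK => ⟨trivial, hK⟩
    rintro ⟨T, r⟩ - ⟨T', r'⟩ - h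
    simp only [Prod.mk.injEq] at h
    obtain ⟨rfl, h⟩ := h
    simpa using h
  have hK (i : ℕ) : (s i).1 ∈ {K : Σ T : Quiver.Total U,
      𝔸.Path (𝔹.type.obj T.right) (𝔹.type.obj z) |
      (⟨_, K.2⟩ : Σ x : V, 𝔸.Path x _) ∈ p.tails} := by
    obtain ⟨_, _, _, _, _, _, h⟩ := hs i
    exact h
  have hex (K) (i : ℕ) (h : (s i).1 = K) : ∃ c, s i = ⟨K, c⟩ := by
    subst h
    exact ⟨_, rfl⟩
  by_cases hA : {i | Infinite (𝔹.edge (s i).1.1.hom)}.Infinite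
  -- Infinitely many steps run along edges with infinite groups, which have finitely many cosets.
  · obtain ⟨K, -, hI⟩ := hA.exists_infinite_fiber (g := fun i => (s i).1) hF fun i _ => hK i
    choose! c hc using hex K
    have hfi : (𝔹.edge K.1.hom).FiniteIndex := by
      obtain ⟨i, hi, rfl⟩ := hI.nonempty
      exact hindex _ hi
    have hfq : Finite (𝔸.edge (𝔹.type.map K.1.hom) ⧸ 𝔹.edge K.1.hom) := inferInstance
    obtain ⟨i, hi, j, hj, hij, hcij⟩ := hI.exists_lt_map_eq_of_mapsTo
      (f := fun i => (QuotientGroup.mk (c i)⁻¹ :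
        𝔸.edge (𝔹.type.map K.1.hom) ⧸ 𝔹.edge K.1.hom))
      (Set.mapsTo_univ _ _) Set.finite_univ
    refine Occurs.readable_loop hij (hc i hi.2 ▸ hs i) (hc j hj.2 ▸ hs j) ?_
    have := QuotientGroup.eq.1 hcij.symm
    simpa using this
  -- From some time on the edge groups are finite, and good pairs occur infinitely often.
  · rw [Set.not_infinite] at hA
    obtain ⟨N, hN⟩ := hA.bddAbove
    have hfin (i : ℕ) (hi : N < i) : Finite (𝔹.edge (s i).1.1.hom) := by
      by_contra h
      exact absurd (hN (not_finite_iff_infinite.1 h)) (by omega)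
    have hT (i : ℕ) : (s i).1.1.right = (s (i + 1)).1.1.left := by
      have := hfollows i
      generalize s i = S at this
      generalize s (i + 1) = S' at this
      cases this
      rfl
    have hG : {i | N < i ∧ 𝔹.GoodTotal (s i).1.1 (s (i + 1)).1.1}.Infinite := by
      intro hG
      obtain ⟨M, hM⟩ := hG.bddAbove
      obtain ⟨i, hi, j, hj, hij, h⟩ := (Set.Ioi_infinite (max M N)).exists_lt_map_eq_of_mapsTo
        (f := fun i => (s i).1.1) (Set.mapsTo_univ _ _) Set.finite_univ
      rw [Set.mem_Ioi] at hi
      obtain ⟨k, hik, hk⟩ := exists_goodTotal hcycle (T := fun i => (s i).1.1) hT hij h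
        fun k hk => hfin k (by omega)
      exact absurd (hM ⟨by omega, hk⟩) (by omega)
    obtain ⟨⟨K, T'⟩, -, hI⟩ := hG.exists_infinite_fiber
      (g := fun i => ((s i).1, (s (i + 1)).1.1)) (hF.prod Set.finite_univ)
      fun i _ => ⟨hK i, trivial⟩
    choose! c hc using hex K
    have hfinite : {c : 𝔸.edge (𝔹.type.map K.1.hom) |
        ∃ S', Follows p ⟨K, c⟩ S' ∧ S'.1.1 = T'}.Finite := by
      obtain ⟨i, ⟨hNi, hi⟩, hi'⟩ := hI.nonempty
      simp only [Prod.mk.injEq] at hi'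
      obtain ⟨rfl, rfl⟩ := hi'
      have hf := hfin i hNi
      have hg := hfin (i + 1) (by omega)
      exact h𝔹.finite_follows hFG hi hf hg
    obtain ⟨i, hi, j, hj, hij, hcij⟩ := hI.exists_lt_map_eq_of_mapsTo (f := c)
      (t := {c | ∃ S', Follows p ⟨K, c⟩ S' ∧ S'.1.1 = T'})
      (fun i hi => ⟨s (i + 1), hc i (Prod.mk.inj hi.2).1 ▸ hfollows i, (Prod.mk.inj hi.2).2⟩)
          hfinite
    refine Occurs.readable_loop hij (hc i (Prod.mk.inj hi.2).1 ▸ hs i)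
      (hc j (Prod.mk.inj hj.2).1 ▸ hs j) ?_
    rw [hcij, mul_inv_cancel]
    exact one_mem _

end AGraph

/-! ### Words and descriptions of paths -/

/-- The inverse word. -/
def GWord.inv (w : GWord) : GWord := (w.map fun l => (l.1, !l.2)).reverse

/-- Substitute the words of the list `X` for the generators in a word. -/
def GWord.subst (X : List GWord) (w : GWord) : GWord :=
  w.flatMap fun l => bif l.2 then X.getD l.1 [] else GWord.inv (X.getD l.1 [])

/-- The description of a concatenation of paths. -/
def PathCode.comp (p q : PathCode) : PathCode :=
  match p.2.reverse with
  | [] => (p.1 ++ q.1, q.2)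
  | t :: l => (p.1, l.reverse ++ (t.1, t.2 ++ q.1) :: q.2)

/-- The description of the power of a loop with exponent `m + 1`. -/
def PathCode.powSucc (p : PathCode) (m : ℕ) : PathCode := Nat.rec p (fun _ q => q.comp p) m

/-! ### The algorithm

The program searches for a certificate, which consists of a bound `k` for the running time of the
given programs, an exponent, and traces of readings. -/

/-- The data of the edge with number `e`, with a dummy value if there is no such edge. -/
def GraphData.edge (d : GraphData) (e : ℕ) : EdgeData := d.edges.getD e ⟨0, 0, 0, [], []⟩

/-- The data of the vertex with number `v`, with a dummy value if there is no such vertex. -/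
def GraphData.vert (d : GraphData) (v : ℕ) : VertexData := d.verts.getD v ⟨0, .zero, .zero⟩

/-- The data of the edge with number `f`, with a dummy value if there is no such edge. -/
def AGraphData.edge (d : AGraphData) (f : ℕ) : AEdgeData :=
  d.edges.getD f ⟨0, 0, 0, 0, [], [], false⟩

/-- The data of the vertex with number `u`, with a dummy value if there is no such vertex. -/
def AGraphData.vert (d : AGraphData) (u : ℕ) : AVertexData := d.verts.getD u ⟨0, []⟩

namespace ReadPowerInput

/-- Within the time bound `k`, the membership program gives the answer `b` to the question whether
the word `w` represents an element of the group of the vertex `u`. -/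
def MemAnswer (I : ReadPowerInput) (k : ℕ) (b : Bool) (u : ℕ) (w : GWord) : Prop :=
  Code.evaln k (I.graph.vert (I.agraph.vert u).type).memCode
    (Encodable.encode ((I.agraph.vert u).gens, w)) = some (Encodable.encode b)

/-- Within the time bound `k`, the power membership program denies that a power of the word `w`
represents an element of the group of the vertex `u`. -/
def PowDenied (I : ReadPowerInput) (k : ℕ) (u : ℕ) (w : GWord) : Prop :=
  Code.evaln k (I.graph.vert (I.agraph.vert u).type).powCode
    (Encodable.encode ((I.agraph.vert u).gens, w)) = some (Encodable.encode false)

/-- Within the time bound `k`, the intersection program denies that the edge `f` can carry on a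
reading whose remaining path begins with the word `w`. -/
def EdgeDenied (I : ReadPowerInput) (k : ℕ) (f : ℕ) (w : GWord) : Prop :=
  Code.evaln k I.agraph.interCode
    (Encodable.encode (f, (I.agraph.edge f).alpha ++ w.inv)) = some (Encodable.encode false)

instance (I : ReadPowerInput) (k : ℕ) (b : Bool) (u : ℕ) (w : GWord) :
    Decidable (I.MemAnswer k b u w) := by unfold MemAnswer; infer_instance

/-- A step of a reading: an edge `f` of `𝔹` and a word for an element of the edge group of its type,
and the edge of `𝔸` that is read with the word that follows it. -/
abbrev TraceStep := (ℕ × GWord) × (ℕ × GWord)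

/-- The state of a reading: whether all steps were correct, the vertex of `𝔹` that was reached, the
first word of the remaining path, and the description of the `𝔹`-path up to this vertex. -/
abbrev State := Bool × ℕ × GWord × PathCode

/-- The word for the group element before the edge that is read. -/
def stepWord (I : ReadPowerInput) (s : State) (t : TraceStep) : GWord :=
  s.2.2.1 ++ ((GWord.subst (I.graph.edge t.2.1).alpha t.1.2).inv ++ (I.agraph.edge t.1.1).alpha.inv)

/-- One step of a reading. -/
def step (I : ReadPowerInput) (k : ℕ) (s : State) (t : TraceStep) : State :=
  (s.1 && (decide (t.1.1 < I.agraph.edges.length) && (decide ((I.agraph.edge t.1.1).origin = s.2.1)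
      &&
      (decide ((I.agraph.edge t.1.1).type = t.2.1) &&
      decide (I.MemAnswer k true s.2.1 (I.stepWord s t))))),
    (I.agraph.edge t.1.1).terminus,
    ((I.agraph.edge t.1.1).omega.inv ++ GWord.subst (I.graph.edge t.2.1).omega t.1.2) ++ t.2.2,
    s.2.2.2.comp (I.stepWord s t, [(t.1.1, [])]))

/-- The state after the steps of the list `z`. -/
def run (I : ReadPowerInput) (k : ℕ) (s : State) (z : List TraceStep) : State := z.foldl (I.step k)
    s

/-- The steps `z` lead to the end of the path whose edges are given by `l`. -/
def Completes (I : ReadPowerInput) (k : ℕ) (s : State) (l : List (ℕ × GWord)) (z : List TraceStep) :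
    Prop :=
  (I.run k s z).1 = true ∧ z.map Prod.snd = l

/-- The steps `z` lead to a vertex at which no edge carries on the reading of the path whose edges
are given by `l`. -/
def Halts (I : ReadPowerInput) (k : ℕ) (s : State) (l : List (ℕ × GWord)) (z : List TraceStep) :
    Prop :=
  (I.run k s z).1 = true ∧ z.map Prod.snd = l.take z.length ∧ z.length < l.length ∧
    ∀ f < I.agraph.edges.length, ¬ (I.agraph.edge f).origin = (I.run k s z).2.1 ∨
      ¬ (I.agraph.edge f).type = (l.getD z.length (0, [])).1 ∨ I.EdgeDenied k f (I.run k s z).2.2.1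

/-- The initial state for the reading of the power with exponent `m + 1`. -/
def init (I : ReadPowerInput) (m : ℕ) : State :=
  (true, I.start, (I.loop.powSucc m).1, ([], []))

/-- The steps `z` read the power with exponent `m + 1` along a path that ends at the vertex `u`. -/
def Accepts (I : ReadPowerInput) (k m : ℕ) (z : List TraceStep) (u : ℕ) : Prop :=
  I.Completes k (I.init m) (I.loop.powSucc m).2 z ∧ (I.run k (I.init m) z).2.1 = u ∧
    I.MemAnswer k true (I.run k (I.init m) z).2.1 (I.run k (I.init m) z).2.2.1

/-- The steps `z` show that the power with exponent `m + 1` cannot be read along a path to the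
second given vertex. -/
def Rejects (I : ReadPowerInput) (k m : ℕ) (z : List TraceStep) : Prop :=
  (I.Completes k (I.init m) (I.loop.powSucc m).2 z ∧ (¬ (I.run k (I.init m) z).2.1 = I.finish ∨
    I.MemAnswer k false (I.run k (I.init m) z).2.1 (I.run k (I.init m) z).2.2.1)) ∨
  I.Halts k (I.init m) (I.loop.powSucc m).2 z

/-- The description of the path along which the power with exponent `m + 1` was read. -/
def output (I : ReadPowerInput) (k m : ℕ) (z : List TraceStep) : PathCode :=
  (I.run k (I.init m) z).2.2.2.comp ((I.run k (I.init m) z).2.2.1, [])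

/-- A time bound, an exponent, and the traces of readings of the powers. -/
abbrev Certificate := ℕ × ℕ × List (List TraceStep)

/-- The trace for the exponent `m + 1`. -/
def trace (C : Certificate) (m : ℕ) : List TraceStep := C.2.2.getD m []

open Classical in
/-- The answer that a certificate with exponent `M + 1` proves, if any. The outer `none` means that
    it
proves nothing, and `some none` that no power can be read. The latter is proved if the type of the
first given vertex is not the base of the loop; if all powers up to `M + 1` are rejected, and
`p ^ (M + 1)` is read by a loop at the first given vertex or gets stuck; or if the loop has length
`0` and no power of its group element lies in the vertex group. -/
noncomputable def verdict (I : ReadPowerInput) (C : Certificate) : Option (Option (PathCode × ℕ)) :=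
  if ¬ (I.agraph.vert I.start).type = I.base then some none
  else if (∀ m < C.2.1, I.Rejects C.1 m (trace C m)) ∧ I.Accepts C.1 C.2.1 (trace C C.2.1) I.finish
      then
    some (some (I.output C.1 C.2.1 (trace C C.2.1), C.2.1 + 1))
  else if (∀ m < C.2.1 + 1, I.Rejects C.1 m (trace C m)) ∧
      (I.Accepts C.1 C.2.1 (trace C C.2.1) I.start ∨
        I.Halts C.1 (I.init C.2.1) (I.loop.powSucc C.2.1).2 (trace C C.2.1)) then
    some none
  else if I.loop.2 = [] ∧ I.PowDenied C.1 I.start I.loop.1 then some none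
  else none

/-- Search for a certificate. -/
noncomputable def readPower (I : ReadPowerInput) : Part (Option (PathCode × ℕ)) :=
  Nat.rfindOpt fun n => (Encodable.decode (α := Certificate) n).bind I.verdict

end ReadPowerInput

/-! ### The algorithm is computable -/

section Primrec

variable {α : Type*} [Primcodable α]

/-- The fields of the structure as a tuple; the encoding of the structure is transported along
this equivalence. -/
def VertexData.equivProd : VertexData ≃
    ℕ × Code × Code :=
  ⟨fun d => (d.numGens, d.memCode, d.powCode),
    fun t => ⟨t.1, t.2.1, t.2.2⟩, fun _ => rfl, fun _ => rfl⟩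

theorem VertexData.primrec_equivProd : Primrec VertexData.equivProd :=
  Primrec.of_equiv (e := VertexData.equivProd)

theorem VertexData.primrec_memCode : Primrec VertexData.memCode :=
  (Primrec.fst.comp (Primrec.snd.comp VertexData.primrec_equivProd) :)

theorem VertexData.primrec_powCode : Primrec VertexData.powCode :=
  (Primrec.snd.comp (Primrec.snd.comp VertexData.primrec_equivProd) :)

/-- The fields of the structure as a tuple; the encoding of the structure is transported along
this equivalence. -/
def EdgeData.equivProd : EdgeData ≃
    ℕ × ℕ × ℕ × List GWord × List GWord :=
  ⟨fun d => (d.origin, d.terminus, d.inverse, d.alpha, d.omega),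
    fun t => ⟨t.1, t.2.1, t.2.2.1, t.2.2.2.1, t.2.2.2.2⟩, fun _ => rfl, fun _ => rfl⟩

theorem EdgeData.primrec_equivProd : Primrec EdgeData.equivProd :=
  Primrec.of_equiv (e := EdgeData.equivProd)

theorem EdgeData.primrec_alpha : Primrec EdgeData.alpha :=
  (Primrec.fst.comp (Primrec.snd.comp (Primrec.snd.comp (Primrec.snd.comp
      EdgeData.primrec_equivProd))) :)

theorem EdgeData.primrec_omega : Primrec EdgeData.omega :=
  (Primrec.snd.comp (Primrec.snd.comp (Primrec.snd.comp (Primrec.snd.comp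
      EdgeData.primrec_equivProd))) :)

/-- The fields of the structure as a tuple; the encoding of the structure is transported along
this equivalence. -/
def GraphData.equivProd : GraphData ≃
    List VertexData × List EdgeData :=
  ⟨fun d => (d.verts, d.edges),
    fun t => ⟨t.1, t.2⟩, fun _ => rfl, fun _ => rfl⟩

theorem GraphData.primrec_equivProd : Primrec GraphData.equivProd :=
  Primrec.of_equiv (e := GraphData.equivProd)

theorem GraphData.primrec_verts : Primrec GraphData.verts :=
  (Primrec.fst.comp GraphData.primrec_equivProd :)

theorem GraphData.primrec_edges : Primrec GraphData.edges :=
  (Primrec.snd.comp GraphData.primrec_equivProd :)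

/-- The fields of the structure as a tuple; the encoding of the structure is transported along
this equivalence. -/
def AVertexData.equivProd : AVertexData ≃
    ℕ × List GWord :=
  ⟨fun d => (d.type, d.gens),
    fun t => ⟨t.1, t.2⟩, fun _ => rfl, fun _ => rfl⟩

theorem AVertexData.primrec_equivProd : Primrec AVertexData.equivProd :=
  Primrec.of_equiv (e := AVertexData.equivProd)

theorem AVertexData.primrec_type : Primrec AVertexData.type :=
  (Primrec.fst.comp AVertexData.primrec_equivProd :)

theorem AVertexData.primrec_gens : Primrec AVertexData.gens :=
  (Primrec.snd.comp AVertexData.primrec_equivProd :)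

/-- The fields of the structure as a tuple; the encoding of the structure is transported along
this equivalence. -/
def AEdgeData.equivProd : AEdgeData ≃
    ℕ × ℕ × ℕ × ℕ × GWord × GWord × Bool :=
  ⟨fun d => (d.origin, d.terminus, d.inverse, d.type, d.alpha, d.omega, d.infinite),
    fun t => ⟨t.1, t.2.1, t.2.2.1, t.2.2.2.1, t.2.2.2.2.1, t.2.2.2.2.2.1, t.2.2.2.2.2.2⟩, fun _ =>
        rfl, fun _ => rfl⟩

theorem AEdgeData.primrec_equivProd : Primrec AEdgeData.equivProd :=
  Primrec.of_equiv (e := AEdgeData.equivProd)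

theorem AEdgeData.primrec_origin : Primrec AEdgeData.origin :=
  (Primrec.fst.comp AEdgeData.primrec_equivProd :)

theorem AEdgeData.primrec_terminus : Primrec AEdgeData.terminus :=
  (Primrec.fst.comp (Primrec.snd.comp AEdgeData.primrec_equivProd) :)

theorem AEdgeData.primrec_type : Primrec AEdgeData.type :=
  (Primrec.fst.comp (Primrec.snd.comp (Primrec.snd.comp (Primrec.snd.comp
      AEdgeData.primrec_equivProd))) :)

theorem AEdgeData.primrec_alpha : Primrec AEdgeData.alpha :=
  (Primrec.fst.comp (Primrec.snd.comp (Primrec.snd.comp (Primrec.snd.comp (Primrec.snd.comp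
      AEdgeData.primrec_equivProd)))) :)

theorem AEdgeData.primrec_omega : Primrec AEdgeData.omega :=
  (Primrec.fst.comp (Primrec.snd.comp (Primrec.snd.comp (Primrec.snd.comp (Primrec.snd.comp
      (Primrec.snd.comp AEdgeData.primrec_equivProd))))) :)

/-- The fields of the structure as a tuple; the encoding of the structure is transported along
this equivalence. -/
def AGraphData.equivProd : AGraphData ≃
    List AVertexData × List AEdgeData × Code :=
  ⟨fun d => (d.verts, d.edges, d.interCode),
    fun t => ⟨t.1, t.2.1, t.2.2⟩, fun _ => rfl, fun _ => rfl⟩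

theorem AGraphData.primrec_equivProd : Primrec AGraphData.equivProd :=
  Primrec.of_equiv (e := AGraphData.equivProd)

theorem AGraphData.primrec_verts : Primrec AGraphData.verts :=
  (Primrec.fst.comp AGraphData.primrec_equivProd :)

theorem AGraphData.primrec_edges : Primrec AGraphData.edges :=
  (Primrec.fst.comp (Primrec.snd.comp AGraphData.primrec_equivProd) :)

theorem AGraphData.primrec_interCode : Primrec AGraphData.interCode :=
  (Primrec.snd.comp (Primrec.snd.comp AGraphData.primrec_equivProd) :)

/-- The fields of the structure as a tuple; the encoding of the structure is transported along
this equivalence. -/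
def ReadPowerInput.equivProd : ReadPowerInput ≃
    GraphData × AGraphData × ℕ × PathCode × ℕ × ℕ :=
  ⟨fun d => (d.graph, d.agraph, d.base, d.loop, d.start, d.finish),
    fun t => ⟨t.1, t.2.1, t.2.2.1, t.2.2.2.1, t.2.2.2.2.1, t.2.2.2.2.2⟩, fun _ => rfl, fun _ => rfl⟩

theorem ReadPowerInput.primrec_equivProd : Primrec ReadPowerInput.equivProd :=
  Primrec.of_equiv (e := ReadPowerInput.equivProd)

theorem ReadPowerInput.primrec_graph : Primrec ReadPowerInput.graph :=
  (Primrec.fst.comp ReadPowerInput.primrec_equivProd :)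

theorem ReadPowerInput.primrec_agraph : Primrec ReadPowerInput.agraph :=
  (Primrec.fst.comp (Primrec.snd.comp ReadPowerInput.primrec_equivProd) :)

theorem ReadPowerInput.primrec_base : Primrec ReadPowerInput.base :=
  (Primrec.fst.comp (Primrec.snd.comp (Primrec.snd.comp ReadPowerInput.primrec_equivProd)) :)

theorem ReadPowerInput.primrec_loop : Primrec ReadPowerInput.loop :=
  (Primrec.fst.comp (Primrec.snd.comp (Primrec.snd.comp (Primrec.snd.comp
      ReadPowerInput.primrec_equivProd))) :)

theorem ReadPowerInput.primrec_start : Primrec ReadPowerInput.start :=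
  (Primrec.fst.comp (Primrec.snd.comp (Primrec.snd.comp (Primrec.snd.comp (Primrec.snd.comp
      ReadPowerInput.primrec_equivProd)))) :)

theorem ReadPowerInput.primrec_finish : Primrec ReadPowerInput.finish :=
  (Primrec.snd.comp (Primrec.snd.comp (Primrec.snd.comp (Primrec.snd.comp (Primrec.snd.comp
      ReadPowerInput.primrec_equivProd)))) :)

theorem PrimrecRel.forall_lt_of {R : ℕ → α → Prop} (hR : PrimrecRel R) :
    PrimrecRel fun n a => ∀ x < n, R x a :=
  (hR.forall_mem_list.comp (Primrec.list_range.comp Primrec.fst) Primrec.snd).of_eq (by simp)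

theorem GWord.primrec_inv : Primrec GWord.inv :=
  Primrec.list_reverse.comp (Primrec.list_map Primrec.id
    ((Primrec.fst.comp Primrec.snd).pair (Primrec.not.comp (Primrec.snd.comp Primrec.snd))).to₂)

theorem GWord.primrec_subst : Primrec₂ GWord.subst := by
  have h : Primrec fun x : (List GWord × GWord) × (ℕ × Bool) => x.1.1.getD x.2.1 [] :=
    (Primrec.list_getD []).comp (Primrec.fst.comp Primrec.fst) (Primrec.fst.comp Primrec.snd)
  exact Primrec.list_flatMap Primrec.snd
    (Primrec.cond (Primrec.snd.comp Primrec.snd) h (GWord.primrec_inv.comp h)).to₂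

theorem PathCode.primrec_comp : Primrec₂ PathCode.comp := by
  have h : Primrec fun x : PathCode × PathCode =>
      @List.casesOn (ℕ × GWord) (fun _ => PathCode) x.1.2.reverse (x.1.1 ++ x.2.1, x.2.2)
        fun t l => (x.1.1, l.reverse ++ (t.1, t.2 ++ x.2.1) :: x.2.2) := by
    have h₀ : Primrec fun x : PathCode × PathCode => (x.1.1 ++ x.2.1, x.2.2) :=
      (Primrec.list_append.comp (Primrec.fst.comp Primrec.fst)
        (Primrec.fst.comp Primrec.snd)).pair (Primrec.snd.comp Primrec.snd)
    have hx : Primrec fun y : (PathCode × PathCode) × ((ℕ × GWord) × List (ℕ × GWord)) => y.1 :=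
      Primrec.fst
    have ht : Primrec fun y : (PathCode × PathCode) × ((ℕ × GWord) × List (ℕ × GWord)) => y.2.1 :=
      Primrec.fst.comp Primrec.snd
    have hl : Primrec fun y : (PathCode × PathCode) × ((ℕ × GWord) × List (ℕ × GWord)) =>
        y.2.2.reverse := Primrec.list_reverse.comp (Primrec.snd.comp Primrec.snd)
    have h₁ : Primrec fun y : (PathCode × PathCode) × ((ℕ × GWord) × List (ℕ × GWord)) =>
        (y.2.1.1, y.2.1.2 ++ y.1.2.1) :=
      (Primrec.fst.comp ht).pair (Primrec.list_append.comp (Primrec.snd.comp ht)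
        (Primrec.fst.comp (Primrec.snd.comp hx)))
    have h₂ : Primrec fun y : (PathCode × PathCode) × ((ℕ × GWord) × List (ℕ × GWord)) =>
        (y.1.1.1, y.2.2.reverse ++ (y.2.1.1, y.2.1.2 ++ y.1.2.1) :: y.1.2.2) :=
      (Primrec.fst.comp (Primrec.fst.comp hx)).pair (Primrec.list_append.comp hl
        (Primrec.list_cons.comp h₁ (Primrec.snd.comp (Primrec.snd.comp hx))))
    exact Primrec.list_casesOn (Primrec.list_reverse.comp (Primrec.snd.comp Primrec.fst)) h₀
      h₂.to₂
  refine h.of_eq fun x => ?_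
  rw [PathCode.comp]
  cases x.1.2.reverse <;> rfl

theorem PathCode.primrec_powSucc : Primrec₂ PathCode.powSucc := by
  refine (Primrec.nat_rec' (f := fun x : PathCode × ℕ => x.2) (g := fun x => x.1)
    (h := fun x y => y.2.comp x.1) Primrec.snd Primrec.fst ?_)
  exact PathCode.primrec_comp.comp (Primrec.snd.comp Primrec.snd) (Primrec.fst.comp Primrec.fst)

theorem GraphData.primrec_edge : Primrec₂ GraphData.edge :=
  (Primrec.list_getD _).comp (GraphData.primrec_edges.comp Primrec.fst) Primrec.snd

theorem GraphData.primrec_vert : Primrec₂ GraphData.vert :=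
  (Primrec.list_getD _).comp (GraphData.primrec_verts.comp Primrec.fst) Primrec.snd

theorem AGraphData.primrec_edge : Primrec₂ AGraphData.edge :=
  (Primrec.list_getD _).comp (AGraphData.primrec_edges.comp Primrec.fst) Primrec.snd

theorem AGraphData.primrec_vert : Primrec₂ AGraphData.vert :=
  (Primrec.list_getD _).comp (AGraphData.primrec_verts.comp Primrec.fst) Primrec.snd

namespace ReadPowerInput

theorem primrecPred_evaln {k : α → ℕ} {c : α → Code} {n : α → ℕ} {b : α → Bool} (hk : Primrec k)
    (hc : Primrec c) (hn : Primrec n) (hb : Primrec b) :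
    PrimrecPred fun a => Code.evaln (k a) (c a) (n a) = some (Encodable.encode (b a)) :=
  Primrec.eq.comp (Code.primrec_evaln.comp ((hk.pair hc).pair hn))
    (Primrec.option_some.comp (Primrec.encode.comp hb))

variable {I : α → ReadPowerInput} {k u m f : α → ℕ} {w : α → GWord} {s : α → State}
  {z : α → List TraceStep}

theorem primrec_edge (hI : Primrec I) (hf : Primrec f) : Primrec fun a => (I a).agraph.edge (f a) :=
  AGraphData.primrec_edge.comp (primrec_agraph.comp hI) hf

theorem primrec_vert (hI : Primrec I) (hu : Primrec u) : Primrec fun a => (I a).agraph.vert (u a) :=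
  AGraphData.primrec_vert.comp (primrec_agraph.comp hI) hu

theorem primrec_type_vert (hI : Primrec I) (hu : Primrec u) :
    Primrec fun a => (I a).graph.vert ((I a).agraph.vert (u a)).type :=
  GraphData.primrec_vert.comp (primrec_graph.comp hI)
    (AVertexData.primrec_type.comp (primrec_vert hI hu))

theorem primrecPred_memAnswer (hI : Primrec I) (hk : Primrec k) {b : α → Bool} (hb : Primrec b)
    (hu : Primrec u) (hw : Primrec w) :
    PrimrecPred fun a => (I a).MemAnswer (k a) (b a) (u a) (w a) :=
  primrecPred_evaln hk (VertexData.primrec_memCode.comp (primrec_type_vert hI hu))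
    (Primrec.encode.comp ((AVertexData.primrec_gens.comp (primrec_vert hI hu)).pair hw)) hb

theorem primrecPred_powDenied (hI : Primrec I) (hk : Primrec k) (hu : Primrec u)
    (hw : Primrec w) : PrimrecPred fun a => (I a).PowDenied (k a) (u a) (w a) :=
  primrecPred_evaln hk (VertexData.primrec_powCode.comp (primrec_type_vert hI hu))
    (Primrec.encode.comp ((AVertexData.primrec_gens.comp (primrec_vert hI hu)).pair hw))
    (Primrec.const false)

theorem primrecPred_edgeDenied (hI : Primrec I) (hk : Primrec k) (hf : Primrec f)
    (hw : Primrec w) : PrimrecPred fun a => (I a).EdgeDenied (k a) (f a) (w a) :=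
  primrecPred_evaln hk (AGraphData.primrec_interCode.comp (primrec_agraph.comp hI))
    (Primrec.encode.comp (hf.pair (Primrec.list_append.comp
      (AEdgeData.primrec_alpha.comp (primrec_edge hI hf)) (GWord.primrec_inv.comp hw))))
    (Primrec.const false)

theorem primrec_stepWord (hI : Primrec I) (hs : Primrec s) {t : α → TraceStep} (ht : Primrec t) :
    Primrec fun a => (I a).stepWord (s a) (t a) := by
  have hf := Primrec.fst.comp (Primrec.fst.comp ht)
  have hc := Primrec.snd.comp (Primrec.fst.comp ht)
  have he := GraphData.primrec_edge.comp (primrec_graph.comp hI)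
    (Primrec.fst.comp (Primrec.snd.comp ht))
  exact Primrec.list_append.comp (Primrec.fst.comp (Primrec.snd.comp (Primrec.snd.comp hs)))
    (Primrec.list_append.comp
      (GWord.primrec_inv.comp (GWord.primrec_subst.comp (EdgeData.primrec_alpha.comp he) hc))
      (GWord.primrec_inv.comp (AEdgeData.primrec_alpha.comp (primrec_edge hI hf))))

theorem primrec_step (hI : Primrec I) (hk : Primrec k) (hs : Primrec s) {t : α → TraceStep}
    (ht : Primrec t) : Primrec fun a => (I a).step (k a) (s a) (t a) := by
  have hf := Primrec.fst.comp (Primrec.fst.comp ht)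
  have hc := Primrec.snd.comp (Primrec.fst.comp ht)
  have he := Primrec.fst.comp (Primrec.snd.comp ht)
  have hfd := primrec_edge hI hf
  have hed := GraphData.primrec_edge.comp (primrec_graph.comp hI) he
  have hu := Primrec.fst.comp (Primrec.snd.comp hs)
  have hw := primrec_stepWord hI hs ht
  refine Primrec.pair (Primrec.and.comp (Primrec.fst.comp hs) (Primrec.and.comp
    (PrimrecPred.decide ?_) (Primrec.and.comp (PrimrecPred.decide ?_)
      (Primrec.and.comp (PrimrecPred.decide ?_) (PrimrecPred.decide ?_)))))
    (Primrec.pair (AEdgeData.primrec_terminus.comp hfd) (Primrec.pair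
      (Primrec.list_append.comp (Primrec.list_append.comp
        (GWord.primrec_inv.comp (AEdgeData.primrec_omega.comp hfd))
        (GWord.primrec_subst.comp (EdgeData.primrec_omega.comp hed) hc))
        (Primrec.snd.comp (Primrec.snd.comp ht)))
      (PathCode.primrec_comp.comp (Primrec.snd.comp (Primrec.snd.comp (Primrec.snd.comp hs)))
        (hw.pair (Primrec.list_cons.comp (hf.pair (Primrec.const [])) (Primrec.const []))))))
  · exact Primrec.nat_lt.comp hf
      (Primrec.list_length.comp (AGraphData.primrec_edges.comp (primrec_agraph.comp hI)))
  · exact Primrec.eq.comp (AEdgeData.primrec_origin.comp hfd) hu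
  · exact Primrec.eq.comp (AEdgeData.primrec_type.comp hfd) he
  · exact primrecPred_memAnswer hI hk (Primrec.const true) hu hw

theorem primrec_run (hI : Primrec I) (hk : Primrec k) (hs : Primrec s) (hz : Primrec z) :
    Primrec fun a => (I a).run (k a) (s a) (z a) :=
  Primrec.list_foldl hz hs (h := fun a x => (I a).step (k a) x.1 x.2)
    (primrec_step (hI.comp Primrec.fst) (hk.comp Primrec.fst) (Primrec.fst.comp Primrec.snd)
      (Primrec.snd.comp Primrec.snd))

variable {l : α → List (ℕ × GWord)}

theorem primrecPred_completes (hI : Primrec I) (hk : Primrec k) (hs : Primrec s) (hl : Primrec l)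
    (hz : Primrec z) : PrimrecPred fun a => (I a).Completes (k a) (s a) (l a) (z a) :=
  (Primrec.eq.comp (Primrec.fst.comp (primrec_run hI hk hs hz)) (Primrec.const true)).and
    (Primrec.eq.comp (Primrec.list_map hz (Primrec.snd.comp Primrec.snd).to₂) hl)

theorem primrecPred_halts (hI : Primrec I) (hk : Primrec k) (hs : Primrec s) (hl : Primrec l)
    (hz : Primrec z) : PrimrecPred fun a => (I a).Halts (k a) (s a) (l a) (z a) := by
  have hrun := primrec_run hI hk hs hz
  have hlen := Primrec.list_length.comp hz
  have hall : PrimrecRel fun (f : ℕ) (a : α) => ¬ ((I a).agraph.edge f).origin =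
      ((I a).run (k a) (s a) (z a)).2.1 ∨
      ¬ ((I a).agraph.edge f).type = ((l a).getD (z a).length (0, [])).1 ∨
      (I a).EdgeDenied (k a) f ((I a).run (k a) (s a) (z a)).2.2.1 := by
    have hf : Primrec fun x : ℕ × α => x.1 := Primrec.fst
    have hI' := hI.comp (Primrec.snd (α := ℕ) (β := α))
    have hk' := hk.comp (Primrec.snd (α := ℕ) (β := α))
    have hrun' := hrun.comp (Primrec.snd (α := ℕ) (β := α))
    have hl' := ((Primrec.list_getD (0, [])).comp hl hlen).comp (Primrec.snd (α := ℕ) (β := α))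
    exact (Primrec.eq.comp (AEdgeData.primrec_origin.comp (primrec_edge hI' hf))
      (Primrec.fst.comp (Primrec.snd.comp hrun'))).not.or
      ((Primrec.eq.comp (AEdgeData.primrec_type.comp (primrec_edge hI' hf))
        (Primrec.fst.comp hl')).not.or
      (primrecPred_edgeDenied hI' hk' hf
        (Primrec.fst.comp (Primrec.snd.comp (Primrec.snd.comp hrun')))))
  have hall' := hall.forall_lt_of
  exact (Primrec.eq.comp (Primrec.fst.comp hrun) (Primrec.const true)).and
    ((Primrec.eq.comp (Primrec.list_map hz (Primrec.snd.comp Primrec.snd).to₂)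
      (Primrec.list_take.comp hlen hl)).and
    ((Primrec.nat_lt.comp hlen (Primrec.list_length.comp hl)).and
    (hall'.comp (Primrec.list_length.comp
      (AGraphData.primrec_edges.comp (primrec_agraph.comp hI))) Primrec.id)))

theorem primrec_powSucc (hI : Primrec I) (hm : Primrec m) :
    Primrec fun a => (I a).loop.powSucc (m a) :=
  PathCode.primrec_powSucc.comp (primrec_loop.comp hI) hm

theorem primrec_init (hI : Primrec I) (hm : Primrec m) : Primrec fun a => (I a).init (m a) :=
  (Primrec.const true).pair ((primrec_start.comp hI).pair
    ((Primrec.fst.comp (primrec_powSucc hI hm)).pair (Primrec.const ([], []))))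

theorem primrecPred_accepts (hI : Primrec I) (hk : Primrec k) (hm : Primrec m) (hz : Primrec z)
    (hu : Primrec u) : PrimrecPred fun a => (I a).Accepts (k a) (m a) (z a) (u a) := by
  have hrun := primrec_run hI hk (primrec_init hI hm) hz
  have hv := Primrec.fst.comp (Primrec.snd.comp hrun)
  exact (primrecPred_completes hI hk (primrec_init hI hm)
    (Primrec.snd.comp (primrec_powSucc hI hm)) hz).and
    ((Primrec.eq.comp hv hu).and (primrecPred_memAnswer hI hk (Primrec.const true) hv
      (Primrec.fst.comp (Primrec.snd.comp (Primrec.snd.comp hrun)))))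

theorem primrecPred_rejects (hI : Primrec I) (hk : Primrec k) (hm : Primrec m) (hz : Primrec z) :
    PrimrecPred fun a => (I a).Rejects (k a) (m a) (z a) := by
  have hrun := primrec_run hI hk (primrec_init hI hm) hz
  have hv := Primrec.fst.comp (Primrec.snd.comp hrun)
  have hl := Primrec.snd.comp (primrec_powSucc hI hm)
  exact ((primrecPred_completes hI hk (primrec_init hI hm) hl hz).and
    ((Primrec.eq.comp hv (primrec_finish.comp hI)).not.or
    (primrecPred_memAnswer hI hk (Primrec.const false) hv
      (Primrec.fst.comp (Primrec.snd.comp (Primrec.snd.comp hrun)))))).or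
    (primrecPred_halts hI hk (primrec_init hI hm) hl hz)

theorem primrec_output (hI : Primrec I) (hk : Primrec k) (hm : Primrec m) (hz : Primrec z) :
    Primrec fun a => (I a).output (k a) (m a) (z a) := by
  have hrun := Primrec.snd.comp (Primrec.snd.comp (primrec_run hI hk (primrec_init hI hm) hz))
  exact PathCode.primrec_comp.comp (Primrec.snd.comp hrun)
    ((Primrec.fst.comp hrun).pair (Primrec.const []))

open Classical in
theorem primrec_verdict : Primrec₂ verdict := by
  have hI : Primrec fun x : ReadPowerInput × Certificate => x.1 := Primrec.fst
  have hk : Primrec fun x : ReadPowerInput × Certificate => x.2.1 := Primrec.fst.comp Primrec.snd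
  have hm : Primrec fun x : ReadPowerInput × Certificate => x.2.2.1 :=
    Primrec.fst.comp (Primrec.snd.comp Primrec.snd)
  have hZ : Primrec fun x : ReadPowerInput × Certificate => x.2.2.2 :=
    Primrec.snd.comp (Primrec.snd.comp Primrec.snd)
  have hz : Primrec fun x : ReadPowerInput × Certificate => trace x.2 x.2.2.1 :=
    (Primrec.list_getD []).comp hZ hm
  have hrej : PrimrecRel fun (m : ℕ) (x : ReadPowerInput × Certificate) =>
      x.1.Rejects x.2.1 m (trace x.2 m) :=
    primrecPred_rejects (hI.comp Primrec.snd) (hk.comp Primrec.snd) Primrec.fst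
      ((Primrec.list_getD []).comp (hZ.comp Primrec.snd) Primrec.fst)
  have hrej' := hrej.forall_lt_of
  exact Primrec.ite (Primrec.eq.comp (AVertexData.primrec_type.comp
      (primrec_vert hI (primrec_start.comp hI))) (primrec_base.comp hI)).not (Primrec.const _)
    (Primrec.ite ((hrej'.comp hm Primrec.id).and
      (primrecPred_accepts hI hk hm hz (primrec_finish.comp hI)))
      (Primrec.option_some.comp (Primrec.option_some.comp
        ((primrec_output hI hk hm hz).pair (Primrec.succ.comp hm))))
    (Primrec.ite ((hrej'.comp (Primrec.succ.comp hm) Primrec.id).and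
      ((primrecPred_accepts hI hk hm hz (primrec_start.comp hI)).or
        (primrecPred_halts hI hk (primrec_init hI hm)
          (Primrec.snd.comp (primrec_powSucc hI hm)) hz)))
      (Primrec.const _)
    (Primrec.ite ((Primrec.eq.comp (Primrec.snd.comp (primrec_loop.comp hI)) (Primrec.const [])).and
      (primrecPred_powDenied hI hk (primrec_start.comp hI)
        (Primrec.fst.comp (primrec_loop.comp hI)))) (Primrec.const _) (Primrec.const _))))

theorem partrec_readPower : Partrec readPower :=
  Partrec.rfindOpt (Primrec.option_bind (Primrec.decode.comp Primrec.snd)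
    (primrec_verdict.comp (Primrec.fst.comp Primrec.fst) Primrec.snd).to₂).to_comp

end ReadPowerInput

end Primrec

/-! ### Values of words and described paths -/

namespace GWord

variable {G : Type*} [Group G]

@[simp] theorem eval_nil (gens : List G) : eval gens [] = 1 := rfl

@[simp] theorem eval_append (gens : List G) (w w' : GWord) :
    eval gens (w ++ w') = eval gens w * eval gens w' := by
  simp [eval]

theorem eval_cons (gens : List G) (i : ℕ) (b : Bool) (w : GWord) :
    eval gens ((i, b) :: w) =
      (if b then gens.getD i 1 else (gens.getD i 1)⁻¹) * eval gens w := by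
  simp [eval]

@[simp] theorem eval_inv (gens : List G) (w : GWord) : eval gens w.inv = (eval gens w)⁻¹ := by
  induction w with
  | nil => simp [inv]
  | cons l w ih =>
    obtain ⟨i, b⟩ := l
    have h : inv ((i, b) :: w) = inv w ++ [(i, !b)] := by simp [inv]
    rw [h, eval_append, ih, eval_cons, eval_cons, mul_inv_rev]
    cases b <;> simp

theorem eval_subst {H : Type*} [Group H] {gens : List G} {X : List GWord} {gens' : List H}
    {φ : H →* G} (h : X.map (eval gens) = gens'.map φ) (w : GWord) :
    eval gens (subst X w) = φ (eval gens' w) := by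
  have hX (i : ℕ) : eval gens (X.getD i []) = φ (gens'.getD i 1) := by
    calc eval gens (X.getD i []) = (X.map (eval gens)).getD i (eval gens []) :=
          (List.getD_map _ _ (eval gens)).symm
      _ = (gens'.map φ).getD i (φ 1) := by rw [h, eval_nil, map_one]
      _ = φ (gens'.getD i 1) := List.getD_map _ _ φ
  induction w with
  | nil => simp [subst]
  | cons l w ih =>
    obtain ⟨i, b⟩ := l
    have hs : subst X ((i, b) :: w) =
        (bif b then X.getD i [] else inv (X.getD i [])) ++ subst X w := by simp [subst]
    rw [hs, eval_append, ih, eval_cons, map_mul]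
    cases b
    · simp only [cond_false, eval_inv, hX, Bool.false_eq_true, if_false, map_inv]
    · simp only [cond_true, hX, if_true]

theorem exists_eval_eq {gens : List G} (h : Subgroup.closure {g | g ∈ gens} = ⊤) (g : G) :
    ∃ w, eval gens w = g := by
  have hg : g ∈ Subgroup.closure {g | g ∈ gens} := h ▸ Subgroup.mem_top g
  induction hg using Subgroup.closure_induction with
  | mem g hg =>
    obtain ⟨i, hi, rfl⟩ := List.mem_iff_getElem.1 hg
    exact ⟨[(i, true)], by simp [eval_cons, hi]⟩
  | one => exact ⟨[], rfl⟩
  | mul g g' _ _ ih ih' =>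
    obtain ⟨w, rfl⟩ := ih
    obtain ⟨w', rfl⟩ := ih'
    exact ⟨w ++ w', eval_append _ _ _⟩
  | inv g _ ih =>
    obtain ⟨w, rfl⟩ := ih
    exact ⟨w.inv, eval_inv _ _⟩

theorem span_fg (gens : List G) (X : List GWord) : (span gens X).FG := by
  refine (Subgroup.fg_iff _).2 ⟨_, rfl, ?_⟩
  exact (X.finite_toSet.image (eval gens)).subset fun g ⟨w, hw, h⟩ => ⟨w, hw, h⟩

end GWord

namespace PathCode

theorem comp_cons_left (w w' : GWord) (e : ℕ) (l : List (ℕ × GWord)) (q : PathCode) :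
    comp (w, (e, w') :: l) q = (w, (e, (comp (w', l) q).1) :: (comp (w', l) q).2) := by
  unfold comp
  simp only [List.reverse_cons]
  cases h : l.reverse with
  | nil =>
    rw [List.reverse_eq_nil_iff] at h
    simp
  | cons t l' => simp

end PathCode

namespace GraphOfGroups.Path

variable {V : Type u₁} [Quiver.{v₁} V] [HasInvolutiveReverse V]
  {𝔸 : GraphOfGroups.{u₁, u₃, u₄, v₁} V} {r : ∀ v : V, 𝔸.vert v → GWord → Prop}
  {num : Quiver.Total V → ℕ}

theorem DescribedBy.mulLeft (hr : ∀ v a b s t, r v a s → r v b t → r v (a * b) (s ++ t)) {v w : V}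
    {a : 𝔸.vert v} {s : GWord} (ha : r v a s) {p : 𝔸.Path v w} {c : PathCode}
    (hp : p.DescribedBy r num c) : (p.mulLeft a).DescribedBy r num (s ++ c.1, c.2) := by
  cases p with
  | nil b => exact ⟨hr _ _ _ _ _ ha hp.1, hp.2⟩
  | cons b e p => exact ⟨hr _ _ _ _ _ ha hp.1, hp.2⟩

theorem DescribedBy.comp (hr : ∀ v a b s t, r v a s → r v b t → r v (a * b) (s ++ t)) {v w x : V}
    {p : 𝔸.Path v w} {q : 𝔸.Path w x} {c c' : PathCode} (hp : p.DescribedBy r num c)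
    (hq : q.DescribedBy r num c') : (p.comp q).DescribedBy r num (c.comp c') := by
  induction p generalizing c with
  | nil a =>
    obtain ⟨s, l⟩ := c
    obtain ⟨ha, rfl⟩ : _ ∧ l = [] := hp
    exact hq.mulLeft hr ha
  | cons a e p ih =>
    obtain ⟨s, l⟩ := c
    obtain ⟨ha, c, rfl, hc⟩ : _ ∧ ∃ c : PathCode, l = _ ∧ _ := hp
    rw [PathCode.comp_cons_left]
    exact ⟨ha, _, rfl, ih hc hq⟩

theorem DescribedBy.powSucc (hr : ∀ v a b s t, r v a s → r v b t → r v (a * b) (s ++ t)) {v : V}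
    {p : 𝔸.Path v v} {c : PathCode} (hp : p.DescribedBy r num c) (m : ℕ) :
    (p.pow (m + 1)).DescribedBy r num (c.powSucc m) := by
  induction m with
  | zero => exact hp
  | succ m ih => exact ih.comp hr hp

theorem exists_eq_nil {v : V} {p : 𝔸.Path v v} (h : p.length = 0) : ∃ a, p = nil a := by
  cases p with
  | nil a => exact ⟨a, rfl⟩
  | cons => exact absurd h (Nat.succ_ne_zero _)

end GraphOfGroups.Path

namespace Nat.Partrec.Code

theorem Answers.of_evaln {α : Type*} [Primcodable α] {c : Code} {a : α} {p : Prop}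
    (h : c.Answers a p) {k : ℕ} {b : Bool}
    (hk : evaln k c (Encodable.encode a) = some (Encodable.encode b)) : b = true ↔ p := by
  obtain ⟨b', hb', h⟩ := h
  have := Part.mem_unique (evaln_sound hk) hb'
  rwa [Encodable.encode_injective this]

theorem Answers.eventually {α : Type*} [Primcodable α] {c : Code} {a : α} {p : Prop}
    (h : c.Answers a p) {b : Bool} (hb : b = true ↔ p) : ∀ᶠ k in Filter.atTop,
    evaln k c (Encodable.encode a) = some (Encodable.encode b) := by
  obtain ⟨b', hb', h⟩ := h
  obtain rfl : b = b' := by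
    rw [Bool.eq_iff_iff]
    exact hb.trans h.symm
  obtain ⟨K, hK⟩ := evaln_complete.1 hb'
  exact Filter.eventually_atTop.2 ⟨K, fun k hk => evaln_mono hk hK⟩

end Nat.Partrec.Code

/-! ### Correctness of the readings of the program -/

namespace ReadPowerInput

open GraphOfGroups GraphOfGroups.Path AGraph

variable {V : Type u₁} [Quiver.{v₁} V] [HasInvolutiveReverse V]
  {𝔸 : GraphOfGroups.{u₁, u₃, u₄, v₁} V} {U : Type u₂} [Quiver.{v₂} U] [HasInvolutiveReverse U]
  {𝔹 : AGraph 𝔸 U} {I : ReadPowerInput} {P : 𝔸.Presentation I.graph}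
  {Q : 𝔹.Presentation P I.agraph}

theorem agraph_vert (Q : 𝔹.Presentation P I.agraph) (u : U) :
    I.agraph.vert (Q.vNum u) = I.agraph.verts.get (Q.vNum u) := by
  simp [AGraphData.vert]

theorem agraph_edge (Q : 𝔹.Presentation P I.agraph) (T : Quiver.Total U) :
    I.agraph.edge (Q.eNum T) = I.agraph.edges.get (Q.eNum T) := by
  simp [AGraphData.edge]

theorem graph_vert (P : 𝔸.Presentation I.graph) (v : V) :
    I.graph.vert (P.vNum v) = I.graph.verts.get (P.vNum v) := by
  simp [GraphData.vert]

theorem graph_edge (P : 𝔸.Presentation I.graph) (T : Quiver.Total V) :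
    I.graph.edge (P.eNum T) = I.graph.edges.get (P.eNum T) := by
  simp [GraphData.edge]

theorem answers_mem (hQ : AGraph.PowerReadingConditions Q) (u : U) (w : GWord) :
    (I.graph.vert (I.agraph.vert (Q.vNum u)).type).memCode.Answers
      ((I.agraph.vert (Q.vNum u)).gens, w) (GWord.eval (P.vGens (𝔹.type.obj u)) w ∈ 𝔹.vert u) := by
  have h := hQ.membership (𝔹.type.obj u) (I.agraph.verts.get (Q.vNum u)).gens w
  rw [agraph_vert, Q.vert_type, graph_vert]
  rwa [Q.gens] at h

theorem answers_pow (hQ : AGraph.PowerReadingConditions Q) (u : U) (w : GWord) :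
    (I.graph.vert (I.agraph.vert (Q.vNum u)).type).powCode.Answers
      ((I.agraph.vert (Q.vNum u)).gens, w)
      (∃ k : ℤ, k ≠ 0 ∧ GWord.eval (P.vGens (𝔹.type.obj u)) w ^ k ∈ 𝔹.vert u) := by
  have h := hQ.powerMembership (𝔹.type.obj u) (I.agraph.verts.get (Q.vNum u)).gens w
  rw [agraph_vert, Q.vert_type, graph_vert]
  rwa [Q.gens] at h

theorem eval_alpha (Q : 𝔹.Presentation P I.agraph) {u w : U} (f : u ⟶ w) :
    GWord.eval (P.vGens (𝔹.type.obj u)) (I.agraph.edge (Q.eNum ⟨u, w, f⟩)).alpha = 𝔹.lα f := by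
  rw [agraph_edge, Q.alpha]

theorem eval_omega (Q : 𝔹.Presentation P I.agraph) {u w : U} (f : u ⟶ w) :
    GWord.eval (P.vGens (𝔹.type.obj w)) (I.agraph.edge (Q.eNum ⟨u, w, f⟩)).omega = 𝔹.lω f := by
  rw [agraph_edge, Q.omega]

/-- The condition `x α_e(c)⁻¹ f_α⁻¹ ∈ B_u` for some `c` says that `f_α x⁻¹ B_u` meets
`α_e(A_e) ^ (f_α⁻¹)`. -/
theorem answers_inter (hQ : AGraph.PowerReadingConditions Q) {u w : U} (f : u ⟶ w) (x : GWord) :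
    I.agraph.interCode.Answers
      ((Q.eNum ⟨u, w, f⟩ : ℕ), (I.agraph.edge (Q.eNum ⟨u, w, f⟩)).alpha ++ x.inv)
      (∃ c, 𝔹.CanRead (GWord.eval (P.vGens (𝔹.type.obj u)) x) f c) := by
  obtain ⟨b, hb, h⟩ := hQ.intersection f ((I.agraph.edge (Q.eNum ⟨u, w, f⟩)).alpha ++ x.inv)
  refine ⟨b, hb, h.trans ?_⟩
  rw [GWord.eval_append, GWord.eval_inv, eval_alpha]
  generalize GWord.eval (P.vGens (𝔹.type.obj u)) x = a
  constructor
  · rintro ⟨b, hb, h⟩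
    obtain ⟨c, hc⟩ := (Subgroup.mem_conjBy _ _ _).1 h
    refine ⟨c⁻¹, ?_⟩
    have hb' : a * (𝔸.α (𝔹.type.map f) c⁻¹)⁻¹ * (𝔹.lα f)⁻¹ = b := by
      rw [map_inv, inv_inv, hc]
      group
    rw [CanRead, hb']
    exact hb
  · rintro ⟨c, hc⟩
    refine ⟨_, hc, ?_⟩
    rw [Subgroup.mem_conjBy]
    exact ⟨c⁻¹, by rw [map_inv]; group⟩

theorem eval_subst_alpha (P : 𝔸.Presentation I.graph) {v x : V} (e : v ⟶ x) (c : GWord) :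
    GWord.eval (P.vGens v) (GWord.subst (I.graph.edge (P.eNum ⟨v, x, e⟩)).alpha c) =
      𝔸.α e (GWord.eval (P.eGens e) c) := by
  rw [graph_edge]
  exact GWord.eval_subst (P.alpha e) c

theorem eval_subst_omega (P : 𝔸.Presentation I.graph) {v x : V} (e : v ⟶ x) (c : GWord) :
    GWord.eval (P.vGens x) (GWord.subst (I.graph.edge (P.eNum ⟨v, x, e⟩)).omega c) =
      𝔸.ω e (GWord.eval (P.eGens e) c) := by
  rw [graph_edge]
  exact GWord.eval_subst (P.omega e) c

/-- The state `s` of the program stands for a reading along `q` with the remaining path `r`; the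
list `l` gives the edges of `r`. -/
structure Matches (Q : 𝔹.Presentation P I.agraph) {u w : U} {x : V} (s : State) (q : 𝔹.Path u w)
    (r : 𝔸.Path (𝔹.type.obj w) x) (l : List (ℕ × GWord)) : Prop where
  vertex : s.2.1 = Q.vNum w
  describes : Q.Describes q s.2.2.2
  remaining : P.Describes r (s.2.2.1, l)

theorem eval_stepWord (Q : 𝔹.Presentation P I.agraph) {u w : U} (f : u ⟶ w) {s : State}
    (c : GWord) (x : GWord) :
    GWord.eval (P.vGens (𝔹.type.obj u))
      (I.stepWord s ((Q.eNum ⟨u, w, f⟩, c), (P.eNum ⟨_, _, 𝔹.type.map f⟩, x))) =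
      GWord.eval (P.vGens (𝔹.type.obj u)) s.2.2.1 *
        (𝔸.α (𝔹.type.map f) (GWord.eval (P.eGens (𝔹.type.map f)) c))⁻¹ * (𝔹.lα f)⁻¹ := by
  simp only [stepWord, GWord.eval_append, GWord.eval_inv, eval_alpha, eval_subst_alpha, mul_assoc]

theorem step_snd_describes (Q : 𝔹.Presentation P I.agraph) {u w y : U} {x : V} {s : State}
    {q : 𝔹.Path u w} {f : w ⟶ y} {r : 𝔸.Path (𝔹.type.obj y) x} {l : List (ℕ × GWord)}
    {c : GWord} {t : GWord} {k : ℕ} (hs : Q.Describes q s.2.2.2) (hr : P.Describes r (t, l))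
    (hc : 𝔹.CanRead (GWord.eval (P.vGens (𝔹.type.obj w)) s.2.2.1) f
      (GWord.eval (P.eGens (𝔹.type.map f)) c)) :
    Matches Q (I.step k s ((Q.eNum ⟨w, y, f⟩, c), (P.eNum ⟨_, _, 𝔹.type.map f⟩, t)))
      (q.comp (.cons (toVert hc) f (.nil 1)))
      (r.mulLeft ((𝔹.lω f)⁻¹ * 𝔸.ω (𝔹.type.map f) (GWord.eval (P.eGens (𝔹.type.map f)) c))) l := by
  refine ⟨?_, ?_, ?_⟩
  · change (I.agraph.edge (Q.eNum ⟨w, y, f⟩)).terminus = _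
    rw [agraph_edge, Q.terminus]
  · refine DescribedBy.comp ?_ hs ⟨eval_stepWord Q f c t, ([], []), rfl, rfl, rfl⟩
    rintro v a b s t rfl_a rfl_b
    rw [GWord.eval_append, rfl_a, rfl_b]
    rfl
  · refine DescribedBy.mulLeft ?_ ?_ hr
    · rintro v a b s t rfl rfl
      exact GWord.eval_append _ _ _
    · rw [GWord.eval_append, GWord.eval_inv, eval_omega, eval_subst_omega]

theorem exists_cons_of_describes {v x : V} {r : 𝔸.Path v x} {t : GWord} {e : ℕ × GWord}
    {l : List (ℕ × GWord)} (h : P.Describes r (t, e :: l)) :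
    ∃ (y : V) (e' : v ⟶ y) (r' : 𝔸.Path y x), r = .cons (GWord.eval (P.vGens v) t) e' r' ∧
      e.1 = P.eNum ⟨v, y, e'⟩ ∧ P.Describes r' (e.2, l) := by
  cases r with
  | nil a => exact absurd h.2 (List.cons_ne_nil _ _)
  | cons a e' r =>
    obtain ⟨ha, c, hc, hr⟩ := h
    obtain ⟨rfl, rfl⟩ := List.cons.inj hc
    exact ⟨_, e', r, by rw [← ha], rfl, hr⟩

theorem step_sound (hQ : AGraph.PowerReadingConditions Q) {u w : U} {x : V}
    {p : 𝔸.Path (𝔹.type.obj u) x} {q : 𝔹.Path u w} {r : 𝔸.Path (𝔹.type.obj w) x}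
    (hp : 𝔹.ReadsInitial p q r) {s : State} {k : ℕ} {t : TraceStep} {l : List (ℕ × GWord)}
    (hs : Matches Q s q r (t.2 :: l)) (hok : (I.step k s t).1 = true) :
    ∃ (w' : U) (q' : 𝔹.Path u w') (r' : 𝔸.Path (𝔹.type.obj w') x), 𝔹.ReadsInitial p q' r' ∧
      Matches Q (I.step k s t) q' r' l := by
  obtain ⟨⟨f, c⟩, ⟨e, t⟩⟩ := t
  simp only [step, Bool.and_eq_true, decide_eq_true_eq] at hok
  obtain ⟨-, hf, horig, htype, hmem⟩ := hok
  obtain ⟨⟨w₁, y, f'⟩, hf'⟩ := Q.eNum.surjective ⟨f, hf⟩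
  obtain rfl : (Q.eNum ⟨w₁, y, f'⟩ : ℕ) = f := congrArg Fin.val hf'
  obtain ⟨y', e', r', rfl, he, hr'⟩ := exists_cons_of_describes hs.remaining
  dsimp only at he hr'
  subst he
  rw [agraph_edge] at horig htype
  rw [Q.origin, hs.vertex] at horig
  obtain rfl := Q.vNum.injective (Fin.val_injective horig)
  rw [Q.edge_type] at htype
  have htype' := P.eNum.injective (Fin.val_injective htype)
  injection htype' with _ hy he
  subst hy
  obtain rfl := eq_of_heq he
  have hc : 𝔹.CanRead (GWord.eval (P.vGens (𝔹.type.obj w₁)) s.2.2.1) f'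
      (GWord.eval (P.eGens (𝔹.type.map f')) c) := by
    rw [hs.vertex] at hmem
    have := ((answers_mem hQ w₁ _).of_evaln hmem).1 rfl
    rwa [eval_stepWord] at this
  exact ⟨y, _, _, hp.step hc, step_snd_describes Q hs.describes hr' hc⟩

theorem fst_of_run_fst {k : ℕ} {s : State} {z : List TraceStep} (h : (I.run k s z).1 = true) :
    s.1 = true := by
  induction z generalizing s with
  | nil => exact h
  | cons t z ih =>
    have := ih h
    simp only [step, Bool.and_eq_true] at this
    exact this.1

theorem run_sound (hQ : AGraph.PowerReadingConditions Q) {u w : U} {x : V}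
    {p : 𝔸.Path (𝔹.type.obj u) x} {q : 𝔹.Path u w} {r : 𝔸.Path (𝔹.type.obj w) x}
    (hp : 𝔹.ReadsInitial p q r) {s : State} {k : ℕ} {z : List TraceStep} {l : List (ℕ × GWord)}
    (hs : Matches Q s q r (z.map Prod.snd ++ l)) (hok : (I.run k s z).1 = true) :
    ∃ (w' : U) (q' : 𝔹.Path u w') (r' : 𝔸.Path (𝔹.type.obj w') x), 𝔹.ReadsInitial p q' r' ∧
      Matches Q (I.run k s z) q' r' l := by
  induction z generalizing w s with
  | nil => exact ⟨w, q, r, hp, hs⟩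
  | cons t z ih =>
    obtain ⟨w', q', r', hp', hs'⟩ := step_sound hQ hp hs (fst_of_run_fst hok)
    exact ih hp' hs' hok

/-- A completed trace decides along which paths `p` is read. -/
theorem completes_sound (h𝔹 : 𝔹.Folded) (hQ : AGraph.PowerReadingConditions Q) {u w : U} {x : V}
    {p : 𝔸.Path (𝔹.type.obj u) x} {q : 𝔹.Path u w} {r : 𝔸.Path (𝔹.type.obj w) x}
    (hp : 𝔹.ReadsInitial p q r) {s : State} {k : ℕ} {z : List TraceStep} {l : List (ℕ × GWord)}
    (hs : Matches Q s q r l) (hz : I.Completes k s l z) :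
    ∃ w' : U, (I.run k s z).2.1 = Q.vNum w' ∧
      (∀ u', 𝔹.Readable u u' p ↔ w' = u' ∧
        GWord.eval (P.vGens (𝔹.type.obj w')) (I.run k s z).2.2.1 ∈ 𝔹.vert w') ∧
      (GWord.eval (P.vGens (𝔹.type.obj w')) (I.run k s z).2.2.1 ∈ 𝔹.vert w' →
        ∃ q' : 𝔹.Path u w', Q.Describes q'
          ((I.run k s z).2.2.2.comp ((I.run k s z).2.2.1, [])) ∧ 𝔹.Reads q' p) ∧
      (p.Reduced → ¬ 𝔹.Blocked u p) := by
  obtain ⟨w', q', r', hp', hs'⟩ := run_sound hQ hp (l := [])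
    (by rwa [List.append_nil, hz.2]) hz.1
  refine ⟨w', hs'.vertex, ?_⟩
  have hrem := hs'.remaining
  cases r' with
  | cons a e r' =>
    obtain ⟨-, c, hc, -⟩ := hrem
    exact absurd hc.symm (List.cons_ne_nil _ _)
  | nil a =>
    have ha : GWord.eval (P.vGens (𝔹.type.obj w')) (I.run k s z).2.2.1 = a := hrem.1
    rw [ha]
    refine ⟨fun u' => hp'.readable.trans h𝔹.readable_nil_iff, fun hmem => ?_, hp'.not_blocked⟩
    refine ⟨q'.comp (.nil (toVert hmem)), ?_, rfl, rfl, ?_⟩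
    · refine DescribedBy.comp ?_ hs'.describes ⟨ha, rfl⟩
      rintro v a b s t ha hb
      rw [GWord.eval_append, ha, hb]
      rfl
    · change (𝔹.μ _).Equivalent p
      rw [μ_comp]
      exact hp'.equivalent

/-- A trace that comes to a halt proves that `p` is blocked. -/
theorem halts_sound (h𝔹 : 𝔹.Folded) (hQ : AGraph.PowerReadingConditions Q) {u w : U} {x : V}
    {p : 𝔸.Path (𝔹.type.obj u) x} {q : 𝔹.Path u w} {r : 𝔸.Path (𝔹.type.obj w) x}
    (hp : 𝔹.ReadsInitial p q r) {s : State} {k : ℕ} {z : List TraceStep} {l : List (ℕ × GWord)}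
    (hs : Matches Q s q r l) (hz : I.Halts k s l z) : 𝔹.Blocked u p := by
  obtain ⟨hok, htake, hlen, hedges⟩ := hz
  obtain ⟨w', q', r', hp', hs'⟩ := run_sound hQ hp (l := l.drop z.length)
    (by rwa [htake, List.take_append_drop]) hok
  rw [List.drop_eq_getElem_cons hlen] at hs'
  obtain ⟨y, e, r'', rfl, he, -⟩ := exists_cons_of_describes hs'.remaining
  refine hp'.blocked h𝔹 fun y' f c hf hc => ?_
  rcases hedges (Q.eNum ⟨w', y', f⟩) (Fin.is_lt _) with h | h | h
  · rw [agraph_edge, Q.origin, hs'.vertex] at h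
    exact h rfl
  · rw [agraph_edge, Q.edge_type, List.getD_eq_getElem _ _ hlen, he] at h
    refine h ?_
    cases hf
    rfl
  · exact absurd (((answers_inter hQ f _).of_evaln h).2 ⟨c, hc⟩) Bool.false_ne_true

/-- Every path has a trace that is completed or comes to a halt. -/
theorem exists_trace (hQ : AGraph.PowerReadingConditions Q) {w : U} {x : V}
    {r : 𝔸.Path (𝔹.type.obj w) x} {s : State} {l : List (ℕ × GWord)} (hok : s.1 = true)
    (hv : s.2.1 = Q.vNum w) (hr : P.Describes r (s.2.2.1, l)) :
    ∃ z, (∀ᶠ k in Filter.atTop, I.Halts k s l z) ∨ ∃ b, ∀ᶠ k in Filter.atTop,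
      I.Completes k s l z ∧ I.MemAnswer k b (I.run k s z).2.1 (I.run k s z).2.2.1 := by
  classical
  induction l generalizing w s with
  | nil =>
    refine ⟨[], .inr ⟨decide (GWord.eval (P.vGens (𝔹.type.obj w)) s.2.2.1 ∈ 𝔹.vert w), ?_⟩⟩
    filter_upwards [(answers_mem hQ w s.2.2.1).eventually (decide_eq_true_iff)] with k hk
    refine ⟨⟨hok, rfl⟩, ?_⟩
    rw [← hv] at hk
    exact hk
  | cons e l ih =>
    obtain ⟨y, e', r', rfl, he, hr'⟩ := exists_cons_of_describes hr
    by_cases hstuck : 𝔹.Stuck w (GWord.eval (P.vGens (𝔹.type.obj w)) s.2.2.1) e'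
    · refine ⟨[], .inl ?_⟩
      have hall : ∀ᶠ k in Filter.atTop, ∀ f ∈ Set.Iio I.agraph.edges.length,
          ¬ (I.agraph.edge f).origin = s.2.1 ∨ ¬ (I.agraph.edge f).type = e.1 ∨
            I.EdgeDenied k f s.2.2.1 := by
        refine (Filter.eventually_all_finite (Set.finite_Iio _)).2 fun f hf => ?_
        obtain ⟨⟨w₁, y', f'⟩, hf'⟩ := Q.eNum.surjective ⟨f, hf⟩
        obtain rfl : (Q.eNum ⟨w₁, y', f'⟩ : ℕ) = f := congrArg Fin.val hf'
        rw [agraph_edge, Q.origin, Q.edge_type, hv, he]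
        by_cases h₁ : (Q.vNum w₁ : ℕ) = Q.vNum w
        · obtain rfl := Q.vNum.injective (Fin.val_injective h₁)
          by_cases h₂ : (P.eNum ⟨_, _, 𝔹.type.map f'⟩ : ℕ) = P.eNum ⟨_, _, e'⟩
          · have h₂' := P.eNum.injective (Fin.val_injective h₂)
            injection h₂' with _ hy he'
            subst hy
            obtain rfl := eq_of_heq he'
            have hno : (false = true) ↔ ∃ c, 𝔹.CanRead
                (GWord.eval (P.vGens (𝔹.type.obj w₁)) s.2.2.1) f' c :=
              ⟨fun h => absurd h Bool.false_ne_true, fun ⟨c, hc⟩ => absurd hc (hstuck _ f' c rfl)⟩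
            filter_upwards [(answers_inter hQ f' s.2.2.1).eventually hno] with k hk
            exact .inr (.inr hk)
          · exact .of_forall fun k => .inr (.inl h₂)
        · exact .of_forall fun k => .inl h₁
      filter_upwards [hall] with k hk
      exact ⟨hok, rfl, Nat.succ_pos _, hk⟩
    · simp only [Stuck, not_forall, not_not] at hstuck
      obtain ⟨y', f, c, hf, hc⟩ := hstuck
      injection hf with hy he'
      subst hy
      obtain rfl := eq_of_heq he'
      obtain ⟨c, rfl⟩ := GWord.exists_eval_eq (P.closure_eGens (𝔹.type.map f)) c
      obtain ⟨e, t⟩ := e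
      dsimp only at he hr'
      subst he
      set step' : TraceStep := ((Q.eNum ⟨w, y', f⟩, c), (P.eNum ⟨_, _, 𝔹.type.map f⟩, t)) with
          hstep'
      have hok' : ∀ᶠ k in Filter.atTop, I.step k s step' = (true, (I.step 0 s step').2) := by
        have hmem : (true = true) ↔ GWord.eval (P.vGens (𝔹.type.obj w)) (I.stepWord s step') ∈
            𝔹.vert w := by
          rw [hstep', eval_stepWord]
          exact iff_of_true rfl hc
        filter_upwards [(answers_mem hQ w (I.stepWord s step')).eventually hmem] with k hk
        refine Prod.ext ?_ rfl
        rw [← hv] at hk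
        simp only [step, hok, Bool.and_eq_true, decide_eq_true_eq, true_and]
        refine ⟨Fin.is_lt _, ?_, ?_, hk⟩
        · rw [hstep', agraph_edge, Q.origin, hv]
        · rw [hstep', agraph_edge, Q.edge_type]
      have hdesc := step_snd_describes Q (k := 0) (q := .nil (1 : 𝔹.toGraphOfGroups.vert w))
        (s := (true, s.2.1, s.2.2.1, ([], []))) (c := c) ⟨rfl, rfl⟩ hr' hc
      obtain ⟨z, hz⟩ := ih (s := (true, (I.step 0 s step').2)) rfl hdesc.vertex hdesc.remaining
      refine ⟨step' :: z, hz.imp (fun hz => ?_) (fun ⟨b, hz⟩ => ⟨b, ?_⟩)⟩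
      · filter_upwards [hz, hok'] with k hk hk'
        obtain ⟨h₁, h₂, h₃, h₄⟩ := hk
        have hrun : I.run k s (step' :: z) = I.run k (true, (I.step 0 s step').2) z := by
          rw [← hk']; rfl
        refine ⟨hrun ▸ h₁, ?_, Nat.succ_lt_succ h₃, hrun ▸ h₄⟩
        simp [h₂, hstep']
      · filter_upwards [hz, hok'] with k hk hk'
        obtain ⟨⟨h₁, h₂⟩, h₃⟩ := hk
        have hrun : I.run k s (step' :: z) = I.run k (true, (I.step 0 s step').2) z := by
          rw [← hk']; rfl
        rw [Completes, hrun]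
        exact ⟨⟨h₁, by rw [List.map_cons, h₂]⟩, h₃⟩

end ReadPowerInput

/-! ### Correctness and termination of the search -/

namespace ReadPowerInput

open GraphOfGroups GraphOfGroups.Path AGraph

variable {V : Type u₁} [Quiver.{v₁} V] [HasInvolutiveReverse V]
  {𝔸 : GraphOfGroups.{u₁, u₃, u₄, v₁} V} {U : Type u₂} [Quiver.{v₂} U] [HasInvolutiveReverse U]
  {𝔹 : AGraph 𝔸 U} {I : ReadPowerInput} {P : 𝔸.Presentation I.graph}
  {Q : 𝔹.Presentation P I.agraph} {u u' : U} {p : 𝔸.Path (𝔹.type.obj u) (𝔹.type.obj u)}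

theorem _root_.AGraph.Blocked.not_readable {w : U} {v x : V} {p : 𝔸.Path v x} (h : 𝔹.Blocked u p)
    (hp : p.Reduced) : ¬ 𝔹.Readable u w p := by
  have := h (.nil 1)
  rw [comp_nil_one] at this
  exact this hp w

theorem matches_init (hstart : I.start = Q.vNum u) (hl : P.Describes p I.loop) (m : ℕ) :
    Matches Q (I.init m) (.nil 1 : 𝔹.Path u u) (p.pow (m + 1)) (I.loop.powSucc m).2 :=
  ⟨hstart, ⟨rfl, rfl⟩, DescribedBy.powSucc (by
    rintro v a b s t rfl rfl
    exact GWord.eval_append _ _ _) hl m⟩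

theorem accepts_sound (h𝔹 : 𝔹.Folded) (hQ : AGraph.PowerReadingConditions Q)
    (hstart : I.start = Q.vNum u) (hl : P.Describes p I.loop) {k m : ℕ} {z : List TraceStep}
    (h : I.Accepts k m z (Q.vNum u')) :
    ∃ q : 𝔹.Path u u', Q.Describes q (I.output k m z) ∧ 𝔹.Reads q (p.pow (m + 1)) := by
  obtain ⟨hz, hv, hmem⟩ := h
  obtain ⟨w, hw, -, hq, -⟩ :=
    completes_sound h𝔹 hQ (.refl (p.pow (m + 1))) (matches_init hstart hl m) hz
  rw [hw] at hv
  obtain rfl := Q.vNum.injective (Fin.val_injective hv)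
  rw [hw] at hmem
  exact hq (((answers_mem hQ w _).of_evaln hmem).1 rfl)

theorem blocked_of_halts (h𝔹 : 𝔹.Folded) (hQ : AGraph.PowerReadingConditions Q)
    (hstart : I.start = Q.vNum u) (hl : P.Describes p I.loop) {k m : ℕ} {z : List TraceStep}
    (h : I.Halts k (I.init m) (I.loop.powSucc m).2 z) : 𝔹.Blocked u (p.pow (m + 1)) :=
  halts_sound h𝔹 hQ (.refl _) (matches_init hstart hl m) h

theorem rejects_sound (h𝔹 : 𝔹.Folded) (hQ : AGraph.PowerReadingConditions Q)
    (hstart : I.start = Q.vNum u) (hfinish : I.finish = Q.vNum u') (hl : P.Describes p I.loop)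
    (hp : p.CyclicallyReduced) {k m : ℕ} {z : List TraceStep} (h : I.Rejects k m z) :
    ¬ 𝔹.Readable u u' (p.pow (m + 1)) := by
  rcases h with ⟨hz, h⟩ | h
  · obtain ⟨w, hw, hread, -, -⟩ :=
      completes_sound h𝔹 hQ (.refl (p.pow (m + 1))) (matches_init hstart hl m) hz
    rw [hread]
    rintro ⟨rfl, hmem⟩
    rw [hw] at h
    exact h.elim (fun h => h hfinish.symm) fun h =>
      Bool.false_ne_true (((answers_mem hQ w _).of_evaln h).2 hmem)
  · exact (blocked_of_halts h𝔹 hQ hstart hl h).not_readable (hp.pow_succ_reduced m)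

/-- For each exponent there is a trace that proves, if enough time is granted, whatever is true
about the reading of this power. -/
theorem exists_conclusive_trace (h𝔹 : 𝔹.Folded) (hQ : AGraph.PowerReadingConditions Q)
    (hstart : I.start = Q.vNum u) (hfinish : I.finish = Q.vNum u') (hl : P.Describes p I.loop)
    (hp : p.CyclicallyReduced) (m : ℕ) : ∃ z,
      (∀ w, 𝔹.Readable u w (p.pow (m + 1)) →
        ∀ᶠ k in Filter.atTop, I.Accepts k m z (Q.vNum w)) ∧
      (¬ 𝔹.Readable u u' (p.pow (m + 1)) → ∀ᶠ k in Filter.atTop, I.Rejects k m z) ∧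
      (𝔹.Blocked u (p.pow (m + 1)) →
        ∀ᶠ k in Filter.atTop, I.Halts k (I.init m) (I.loop.powSucc m).2 z) := by
  have hinit := matches_init hstart hl m
  have hred := hp.pow_succ_reduced m
  obtain ⟨z, hz | ⟨b, hz⟩⟩ := exists_trace hQ (s := I.init m) rfl hinit.vertex hinit.remaining
  · refine ⟨z, fun w hw => ?_, fun _ => hz.mono fun k hk => .inr hk, fun _ => hz⟩
    obtain ⟨k, hk⟩ := hz.exists
    exact absurd hw ((blocked_of_halts h𝔹 hQ hstart hl hk).not_readable hred)
  · refine ⟨z, fun w hw => ?_, fun hu' => ?_, fun hb => ?_⟩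
    · filter_upwards [hz] with k ⟨hk, hmem⟩
      obtain ⟨w', hw', hread, -, -⟩ := completes_sound h𝔹 hQ (.refl _) hinit hk
      obtain ⟨rfl, hend⟩ := (hread w).1 hw
      refine ⟨hk, hw', ?_⟩
      have hb := hmem
      rw [hw'] at hb
      rwa [((answers_mem hQ w' _).of_evaln hb).2 hend] at hmem
    · filter_upwards [hz] with k ⟨hk, hmem⟩
      obtain ⟨w', hw', hread, -, -⟩ := completes_sound h𝔹 hQ (.refl _) hinit hk
      refine .inl ⟨hk, ?_⟩
      rw [hread] at hu'
      by_cases hw : w' = u'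
      · have hb := hmem
        rw [hw'] at hb
        have := mt ((answers_mem hQ w' _).of_evaln hb).1 fun h => hu' ⟨hw, h⟩
        rw [Bool.not_eq_true] at this
        exact .inr (this ▸ hmem)
      · refine .inl fun h => hw ?_
        rw [hw', hfinish] at h
        exact Q.vNum.injective (Fin.val_injective h)
    · obtain ⟨k, hk, -⟩ := hz.exists
      obtain ⟨-, -, -, -, h⟩ := completes_sound h𝔹 hQ (.refl _) hinit hk
      exact absurd hb (h hred)

theorem type_start (hstart : I.start = Q.vNum u) :
    (I.agraph.vert I.start).type = P.vNum (𝔹.type.obj u) := by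
  rw [hstart, agraph_vert, Q.vert_type]

/-- Some certificate proves an answer. -/
theorem exists_verdict (h𝔹 : 𝔹.Folded) (hQ : AGraph.PowerReadingConditions Q)
    (hstart : I.start = Q.vNum u) (hfinish : I.finish = Q.vNum u') (hl : P.Describes p I.loop)
    (hp : p.CyclicallyReduced) : ∃ C, (I.verdict C).isSome = true := by
  classical
  choose z hacc hrej hhalt using exists_conclusive_trace h𝔹 hQ hstart hfinish hl hp
  by_cases h : ∃ m, 𝔹.Readable u u' (p.pow (m + 1)) ∨ 𝔹.Readable u u (p.pow (m + 1)) ∨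
      𝔹.Blocked u (p.pow (m + 1))
  -- The least exponent at which the search can stop is the exponent of the certificate.
  · obtain ⟨M, hM, hmin⟩ : ∃ M, (𝔹.Readable u u' (p.pow (M + 1)) ∨
        𝔹.Readable u u (p.pow (M + 1)) ∨ 𝔹.Blocked u (p.pow (M + 1))) ∧
        ∀ m < M, ¬ 𝔹.Readable u u' (p.pow (m + 1)) :=
      ⟨Nat.find h, Nat.find_spec h, fun m hm hr => Nat.find_min h hm (.inl hr)⟩
    have hrejM : ∀ᶠ k in Filter.atTop, ∀ m ∈ Set.Iio M, I.Rejects k m (z m) :=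
      (Filter.eventually_all_finite (Set.finite_Iio M)).2 fun m hm => hrej m (hmin m hm)
    have htrace (k : ℕ) {m : ℕ} (hm : m < M + 1) :
        trace (k, M, (List.range (M + 1)).map z) m = z m := by
      simp [trace, hm]
    by_cases hM' : 𝔹.Readable u u' (p.pow (M + 1))
    · obtain ⟨k, hk, hk'⟩ := (hrejM.and (hacc M u' hM')).exists
      refine ⟨(k, M, (List.range (M + 1)).map z), ?_⟩
      have h₂ : (∀ m < M, I.Rejects k m (trace (k, M, (List.range (M + 1)).map z) m)) ∧
          I.Accepts k M (trace (k, M, (List.range (M + 1)).map z) M) I.finish := by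
        rw [htrace k (Nat.lt_succ_self M), hfinish]
        refine ⟨fun m hm => ?_, hk'⟩
        rw [htrace k (hm.trans (Nat.lt_succ_self M))]
        exact hk m hm
      unfold verdict
      split_ifs <;> rfl
    · have hend : ∀ᶠ k in Filter.atTop, I.Accepts k M (z M) I.start ∨
          I.Halts k (I.init M) (I.loop.powSucc M).2 (z M) := by
        rcases hM with hM | hM | hM
        · exact absurd hM hM'
        · rw [hstart]
          exact (hacc M u hM).mono fun k hk => .inl hk
        · exact (hhalt M hM).mono fun k hk => .inr hk
      obtain ⟨k, ⟨hk, hkM⟩, hk'⟩ := ((hrejM.and (hrej M hM')).and hend).exists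
      refine ⟨(k, M, (List.range (M + 1)).map z), ?_⟩
      have h₃ : (∀ m < M + 1, I.Rejects k m (trace (k, M, (List.range (M + 1)).map z) m)) ∧
          (I.Accepts k M (trace (k, M, (List.range (M + 1)).map z) M) I.start ∨
            I.Halts k (I.init M) (I.loop.powSucc M).2
              (trace (k, M, (List.range (M + 1)).map z) M)) := by
        rw [htrace k (Nat.lt_succ_self M)]
        refine ⟨fun m hm => ?_, hk'⟩
        rw [htrace k hm]
        rcases Nat.lt_succ_iff_lt_or_eq.1 hm with hm | rfl
        · exact hk m hm
        · exact hkM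
      unfold verdict
      split_ifs <;> rfl
  -- Otherwise the length is `0`, and no power of the group element lies in the vertex group.
  · push Not at h
    have : Finite (Quiver.Total U) := Finite.of_equiv _ Q.eNum.symm
    have hlen : p.length = 0 := by
      by_contra hlen
      obtain ⟨m, hm, hm'⟩ := h𝔹.exists_loop_or_blocked
        (fun u => Q.gens u ▸ GWord.span_fg _ _) hQ.finiteIndex hQ.cycle hp hlen
      obtain ⟨m, rfl⟩ := Nat.exists_eq_succ_of_ne_zero hm.ne'
      exact hm'.elim (h m).2.1 (h m).2.2
    obtain ⟨a, rfl⟩ := exists_eq_nil hlen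
    have hno : (false = true) ↔ ∃ k : ℤ, k ≠ 0 ∧
        GWord.eval (P.vGens (𝔹.type.obj u)) I.loop.1 ^ k ∈ 𝔹.vert u := by
      refine ⟨fun h => absurd h Bool.false_ne_true, fun ⟨k, hk, hmem⟩ => ?_⟩
      rw [hl.1] at hmem
      obtain ⟨n, hn⟩ := Nat.exists_eq_succ_of_ne_zero (Int.natAbs_ne_zero.2 hk)
      refine absurd ?_ (h n).2.1
      rw [nil_pow, h𝔹.readable_nil_iff, ← Nat.succ_eq_add_one, ← hn]
      refine ⟨rfl, ?_⟩
      rcases Int.natAbs_eq k with hk | hk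
      · rwa [hk, zpow_natCast] at hmem
      · rwa [hk, zpow_neg, zpow_natCast, inv_mem_iff] at hmem
    obtain ⟨k, hk⟩ := ((answers_pow hQ u I.loop.1).eventually hno).exists
    refine ⟨(k, 0, []), ?_⟩
    have h₄ : I.loop.2 = [] ∧ I.PowDenied k I.start I.loop.1 := ⟨hl.2, hstart ▸ hk⟩
    unfold verdict
    split_ifs <;> rfl

/-- If a loop at `u` reads `p ^ (M + 1)`, or if this power is blocked, then it suffices to examine
    the
exponents up to `M + 1`. -/
theorem not_readable_of_loop_or_blocked (hp : p.CyclicallyReduced) {M : ℕ}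
    (hM : ∀ m < M + 1, ¬ 𝔹.Readable u u' (p.pow (m + 1)))
    (h : 𝔹.Readable u u (p.pow (M + 1)) ∨ 𝔹.Blocked u (p.pow (M + 1))) (m : ℕ) :
    ¬ 𝔹.Readable u u' (p.pow (m + 1)) := by
  induction m using Nat.strong_induction_on with
  | _ m ih =>
    intro hm
    rcases lt_or_ge m (M + 1) with hlt | hge
    · exact hM m hlt hm
    obtain ⟨n, rfl⟩ := Nat.exists_eq_add_of_le hge
    rcases h with h | h
    · exact ih n (by omega) (h.shorten hm)
    · rw [add_assoc, Path.pow_add] at hm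
      refine h _ ?_ _ hm
      rw [← Path.pow_add, ← add_assoc]
      exact hp.pow_succ_reduced _

/-- Every answer that a certificate proves is correct. -/
theorem verdict_sound (h𝔹 : 𝔹.Folded) (hQ : AGraph.PowerReadingConditions Q)
    (hstart : I.start = Q.vNum u) (hfinish : I.finish = Q.vNum u')
    (hbase : I.base = P.vNum (𝔹.type.obj u)) (hl : P.Describes p I.loop)
    (hp : p.CyclicallyReduced) {C : Certificate} {out : Option (PathCode × ℕ)}
    (h : I.verdict C = some out) :
    (out = none ∧ ∀ m, ¬ 𝔹.Readable u u' (p.pow (m + 1))) ∨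
      ∃ c m, out = some (c, m + 1) ∧
        (∃ q : 𝔹.Path u u', Q.Describes q c ∧ 𝔹.Reads q (p.pow (m + 1))) ∧
        ∀ n < m, ¬ 𝔹.Readable u u' (p.pow (n + 1)) := by
  unfold verdict at h
  split_ifs at h with h₁ h₂ h₃ h₄
  · obtain rfl := Option.some.inj h
    refine .inr ⟨_, _, rfl, ?_, fun n hn => rejects_sound h𝔹 hQ hstart hfinish hl hp (h₂.1 n hn)⟩
    have := h₂.2
    rw [hfinish] at this
    exact accepts_sound h𝔹 hQ hstart hl this
  · obtain rfl := Option.some.inj h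
    refine .inl ⟨rfl, not_readable_of_loop_or_blocked hp
      (fun m hm => rejects_sound h𝔹 hQ hstart hfinish hl hp (h₃.1 m hm)) ?_⟩
    refine h₃.2.imp (fun h => ?_) (blocked_of_halts h𝔹 hQ hstart hl)
    rw [hstart] at h
    obtain ⟨q, -, hq⟩ := accepts_sound h𝔹 hQ hstart hl h
    exact ⟨q, hq⟩
  · obtain rfl := Option.some.inj h
    refine .inl ⟨rfl, fun m hm => ?_⟩
    obtain ⟨hnil, hpow⟩ := h₄
    cases p with
    | cons a e p =>
      obtain ⟨-, c, hc, -⟩ := hl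
      exact List.cons_ne_nil _ _ (hc.symm.trans hnil)
    | nil a =>
      rw [nil_pow, h𝔹.readable_nil_iff] at hm
      rw [PowDenied, hstart] at hpow
      refine Bool.false_ne_true (((answers_pow hQ u I.loop.1).of_evaln hpow).2
        ⟨(m + 1 : ℕ), by omega, ?_⟩)
      rw [hl.1, zpow_natCast]
      exact hm.2
  · exact absurd ((type_start hstart).trans hbase.symm) h₁

end ReadPowerInput

theorem mainTheorem7 :
    ∃ readPower : ReadPowerInput →. Option (PathCode × ℕ), Partrec readPower ∧
      ∀ (V : Type u₁) [Quiver.{v₁} V] [HasInvolutiveReverse V]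
        (U : Type u₂) [Quiver.{v₂} U] [HasInvolutiveReverse U]
        (𝔸 : GraphOfGroups.{u₁, u₃, u₄, v₁} V) (𝔹 : AGraph 𝔸 U) (_ : 𝔹.Folded)
        (d : GraphData) (P : 𝔸.Presentation d) (d' : AGraphData) (Q : 𝔹.Presentation P d')
        (_ : AGraph.PowerReadingConditions Q)
        (v : V) (p : 𝔸.Path v v) (_ : p.CyclicallyReduced)
        (l : PathCode) (_ : P.Describes p l) (u' u'' : U),
        ∃ out ∈ readPower ⟨d, d', P.vNum v, l, Q.vNum u', Q.vNum u''⟩,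
          (out.isSome = true ↔
            ∃ (q : 𝔹.Path u' u'') (m : ℕ), 0 < m ∧ 𝔹.Reads q (p.pow m)) ∧
          ∀ (c : PathCode) (m : ℕ), out = some (c, m) →
            0 < m ∧
            (∃ q : 𝔹.Path u' u'', Q.Describes q c ∧ 𝔹.Reads q (p.pow m)) ∧
            ∀ (q' : 𝔹.Path u' u'') (m' : ℕ), 0 < m' → 𝔹.Reads q' (p.pow m') → m ≤ m' := by
  refine ⟨ReadPowerInput.readPower, ReadPowerInput.partrec_readPower, ?_⟩
  intro V _ _ U _ _ 𝔸 𝔹 h𝔹 d P d' Q hQ v p hp l hl u' u''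
  let I : ReadPowerInput := ⟨d, d', P.vNum v, l, Q.vNum u', Q.vNum u''⟩
  -- Some certificate is conclusive, and the verdict of every certificate is correct.
  obtain ⟨⟨C, hC⟩, hsound⟩ : (∃ C, (I.verdict C).isSome = true) ∧ ∀ C out, I.verdict C = some out →
      (out = none ∧ ∀ m, ¬ 𝔹.Readable u' u'' (p.pow (m + 1))) ∨
      ∃ c m, out = some (c, m + 1) ∧
        (∃ q : 𝔹.Path u' u'', Q.Describes q c ∧ 𝔹.Reads q (p.pow (m + 1))) ∧
        ∀ n < m, ¬ 𝔹.Readable u' u'' (p.pow (n + 1)) := by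
    by_cases hv : 𝔹.type.obj u' = v
    · subst hv
      exact ⟨ReadPowerInput.exists_verdict (I := I) h𝔹 hQ rfl rfl hl hp, fun C out =>
        ReadPowerInput.verdict_sound (I := I) h𝔹 hQ rfl rfl rfl hl hp⟩
    · have hne : ¬ (I.agraph.vert I.start).type = I.base := by
        rw [ReadPowerInput.type_start (I := I) (P := P) (Q := Q) (u := u') rfl]
        exact fun h => hv (P.vNum.injective (Fin.val_injective h))
      have hverdict (C) : I.verdict C = some none := by
        rw [ReadPowerInput.verdict, if_pos hne]
      refine ⟨⟨(0, 0, []), by rw [hverdict]; rfl⟩, fun C out h => .inl ⟨?_, ?_⟩⟩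
      · rw [hverdict] at h
        exact (Option.some.inj h).symm
      · rintro m ⟨q, hq, -⟩
        exact hv hq
  have hdom : (I.readPower).Dom := by
    refine Nat.rfindOpt_dom.2 ⟨Encodable.encode C, (I.verdict C).get hC, ?_⟩
    rw [Encodable.encodek, Option.bind_some]
    exact Option.get_mem hC
  refine ⟨_, Part.get_mem hdom, ?_⟩
  obtain ⟨n, hn⟩ := Nat.rfindOpt_spec (Part.get_mem hdom)
  generalize (I.readPower).get hdom = out at hn ⊢
  obtain ⟨C, -, hC⟩ := Option.bind_eq_some_iff.1 hn
  rcases hsound C out hC with ⟨rfl, hno⟩ | ⟨c, m, rfl, hq, hmin⟩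
  · refine ⟨⟨fun h => absurd h Bool.false_ne_true, ?_⟩, fun c m h => by cases h⟩
    rintro ⟨q, m, hm, hq⟩
    obtain ⟨m, rfl⟩ := Nat.exists_eq_succ_of_ne_zero hm.ne'
    exact absurd ⟨q, hq⟩ (hno m)
  · refine ⟨⟨fun _ => ?_, fun _ => rfl⟩, fun c' m' h => ?_⟩
    · obtain ⟨q, -, hq⟩ := hq
      exact ⟨q, m + 1, Nat.succ_pos m, hq⟩
    · cases h
      refine ⟨Nat.succ_pos m, hq, fun q' n hn hq' => ?_⟩
      obtain ⟨n, rfl⟩ := Nat.exists_eq_succ_of_ne_zero hn.ne'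
      by_contra hlt
      exact hmin n (by omega) ⟨q', hq'⟩
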